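/- For a finite simple graph $\Gamma$ with vertex set $\mathcal V$ and edge set $\mathcal E$, consider the Ising model with spin configurations $\sigma:\mathcal V\to\{\pm1\}$, Hamiltonian $$H(\sigma)=-J\sum_{\{v,w\}\in\mathcal E}\sigma(v)\sigma(w)-hM(\sigma),\qquad M(\sigma)=\tfrac12\sum_{\{v,w\}\in\mathcal E}(\sigma(v)+\sigma(w)),$$ and partition function $Z(z,t)=\sum_\sigma e^{-H(\sigma)/T}$, written in the variables $z=e^{-h/T}$, $t=e^{-2J/T}$. Let $\check Z(z,t)=z^{|\mathcal E|}t^{|\mathcal E|/2}Z(z,t)$, which is a polynomial in $(z,t)$. Its zero divisor in $\mathbb C^2$ (the zero curve, components counted with multiplicities) is the divisor $\mathcal S^c$ of Lee-Yang-Fisher zeros, and $[\mathcal S^c]$ is the $(1,1)$-current of integration over it: the sum, over the irreducible components $C$ with their multiplicities, of $\omega\mapsto\int_{C_{\mathrm{reg}}}\omega$, where $C_{\mathrm{reg}}$ is the set of regular points of $C$. Let $(\Gamma_n)_{n\ge0}$ be any sequence (a hierarchy) of finite simple graphs, each with at least one edge, with polynomials $\check Z_n$, edge sets $\mathcal E_n$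 and Lee-Yang-Fisher divisors $\mathcal S^c_n$. Suppose that $$\frac1{2|\mathcal E_n|}\log|\check Z_n(z,t)|\longrightarrow\mathcal F(z,t)\quad\text{in }L^1_{\mathrm{loc}}(\mathbb C^2).$$ Then each $[\mathcal S^c_n]$ is a well-defined $(1,1)$-current on $\mathbb C^2$ (the integrals over regular points converge), and there is a closed positive $(1,1)$-current $\mu^c$ on $\mathbb C^2$ such that $$\frac1{2|\mathcal E_n|}[\mathcal S^c_n]\longrightarrow\mu^c$$ in the sense of distributions, that is, when tested against every smooth compactly supported $(1,1)$-form. Moreover the limiting free energy $\mathcal F$ is a pluripotential of $\mu^c$: $\mathcal F$ agrees almost everywhere with a plurisubharmonic function $G:\mathbb C^2\to[-\infty,\infty)$ such that $\frac i\pi\partial\bar\partial G=\mu^c$ in the sense of distributions. -/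

import Mathlib

open MeasureTheory Filter Topology TopologicalSpace

noncomputable section

namespace LeeYangFisher

/-! ### The Ising model on a finite graph -/

section Ising

variable {V : Type*}

/-- The product `σ(v) σ(w)` of the spins at the two ends of an edge `{v, w}`. -/
def edgeProd (σ : V → ℤˣ) (e : Sym2 V) : ℤ :=
  Sym2.lift ⟨fun v w => (σ v : ℤ) * (σ w : ℤ), fun _ _ => mul_comm _ _⟩ e

/-- The sum `σ(v) + σ(w)` of the spins at the two ends of an edge `{v, w}`. -/
def edgeSum (σ : V → ℤˣ) (e : Sym2 V) : ℤ :=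
  Sym2.lift ⟨fun v w => (σ v : ℤ) + (σ w : ℤ), fun _ _ => add_comm _ _⟩ e

variable [Fintype V] [DecidableEq V] (Γ : SimpleGraph V) [DecidableRel Γ.Adj]

/-- The number of edges `|ℰ|`. -/
def numEdges : ℕ := Γ.edgeFinset.card

/-- `I(σ) = ∑_{{v,w} ∈ ℰ} σ(v) σ(w)`. -/
def interaction (σ : V → ℤˣ) : ℤ := ∑ e ∈ Γ.edgeFinset, edgeProd σ e

/-- `2 M(σ) = ∑_{{v,w} ∈ ℰ} (σ(v) + σ(w))`, twice the magnetic moment. -/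
def twiceMoment (σ : V → ℤˣ) : ℤ := ∑ e ∈ Γ.edgeFinset, edgeSum σ e

/-- The Hamiltonian `H(σ) = -J ∑ σ(v) σ(w) - h M(σ)`, with `M(σ) = ½ ∑ (σ(v) + σ(w))`. -/
def hamiltonian (J h : ℝ) (σ : V → ℤˣ) : ℝ :=
  -J * (interaction Γ σ : ℝ) - h * ((1 / 2) * (twiceMoment Γ σ : ℝ))

/-- The partition function `Z = ∑_σ exp (-H(σ) / T)`. -/
def partitionFunction (J h T : ℝ) : ℝ :=
  ∑ σ : V → ℤˣ, Real.exp (-hamiltonian Γ J h σ / T)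

/-- The polynomial `Ž(z, t) = z ^ |ℰ| * t ^ (|ℰ| / 2) * Z(z, t)` in `z = exp (-h / T)` (variable `0`)
and `t = exp (-2 J / T)` (variable `1`). As `exp (-H(σ) / T) = z ^ (-M(σ)) * t ^ (-I(σ) / 2)`, the
configuration `σ` contributes the monomial `z ^ (|ℰ| - M(σ)) * t ^ ((|ℰ| - I(σ)) / 2)`; both
exponents are natural numbers. See `clearedPartition_eval`. -/
def clearedPartition : MvPolynomial (Fin 2) ℂ :=
  ∑ σ : V → ℤˣ,
    MvPolynomial.X 0 ^ ((numEdges Γ : ℤ) - twiceMoment Γ σ / 2).toNat *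
      MvPolynomial.X 1 ^ (((numEdges Γ : ℤ) - interaction Γ σ) / 2).toNat


end Ising
theorem edge_bounds {V : Type*} (σ : V → ℤˣ) (e : Sym2 V) :
    (∃ a : ℕ, 2 - edgeSum σ e = 2 * a) ∧ (∃ b : ℕ, 1 - edgeProd σ e = 2 * b) := by
  induction e with
  | h v w =>
    simp only [edgeSum, edgeProd, Sym2.lift_mk]
    rcases Int.units_eq_one_or (σ v) with h1 | h1 <;>
      rcases Int.units_eq_one_or (σ w) with h2 | h2 <;> simp only [h1, h2]
    · exact ⟨⟨0, by norm_num⟩, ⟨0, by norm_num⟩⟩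
    · exact ⟨⟨1, by norm_num⟩, ⟨1, by norm_num⟩⟩
    · exact ⟨⟨1, by norm_num⟩, ⟨1, by norm_num⟩⟩
    · exact ⟨⟨2, by norm_num⟩, ⟨0, by norm_num⟩⟩

theorem exponents_exact {V : Type*} [Fintype V] [DecidableEq V] (Γ : SimpleGraph V)
    [DecidableRel Γ.Adj] (σ : V → ℤˣ) :
    2 * ((((numEdges Γ : ℤ) - twiceMoment Γ σ / 2).toNat : ℕ) : ℤ)
        = 2 * (numEdges Γ : ℤ) - twiceMoment Γ σ ∧
      2 * (((((numEdges Γ : ℤ) - interaction Γ σ) / 2).toNat : ℕ) : ℤ)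
        = (numEdges Γ : ℤ) - interaction Γ σ := by
  choose a ha using fun e => (edge_bounds σ e).1
  choose b hb using fun e => (edge_bounds σ e).2
  have h1 : 2 * (numEdges Γ : ℤ) - twiceMoment Γ σ
      = 2 * ((∑ e ∈ Γ.edgeFinset, a e : ℕ) : ℤ) := by
    have : ∑ e ∈ Γ.edgeFinset, (2 - edgeSum σ e) = ∑ e ∈ Γ.edgeFinset, 2 * (a e : ℤ) :=
      Finset.sum_congr rfl fun e _ => ha e
    rw [Finset.sum_sub_distrib, Finset.sum_const, ← Finset.mul_sum] at this
    simp only [nsmul_eq_mul] at this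
    push_cast
    rw [← this, numEdges, twiceMoment]
    ring
  have h2 : (numEdges Γ : ℤ) - interaction Γ σ
      = 2 * ((∑ e ∈ Γ.edgeFinset, b e : ℕ) : ℤ) := by
    have : ∑ e ∈ Γ.edgeFinset, (1 - edgeProd σ e) = ∑ e ∈ Γ.edgeFinset, 2 * (b e : ℤ) :=
      Finset.sum_congr rfl fun e _ => hb e
    rw [Finset.sum_sub_distrib, Finset.sum_const, ← Finset.mul_sum] at this
    simp only [nsmul_eq_mul] at this
    push_cast
    rw [← this, numEdges, interaction]
    ring
  constructor <;> omega

/-- The polynomial `Ž` evaluated at `z = exp (-h / T)`, `t = exp (-2 J / T)` is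
`z ^ |ℰ| * t ^ (|ℰ| / 2)` times the partition function. -/
theorem clearedPartition_eval {V : Type*} [Fintype V] [DecidableEq V] (Γ : SimpleGraph V)
    [DecidableRel Γ.Adj] (J h T : ℝ) :
    MvPolynomial.eval ![(Real.exp (-h / T) : ℂ), (Real.exp (-(2 * J) / T) : ℂ)] (clearedPartition Γ)
      = ((Real.exp (-h / T) ^ numEdges Γ * Real.exp (-(2 * J) / T) ^ ((numEdges Γ : ℝ) / 2)
          * partitionFunction Γ J h T : ℝ) : ℂ) := by
  rw [clearedPartition, partitionFunction, Finset.mul_sum]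
  simp only [map_sum, map_mul, map_pow, MvPolynomial.eval_X, Matrix.cons_val_zero,
    Matrix.cons_val_one]
  rw [Complex.ofReal_sum]
  refine Finset.sum_congr rfl fun σ _ => ?_
  rw [← Complex.ofReal_pow, ← Complex.ofReal_pow, ← Complex.ofReal_mul, Complex.ofReal_inj]
  obtain ⟨h1, h2⟩ := exponents_exact Γ σ
  generalize ((numEdges Γ : ℤ) - twiceMoment Γ σ / 2).toNat = a at h1 ⊢
  generalize (((numEdges Γ : ℤ) - interaction Γ σ) / 2).toNat = b at h2 ⊢
  have h1' : 2 * (a : ℝ) = 2 * (numEdges Γ : ℝ) - (twiceMoment Γ σ : ℝ) := by exact_mod_cast h1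
  have h2' : 2 * (b : ℝ) = (numEdges Γ : ℝ) - (interaction Γ σ : ℝ) := by exact_mod_cast h2
  have h1'' : (twiceMoment Γ σ : ℝ) = 2 * (numEdges Γ : ℝ) - 2 * a := by linarith
  have h2'' : (interaction Γ σ : ℝ) = (numEdges Γ : ℝ) - 2 * b := by linarith
  rw [← Real.exp_nat_mul, ← Real.exp_nat_mul, ← Real.exp_nat_mul, ← Real.exp_mul, ← Real.exp_add,
    ← Real.exp_add, ← Real.exp_add, hamiltonian, h1'', h2'']
  congr 1
  ring

/-- The free energy `𝓕(z, t) = log |Ž(z, t)|`. -/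
def freeEnergy {V : Type*} [Fintype V] [DecidableEq V] (Γ : SimpleGraph V) [DecidableRel Γ.Adj]
    (p : ℂ × ℂ) : ℝ :=
  Real.log ‖MvPolynomial.eval ![p.1, p.2] (clearedPartition Γ)‖

/-- Convergence in `L¹_loc(ℂ²)`. -/
def TendstoL1Loc (f : ℕ → ℂ × ℂ → ℝ) (F : ℂ × ℂ → ℝ) : Prop :=
  LocallyIntegrable F ∧
    ∀ K : Set (ℂ × ℂ), IsCompact K →
      Tendsto (fun n => ∫⁻ p in K, ‖f n p - F p‖ₑ) atTop (𝓝 0)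

/-! ### Test forms and `(1,1)`-currents on `ℂ²`

Write `z₀, z₁` for the coordinates of `ℂ²`. -/

/-- Smooth compactly supported `(1,1)`-forms `ω = ∑ ω_{jk} (i/2) dz_j ∧ dz̄_k` on `ℂ²`, given by
their coefficients `ω p j k`, with the usual topology of test functions. -/
abbrev TestForm : Type := TestFunction (⊤ : Opens (ℂ × ℂ)) (Fin 2 → Fin 2 → ℂ) ⊤

/-- Smooth compactly supported functions `ℂ² → ℂ²`: the coefficients of a `(1,0)`-form
`∑ a_j dz_j`, or of a `(0,1)`-form `∑ b_k dz̄_k`. -/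
abbrev TestCovector : Type := TestFunction (⊤ : Opens (ℂ × ℂ)) (Fin 2 → ℂ) ⊤

/-- A `(1,1)`-current on `ℂ²`: a continuous linear functional on test `(1,1)`-forms. -/
abbrev Current : Type := TestForm →L[ℂ] ℂ

/-- The standard basis of `ℂ²`. -/
def basisVec : Fin 2 → ℂ × ℂ := ![(1, 0), (0, 1)]

/-- The Wirtinger derivative `∂f/∂z_j`. -/
def dHol (j : Fin 2) (f : ℂ × ℂ → ℂ) (p : ℂ × ℂ) : ℂ :=
  (1 / 2) * (fderiv ℝ f p (basisVec j) - Complex.I * fderiv ℝ f p (Complex.I • basisVec j))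

/-- The Wirtinger derivative `∂f/∂z̄_k`. -/
def dAnti (k : Fin 2) (f : ℂ × ℂ → ℂ) (p : ℂ × ℂ) : ℂ :=
  (1 / 2) * (fderiv ℝ f p (basisVec k) + Complex.I * fderiv ℝ f p (Complex.I • basisVec k))

/-- For a `(1,1)`-covector `w = ∑ w_{jk} (i/2) dz_j ∧ dz̄_k` and a vector `v`, the number
`w(v, iv) = ∑ w_{jk} v_j v̄_k`. For a holomorphic curve `s ↦ γ(s)` the pullback `γ^* ω` is
`(ω_{γ(s)}).onLine (γ'(s))` times the area form `(i/2) ds ∧ ds̄`. -/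
def onLine (w : Fin 2 → Fin 2 → ℂ) (v : Fin 2 → ℂ) : ℂ :=
  ∑ j, ∑ k, w j k * v j * (starRingEnd ℂ) (v k)

/-- A `(1,1)`-form on `ℂ²` is positive if its restriction to every complex line (equivalently,
curve) is a nonnegative multiple of the area form. -/
def TestForm.IsPositive (ω : TestForm) : Prop :=
  ∀ p v, 0 ≤ (onLine (ω p) v).re ∧ (onLine (ω p) v).im = 0

/-- A `(1,1)`-current is positive if it is nonnegative on positive test forms. -/
def Current.IsPositive (μ : Current) : Prop :=
  ∀ ω : TestForm, ω.IsPositive → 0 ≤ (μ ω).re ∧ (μ ω).im = 0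

/-- `dμ = 0`: the current `μ` vanishes on `dη` for every test `1`-form
`η = ∑ a_j dz_j + ∑ b_k dz̄_k`. By bidegree only the `(1,1)`-part of `dη` matters, which is
`∑ (∂b_k/∂z_j - ∂a_j/∂z̄_k) dz_j ∧ dz̄_k`, where `dz_j ∧ dz̄_k = -2i · (i/2) dz_j ∧ dz̄_k`. -/
def Current.IsClosed (μ : Current) : Prop :=
  ∀ (a b : TestCovector) (ω : TestForm),
    (∀ p j k, ω p j k =
      -2 * Complex.I * (dHol j (fun q => b q k) p - dAnti k (fun q => a q j) p)) →
    μ ω = 0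

/-- The density with respect to Lebesgue measure of the `4`-form `(i/π) ∂∂̄ω`, for a test
`(1,1)`-form `ω`. With `∂∂̄ω = ∑ ∂_l ∂̄_m ω_{jk} dz_l ∧ dz̄_m ∧ (i/2) dz_j ∧ dz̄_k` and
`dV = (i/2) dz₀ ∧ dz̄₀ ∧ (i/2) dz₁ ∧ dz̄₁`, the nonzero terms have `{l, j} = {m, k} = {0, 1}`. -/
def ddbarDensity (ω : TestForm) (p : ℂ × ℂ) : ℂ :=
  (2 / Real.pi) *
    (dHol 0 (dAnti 0 fun q => ω q 1 1) p + dHol 1 (dAnti 1 fun q => ω q 0 0) p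
      - dHol 0 (dAnti 1 fun q => ω q 1 0) p - dHol 1 (dAnti 0 fun q => ω q 0 1) p)

/-! ### Plurisubharmonic functions and pluripotentials -/

/-- The mean of `u : ℂ² → [-∞, ∞)` over the circle `θ ↦ a + e^{iθ} b`: the mean of the positive part
minus the mean of the negative part. -/
def circleMean (u : ℂ × ℂ → EReal) (a b : ℂ × ℂ) : EReal :=
  (((ENNReal.ofReal (2 * Real.pi))⁻¹ *
      ∫⁻ θ in Set.Ioc 0 (2 * Real.pi), (u (a + Complex.exp (θ * Complex.I) • b)).toENNReal :
        ENNReal) : EReal) -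
  (((ENNReal.ofReal (2 * Real.pi))⁻¹ *
      ∫⁻ θ in Set.Ioc 0 (2 * Real.pi), (-u (a + Complex.exp (θ * Complex.I) • b)).toENNReal :
        ENNReal) : EReal)

/-- Plurisubharmonic functions `ℂ² → [-∞, ∞)`: upper semicontinuous, and submean on every circle in
every complex line. -/
structure IsPSH (u : ℂ × ℂ → EReal) : Prop where
  ne_top : ∀ p, u p ≠ ⊤
  usc : UpperSemicontinuous u
  submean : ∀ a b, u a ≤ circleMean u a b

/-- `G` is a pluripotential of `μ`: `G` is plurisubharmonic (and a genuine, that is almost everywhere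
finite and locally integrable, function) and `(i/π) ∂∂̄G = μ` in the sense of distributions. -/
structure IsPluripotential (G : ℂ × ℂ → EReal) (μ : Current) : Prop where
  psh : IsPSH G
  ae_ne_bot : ∀ᵐ p, G p ≠ ⊥
  locallyIntegrable : LocallyIntegrable fun p => (G p).toReal
  ddbar : ∀ ω : TestForm, μ ω = ∫ p, ((G p).toReal : ℂ) * ddbarDensity ω p

/-! ### Currents of integration over algebraic curves and divisors -/

/-- The value at `p` of the polynomial `Q(z, t)`. -/
def ev (Q : MvPolynomial (Fin 2) ℂ) (p : ℂ × ℂ) : ℂ := MvPolynomial.eval ![p.1, p.2] Q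

/-- The partial derivatives `∂Q/∂z` (`j = 0`) and `∂Q/∂t` (`j = 1`) at `p`. -/
def evDeriv (Q : MvPolynomial (Fin 2) ℂ) (j : Fin 2) (p : ℂ × ℂ) : ℂ :=
  ev (MvPolynomial.pderiv j Q) p

/-- On the part `{∂Q/∂t ≠ 0}` of the curve `C = {Q = 0}`, `z` is a local coordinate, and `C` is
locally a graph with tangent vector `(1, -Q_z/Q_t)`. This is the function on the `z`-line whose
integral is the integral of `ω` over that part of `C`: the sum over the points of `C` above `z`. -/
def fibreSumZ (Q : MvPolynomial (Fin 2) ℂ) (ω : TestForm) (z : ℂ) : ℂ :=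
  ∑ᶠ t ∈ {t : ℂ | ev Q (z, t) = 0 ∧ evDeriv Q 1 (z, t) ≠ 0},
    onLine (ω (z, t)) ![1, -(evDeriv Q 0 (z, t) / evDeriv Q 1 (z, t))]

/-- On the remaining regular points `{∂Q/∂t = 0, ∂Q/∂z ≠ 0}` of the curve `C = {Q = 0}`, `t` is a
local coordinate, with tangent vector `(-Q_t/Q_z, 1) = (0, 1)`. This is the function on the `t`-line
whose integral is the integral of `ω` over that part of `C`. -/
def fibreSumT (Q : MvPolynomial (Fin 2) ℂ) (ω : TestForm) (t : ℂ) : ℂ :=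
  ∑ᶠ z ∈ {z : ℂ | ev Q (z, t) = 0 ∧ evDeriv Q 1 (z, t) = 0 ∧ evDeriv Q 0 (z, t) ≠ 0},
    onLine (ω (z, t)) ![0, 1]

/-- `∫_{C_reg} ω` for the curve `C = {Q = 0}` of an irreducible polynomial `Q`; its regular points
are those points of `C` at which `(∂Q/∂z, ∂Q/∂t) ≠ 0`. -/
def curveIntegral (Q : MvPolynomial (Fin 2) ℂ) (ω : TestForm) : ℂ :=
  (∫ z, fibreSumZ Q ω z) + ∫ t, fibreSumT Q ω t

/-- `S` is the current of integration over the zero divisor `∑ m_i C_i` of the polynomial `P`: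
the sum of `∫_{(C_i)_reg} ω` over the irreducible factors of `P`, counted with multiplicities,
these integrals being convergent. -/
def IsZeroDivisorCurrent (P : MvPolynomial (Fin 2) ℂ) (S : Current) : Prop :=
  ∀ ω : TestForm,
    (∀ Q ∈ UniqueFactorizationMonoid.factors P,
      Integrable (fibreSumZ Q ω) ∧ Integrable (fibreSumT Q ω)) ∧
    S ω = ((UniqueFactorizationMonoid.factors P).map fun Q => curveIntegral Q ω).sum

end LeeYangFisher

end

/-!
# Lee-Yang-Fisher currents and limiting free energies

The current of integration over the zero divisor of a nonzero polynomial `P` is `(i/π) ∂∂̄ log |P|`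
(the Poincaré-Lelong formula, `isZeroDivisorCurrent_ddbarCurrent`), and the operator `(i/π) ∂∂̄` is
continuous from `L¹_loc` to currents (`tendsto_ddbarCurrent`), because it acts by integration against
a smooth compactly supported density. So the normalized currents of the Lee-Yang-Fisher zeros
converge to `μ = (i/π) ∂∂̄F`, where `F` is the limiting free energy. This current is closed since
partial derivatives commute (`ddbarCurrent_isClosed`), and positive as a limit of nonnegative
multiples of currents of integration over curves (`curveIntegral_nonneg`). It remains to prove the
Poincaré-Lelong formula, and to find a plurisubharmonic representative of `F`.

**The Poincaré-Lelong formula.** As `log |P|` is, up to a constant, the sum of `log |Q|` over the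
irreducible factors `Q` of `P`, it is enough to treat an irreducible `Q` (`poincare_lelong`).
Replacing `log |Q|` by `½ log (|Q|² + ε)` shows that `∂ log |Q| = ∂Q / (2Q)` in the sense of
distributions (`integral_log_mul_dHol`). By Gauss' lemma, `Q` has only simple zeros on almost every
coordinate line (`finite_setOf_ev_evDeriv_one_eq_zero`), so by partial fractions and the
Cauchy-Pompeiu formula `∂̄` turns `∂Q / Q` into a sum of point masses on almost every such line
(`integral_logDeriv_mul_dAnti_one`, `integral_logDeriv_mul_dAnti_zero`). On the lines `{z} × ℂ` this
gives the three terms of `∫ ω` that involve `dz` or `dz̄`, as integrals over the `z`-line.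

The term `dt ∧ dt̄` comes from the lines `ℂ × {t}` as an integral over the `t`-line, whereas the
definition of `∫ ω` integrates over the `z`-line wherever `z` is a local coordinate on the curve. The
change of coordinate (`integral_slope_add_eq`) needs no local parametrizations: `∂̄ (1 / Q)` is the
limit of `ε conj(dQ) / (|Q|² + ε)²` as `ε → 0`, so it is killed by the `(0,1)`-forms whose wedge
product with `conj(dQ)` is a multiple of `|Q|²` (`integral_logDeriv_mul_dAnti_add_eq_zero`).
This relates integrals over the two lines, with weights that damp the points where `z` is not a local
coordinate (`integral_dampedSlope_eq`); the damping is then removed, by Fatou's lemma for the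
integrability and by dominated convergence for the value.

**The plurisubharmonic representative.** By Jensen's formula, the means of `log |Pₙ|` over circles in
complex lines increase with the radius, and bound the value at the centre from above
(`isSubharmonicOnLines_log_norm`). Averaging over the directions of the lines, the means of
`log |Pₙ|` over the balls of a given radius form a continuous function that is submean on circles and
increases with the radius. Convergence in `L¹_loc` implies pointwise convergence of these means, so
the ball means of `F` have the same properties (`ballMean_mono_of_tendstoL1Loc`,
`ballMean_le_circleAverage_of_tendstoL1Loc`). Their limit for radius tending to `0` is therefore
plurisubharmonic, as a decreasing limit of such functions (`isPSH_iInf`), and it is equal to `F`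
almost everywhere by the Lebesgue differentiation theorem (`exists_isPSH_of_tendstoL1Loc`).
-/

noncomputable section

namespace LeeYangFisher

open scoped ContDiff ComplexConjugate

/-! ### Wirtinger derivatives -/

section Wirtinger

variable {E : Type*} [NormedAddCommGroup E] [NormedSpace ℂ E]

/-- The first-order operator `½ (D_v + s D_{iv})`. For `s = -i` and `s = i` these are the Wirtinger
derivatives `∂` and `∂̄` in the direction `v`. -/
def wirt (s : ℂ) (v : E) (f : E → ℂ) (p : E) : ℂ :=
  (1 / 2) * (fderiv ℝ f p v + s * fderiv ℝ f p (Complex.I • v))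

theorem dHol_eq_wirt (j : Fin 2) : dHol j = wirt (-Complex.I) (basisVec j) := by
  funext f p
  simp [dHol, wirt, sub_eq_add_neg]

theorem dAnti_eq_wirt (j : Fin 2) : dAnti j = wirt Complex.I (basisVec j) := rfl

variable {f g : E → ℂ} {s s' : ℂ} {v w : E} {p : E}

theorem wirt_mul (hf : DifferentiableAt ℝ f p) (hg : DifferentiableAt ℝ g p) :
    wirt s v (fun q => f q * g q) p = wirt s v f p * g p + f p * wirt s v g p := by
  simp only [wirt]
  rw [fderiv_fun_mul hf hg]
  simp only [add_apply, smul_apply, smul_eq_mul]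
  ring

theorem wirt_add (hf : DifferentiableAt ℝ f p) (hg : DifferentiableAt ℝ g p) :
    wirt s v (fun q => f q + g q) p = wirt s v f p + wirt s v g p := by
  simp only [wirt]
  rw [fderiv_fun_add hf hg]
  simp only [add_apply]
  ring

theorem wirt_sub (hf : DifferentiableAt ℝ f p) (hg : DifferentiableAt ℝ g p) :
    wirt s v (fun q => f q - g q) p = wirt s v f p - wirt s v g p := by
  simp only [wirt]
  rw [fderiv_fun_sub hf hg]
  simp only [sub_apply]
  ring

theorem wirt_const_mul (c : ℂ) (hf : DifferentiableAt ℝ f p) :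
    wirt s v (fun q => c * f q) p = c * wirt s v f p := by
  rw [wirt_mul (differentiableAt_const c) hf]
  simp [wirt]

theorem wirt_congr (h : f =ᶠ[𝓝 p] g) : wirt s v f p = wirt s v g p := by
  simp only [wirt, h.fderiv_eq]

theorem wirt_comp_conj (hf : DifferentiableAt ℝ f p) :
    wirt s v (fun q => conj (f q)) p = conj (wirt (conj s) v f p) := by
  have h : fderiv ℝ (fun q => conj (f q)) p =
      Complex.conjCLE.toContinuousLinearMap ∘L fderiv ℝ f p :=
    (Complex.conjCLE.toContinuousLinearMap.hasFDerivAt.comp p hf.hasFDerivAt).fderiv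
  have h2 : conj (2 : ℂ) = 2 := Complex.conj_ofNat 2
  simp [wirt, h, h2]

theorem wirt_I_of_differentiableAt (hf : DifferentiableAt ℂ f p) : wirt Complex.I v f p = 0 := by
  have h := hf.fderiv_restrictScalars ℝ
  simp only [wirt, h, ContinuousLinearMap.coe_restrictScalars', map_smul, smul_eq_mul]
  linear_combination (1 / 2 : ℂ) * fderiv ℂ f p v * Complex.I_mul_I

theorem wirt_neg_I_of_differentiableAt (hf : DifferentiableAt ℂ f p) :
    wirt (-Complex.I) v f p = fderiv ℂ f p v := by
  have h := hf.fderiv_restrictScalars ℝ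
  simp only [wirt, h, ContinuousLinearMap.coe_restrictScalars', map_smul, smul_eq_mul]
  linear_combination (-1 / 2 : ℂ) * fderiv ℂ f p v * Complex.I_mul_I

theorem contDiff_wirt (hf : ContDiff ℝ ∞ f) : ContDiff ℝ ∞ (wirt s v f) := by
  have h : ∀ w, ContDiff ℝ ∞ fun p => fderiv ℝ f p w := fun w =>
    (hf.fderiv_right (m := ∞) (by simp)).clm_apply contDiff_const
  exact contDiff_const.mul ((h v).add (contDiff_const.mul (h _)))

theorem tsupport_wirt_subset : tsupport (wirt s v f) ⊆ tsupport f := by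
  refine closure_minimal (fun p hp => ?_) (isClosed_tsupport f)
  by_contra h
  refine hp ?_
  simp [wirt, fderiv_of_notMem_tsupport ℝ h]

theorem hasCompactSupport_wirt (hf : HasCompactSupport f) : HasCompactSupport (wirt s v f) :=
  hf.of_isClosed_subset (isClosed_tsupport _) tsupport_wirt_subset

theorem fderiv_fderiv_comm (hf : ContDiff ℝ ∞ f) :
    fderiv ℝ (fun q => fderiv ℝ f q v) p w = fderiv ℝ (fun q => fderiv ℝ f q w) p v := by
  have hd : DifferentiableAt ℝ (fderiv ℝ f) p :=
    (hf.fderiv_right (m := ∞) (by simp)).differentiable (by simp) p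
  rw [fderiv_clm_apply hd (differentiableAt_const _),
      fderiv_clm_apply hd (differentiableAt_const _)]
  simpa using second_derivative_symmetric (f := f) (f' := fderiv ℝ f) (fun y =>
    (hf.differentiable (by simp) y).hasFDerivAt) hd.hasFDerivAt w v

theorem wirt_comm (hf : ContDiff ℝ ∞ f) :
    wirt s v (wirt s' w f) p = wirt s' w (wirt s v f) p := by
  have h : ∀ w : E, DifferentiableAt ℝ (fun p => fderiv ℝ f p w) p := fun w =>
    ((hf.fderiv_right (m := ∞) (by simp)).clm_apply contDiff_const).differentiable (by simp) p
  have key : ∀ (s : ℂ) (v x : E), fderiv ℝ (wirt s v f) p x =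
      (1 / 2) * (fderiv ℝ (fun q => fderiv ℝ f q v) p x +
        s * fderiv ℝ (fun q => fderiv ℝ f q (Complex.I • v)) p x) := by
    intro s v x
    change fderiv ℝ (fun q => (1 / 2) * (fderiv ℝ f q v + s * fderiv ℝ f q (Complex.I • v))) p x = _
    have h1 : DifferentiableAt ℝ (fun q => s * fderiv ℝ f q (Complex.I • v)) p :=
      (h _).const_mul _
    rw [fderiv_const_mul (a := fun q => fderiv ℝ f q v + s * fderiv ℝ f q (Complex.I • v))
      ((h _).add h1), fderiv_fun_add (h _) h1, fderiv_const_mul (h _)]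
    simp [mul_add]
  simp only [wirt.eq_1 s v (wirt s' w f), wirt.eq_1 s' w (wirt s v f), key]
  rw [fderiv_fderiv_comm (v := w) (w := v) hf, fderiv_fderiv_comm (v := w) (w := Complex.I • v) hf,
    fderiv_fderiv_comm (v := Complex.I • w) (w := v) hf,
    fderiv_fderiv_comm (v := Complex.I • w) (w := Complex.I • v) hf]
  ring

theorem integral_wirt_eq_zero [FiniteDimensional ℝ E] [MeasurableSpace E] [BorelSpace E]
    {μ : Measure E} [μ.IsAddHaarMeasure] (hf : ContDiff ℝ ∞ f) (hc : HasCompactSupport f) :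
    ∫ p, wirt s v f p ∂μ = 0 := by
  have hi : ∀ w, Integrable (fun p => fderiv ℝ f p w) μ := fun w =>
    ((hf.fderiv_right (m := ∞) (by simp)).clm_apply
        contDiff_const).continuous.integrable_of_hasCompactSupport
      (hc.fderiv_apply ℝ w)
  have h0 : ∀ w, ∫ p, fderiv ℝ f p w ∂μ = 0 := by
    intro w
    have := integral_smul_fderiv_eq_neg_fderiv_smul_of_integrable (𝕜 := ℝ) (μ := μ)
      (f := fun _ : E => (1 : ℝ)) (g := f) (v := w) (by simp) (by simpa using hi w)
      (by simpa using hf.continuous.integrable_of_hasCompactSupport hc) (by simp)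
      (fun x _ => hf.differentiable (by simp) x)
    simpa using this
  simp only [wirt]
  rw [integral_const_mul, integral_add (hi _) ((hi _).const_mul _), integral_const_mul, h0, h0]
  simp

/-- Integration by parts. -/
theorem integral_mul_wirt [FiniteDimensional ℝ E] [MeasurableSpace E] [BorelSpace E]
    {μ : Measure E} [μ.IsAddHaarMeasure] (hf : ContDiff ℝ ∞ f) (hg : ContDiff ℝ ∞ g)
    (hc : HasCompactSupport g) :
    ∫ p, f p * wirt s v g p ∂μ = -∫ p, wirt s v f p * g p ∂μ := by
  have h1 : Integrable (fun p => f p * wirt s v g p) μ :=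
    (hf.continuous.mul (contDiff_wirt hg).continuous).integrable_of_hasCompactSupport
      (hasCompactSupport_wirt hc).mul_left
  have h2 : Integrable (fun p => wirt s v f p * g p) μ :=
    ((contDiff_wirt hf).continuous.mul hg.continuous).integrable_of_hasCompactSupport hc.mul_left
  have h3 := integral_wirt_eq_zero (s := s) (v := v) (μ := μ) (hf.mul hg) hc.mul_left
  rw [eq_neg_iff_add_eq_zero, ← integral_add h1 h2, ← h3]
  congr 1
  funext p
  rw [wirt_mul (hf.differentiable (by simp) p) (hg.differentiable (by simp) p)]
  ring

end Wirtinger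

/-- The volume of `ℂ × ℂ` is by definition the product measure. -/
instance : (volume : Measure (ℂ × ℂ)).IsAddHaarMeasure :=
  inferInstanceAs ((volume : Measure ℂ).prod (volume : Measure ℂ)).IsAddHaarMeasure

/-! ### Polynomials in two variables as functions -/

section Polynomials

variable (Q : MvPolynomial (Fin 2) ℂ)

@[simp] theorem basisVec_zero : basisVec 0 = (1, 0) := rfl
@[simp] theorem basisVec_one : basisVec 1 = (0, 1) := rfl

@[simp] theorem ev_C (a : ℂ) (p : ℂ × ℂ) : ev (MvPolynomial.C a) p = a := by simp [ev]

theorem ev_X_zero : ev (MvPolynomial.X 0) = Prod.fst := by funext p; simp [ev]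

theorem ev_X_one : ev (MvPolynomial.X 1) = Prod.snd := by funext p; simp [ev]

@[simp] theorem ev_add (P Q : MvPolynomial (Fin 2) ℂ) (p : ℂ × ℂ) :
    ev (P + Q) p = ev P p + ev Q p := by simp [ev]

@[simp] theorem ev_mul (P Q : MvPolynomial (Fin 2) ℂ) (p : ℂ × ℂ) :
    ev (P * Q) p = ev P p * ev Q p := by simp [ev]

theorem hasFDerivAt_ev (p : ℂ × ℂ) :
    HasFDerivAt (ev Q) (evDeriv Q 0 p • ContinuousLinearMap.fst ℂ ℂ ℂ +
      evDeriv Q 1 p • ContinuousLinearMap.snd ℂ ℂ ℂ) p := by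
  induction Q using MvPolynomial.induction_on with
  | C a =>
    have : ev (MvPolynomial.C a) = fun _ => a := by funext p; simp
    rw [this]
    refine (hasFDerivAt_const (𝕜 := ℂ) a p).congr_fderiv ?_
    ext <;> simp [evDeriv, ev]
  | add P Q hP hQ =>
    have : ev (P + Q) = fun p => ev P p + ev Q p := by funext p; simp
    rw [this]
    refine (hP.add hQ).congr_fderiv ?_
    ext <;> simp [evDeriv, ev]
  | mul_X P i hP =>
    have : ev (P * MvPolynomial.X i) = fun p => ev P p * ev (MvPolynomial.X i) p := by
      funext p; simp
    rw [this]
    have hX : HasFDerivAt (ev (MvPolynomial.X i)) (evDeriv (MvPolynomial.X i) 0 p •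
        ContinuousLinearMap.fst ℂ ℂ ℂ + evDeriv (MvPolynomial.X i) 1 p •
        ContinuousLinearMap.snd ℂ ℂ ℂ) p := by
      fin_cases i
      · simp only [Fin.zero_eta, ev_X_zero]
        refine hasFDerivAt_fst.congr_fderiv ?_
        ext <;> simp [evDeriv, ev, MvPolynomial.pderiv_X]
      · simp only [Fin.mk_one, ev_X_one]
        refine hasFDerivAt_snd.congr_fderiv ?_
        ext <;> simp [evDeriv, ev, MvPolynomial.pderiv_X]
    refine (hP.mul hX).congr_fderiv ?_
    ext <;> simp [evDeriv, ev, Derivation.leibniz]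

theorem contDiff_ev {n : WithTop ℕ∞} : ContDiff ℂ n (ev Q) := by
  induction Q using MvPolynomial.induction_on with
  | C a =>
    have : ev (MvPolynomial.C a) = fun _ => a := by funext p; simp
    exact this ▸ contDiff_const
  | add P Q hP hQ =>
    have : ev (P + Q) = fun p => ev P p + ev Q p := by funext p; simp
    exact this ▸ hP.add hQ
  | mul_X P i hP =>
    have : ev (P * MvPolynomial.X i) = fun p => ev P p * ev (MvPolynomial.X i) p := by
      funext p; simp
    refine this ▸ hP.mul ?_
    fin_cases i
    · exact ev_X_zero ▸ contDiff_fst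
    · exact ev_X_one ▸ contDiff_snd

theorem contDiff_real_ev {n : WithTop ℕ∞} : ContDiff ℝ n (ev Q) :=
    (contDiff_ev Q).restrict_scalars ℝ

theorem contDiff_real_evDeriv (j : Fin 2) {n : WithTop ℕ∞} : ContDiff ℝ n (evDeriv Q j) :=
  contDiff_real_ev _

theorem continuous_ev : Continuous (ev Q) := (contDiff_ev Q (n := 0)).continuous

theorem continuous_evDeriv (j : Fin 2) : Continuous (evDeriv Q j) := continuous_ev _

theorem dHol_ev (j : Fin 2) (p : ℂ × ℂ) : dHol j (ev Q) p = evDeriv Q j p := by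
  rw [dHol_eq_wirt, wirt_neg_I_of_differentiableAt (hasFDerivAt_ev Q p).differentiableAt,
    (hasFDerivAt_ev Q p).fderiv]
  fin_cases j <;> simp

theorem dAnti_ev (j : Fin 2) (p : ℂ × ℂ) : dAnti j (ev Q) p = 0 := by
  rw [dAnti_eq_wirt, wirt_I_of_differentiableAt (hasFDerivAt_ev Q p).differentiableAt]

theorem dAnti_conj_ev (j : Fin 2) (p : ℂ × ℂ) :
    dAnti j (fun q => conj (ev Q q)) p = conj (evDeriv Q j p) := by
  rw [dAnti_eq_wirt, wirt_comp_conj ((contDiff_real_ev Q (n := 1)).differentiable (by simp) p),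
    Complex.conj_I, ← dHol_eq_wirt, dHol_ev]

end Polynomials

/-! ### The Cauchy kernel -/

section CauchyKernel

theorem integrableOn_ball_inv : IntegrableOn (fun t : ℂ => t⁻¹) (Metric.ball 0 1) := by
  have h : IntegrableOn (fun t : ℂ => ‖t‖⁻¹) (Metric.ball 0 1) := by
    have := (integrableOn_fun_norm_addHaar (μ := (volume : Measure ℂ)) (f := fun r : ℝ => r⁻¹)
      (r := 1)).2 ?_
    · exact this
    · refine (integrableOn_const (C := (1 : ℝ)) (s := Set.Ioo (0 : ℝ) 1) (by simp)).congr_fun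
        (fun y hy => ?_) measurableSet_Ioo
      have : y ≠ 0 := hy.1.ne'
      simp [Complex.finrank_real_complex, this]
  refine h.mono' (by fun_prop) ?_
  simp

/-- The Cauchy kernel is integrable over a ball, uniformly in its pole. -/
theorem exists_lintegral_ball_inv_sub_le (R : ℝ) :
    ∃ C : ENNReal, C ≠ ⊤ ∧ ∀ a : ℂ, ∫⁻ t in Metric.ball 0 R, ‖(t - a)⁻¹‖ₑ ≤ C := by
  have h1 : ∫⁻ t in Metric.ball (0 : ℂ) 1, ‖t⁻¹‖ₑ ≠ ⊤ := integrableOn_ball_inv.hasFiniteIntegral.ne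
  refine ⟨volume (Metric.ball (0 : ℂ) R) + ∫⁻ t in Metric.ball (0 : ℂ) 1, ‖t⁻¹‖ₑ,
    ENNReal.add_ne_top.2 ⟨measure_ball_lt_top.ne, h1⟩, fun a => ?_⟩
  calc ∫⁻ t in Metric.ball 0 R, ‖(t - a)⁻¹‖ₑ
      ≤ ∫⁻ t in Metric.ball (0 : ℂ) R,
          (1 + (Metric.ball (0 : ℂ) 1).indicator (fun t => ‖t⁻¹‖ₑ) (t - a)) := by
        refine lintegral_mono fun t => ?_
        by_cases ht : t - a ∈ Metric.ball (0 : ℂ) 1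
        · simp [Set.indicator_of_mem ht]
        · rw [Set.indicator_of_notMem ht, add_zero]
          have ht' : 1 ≤ ‖t - a‖ := by simpa using ht
          rw [← ofReal_norm, norm_inv]
          simpa using inv_le_one_of_one_le₀ ht'
    _ = volume (Metric.ball (0 : ℂ) R) + ∫⁻ t in Metric.ball (0 : ℂ) R,
          (Metric.ball (0 : ℂ) 1).indicator (fun t => ‖t⁻¹‖ₑ) (t - a) := by
        rw [lintegral_add_left measurable_const]; simp
    _ ≤ volume (Metric.ball (0 : ℂ) R) + ∫⁻ t,
          (Metric.ball (0 : ℂ) 1).indicator (fun t => ‖t⁻¹‖ₑ) (t - a) := by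
        gcongr; exact Measure.restrict_le_self
    _ = _ := by
        rw [lintegral_sub_right_eq_self (fun t => (Metric.ball (0 : ℂ) 1).indicator
          (fun t => ‖t⁻¹‖ₑ) t), lintegral_indicator measurableSet_ball]

theorem integrable_inv_sub_mul {f : ℂ → ℂ} (hf : Continuous f) (hc : HasCompactSupport f) (a : ℂ) :
    Integrable fun t => (t - a)⁻¹ * f t := by
  have h : LocallyIntegrable (fun t : ℂ => (t - a)⁻¹) := by
    intro x
    obtain ⟨C, hC, h⟩ := exists_lintegral_ball_inv_sub_le (‖x‖ + 1)
    refine ⟨Metric.ball 0 (‖x‖ + 1), Metric.isOpen_ball.mem_nhds (by simp), ?_, ?_⟩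
    · exact Measurable.aestronglyMeasurable (by fun_prop)
    · exact (h a).trans_lt hC.lt_top
  simpa [mul_comm] using h.integrable_smul_left_of_hasCompactSupport hf hc

/-- In polar coordinates, `∂̄g / t` is `½ (∂_r + (i / r) ∂_θ) g` up to the Jacobian. The radial term
integrates to `-g(0)` along each ray, the angular one to `0` along each circle. -/
theorem integral_inv_mul_wirt {g : ℂ → ℂ} (hg : ContDiff ℝ ∞ g) (hc : HasCompactSupport g) :
    ∫ t : ℂ, t⁻¹ * wirt Complex.I 1 g t = -Real.pi * g 0 := by
  have hdiff : Differentiable ℝ g := hg.differentiable (by simp)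
  have hcont : Continuous (fderiv ℝ g) := hg.continuous_fderiv (by simp)
  obtain ⟨R, hR⟩ : ∃ R : ℝ, ∀ t : ℂ, R ≤ ‖t‖ → fderiv ℝ g t = 0 := by
    obtain ⟨R, hR⟩ := (hc.fderiv (𝕜 := ℝ)).isCompact.isBounded.subset_ball 0
    refine ⟨R, fun t ht => ?_⟩
    by_contra h
    have := hR (subset_tsupport _ (Function.mem_support.2 h))
    simp at this
    linarith
  set A : ℝ × ℝ → ℂ := fun q =>
      fderiv ℝ g (q.1 * Complex.exp (q.2 * Complex.I)) (Complex.exp (q.2 * Complex.I)) with hA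
  set B : ℝ × ℝ → ℂ := fun q => fderiv ℝ g (q.1 * Complex.exp (q.2 * Complex.I))
    (Complex.I * Complex.exp (q.2 * Complex.I)) with hB
  have hzero : ∀ q : ℝ × ℝ, R ≤ q.1 → fderiv ℝ g (q.1 * Complex.exp (q.2 * Complex.I)) = 0 := by
    intro q hq
    apply hR
    rw [norm_mul, Complex.norm_exp_ofReal_mul_I, mul_one, Complex.norm_real]
    exact hq.trans (le_abs_self _)
  have hAc : Continuous A := by
    rw [hA]; exact (hcont.comp (by fun_prop)).clm_apply (by fun_prop)
  have hBc : Continuous B := by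
    rw [hB]; exact (hcont.comp (by fun_prop)).clm_apply (by fun_prop)
  have hint : ∀ F : ℝ × ℝ → ℂ, Continuous F → (∀ q, R ≤ q.1 → F q = 0) →
      IntegrableOn F (Set.Ioi (0 : ℝ) ×ˢ Set.Ioo (-Real.pi) Real.pi) := by
    intro F hF h0
    have h1 : IntegrableOn F (Set.Icc (0 : ℝ) R ×ˢ Set.Icc (-Real.pi) Real.pi) :=
      hF.continuousOn.integrableOn_compact (isCompact_Icc.prod isCompact_Icc)
    refine h1.of_forall_sdiff_eq_zero (measurableSet_Ioi.prod measurableSet_Ioo) ?_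
    rintro ⟨r, θ⟩ ⟨⟨hr, hθ⟩, h⟩
    apply h0
    by_contra hlt
    exact h ⟨⟨le_of_lt hr, (not_le.1 hlt).le⟩, ⟨hθ.1.le, hθ.2.le⟩⟩
  have hAi := hint A hAc fun q hq => by simp [hA, hzero q hq]
  have hBi := hint B hBc fun q hq => by simp [hB, hzero q hq]
  have hIA : ∫ q in Set.Ioi (0 : ℝ) ×ˢ Set.Ioo (-Real.pi) Real.pi, A q = -(2 * Real.pi) * g 0 := by
    rw [Measure.volume_eq_prod, ← setIntegral_prod_swap _ _ A, setIntegral_prod]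
    · have : ∀ θ : ℝ, ∫ r in Set.Ioi (0 : ℝ), A (r, θ) = - g 0 := by
        intro θ
        have hline : ∀ r : ℝ, HasDerivAt
            (fun r : ℝ => g (r * Complex.exp (θ * Complex.I))) (A (r, θ)) r := by
          intro r
          refine (hdiff _).hasFDerivAt.comp_hasDerivAt r ?_
          simpa using (Complex.ofRealCLM.hasDerivAt (x := r)).mul_const
            (Complex.exp (θ * Complex.I))
        have := HasCompactSupport.integral_Ioi_deriv_eq
          (f := fun r : ℝ => g (r * Complex.exp (θ * Complex.I))) ?_ ?_ 0
        · simpa [(hline _).deriv] using this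
        · exact (hg.of_le (by simp)).comp
            ((Complex.ofRealCLM.contDiff).mul contDiff_const)
        · refine hc.comp_isClosedEmbedding
            (g := fun r : ℝ => (r : ℂ) * Complex.exp (θ * Complex.I)) ?_
          refine Isometry.isClosedEmbedding (Isometry.of_dist_eq fun x y => ?_)
          rw [dist_eq_norm, ← sub_mul, norm_mul, Complex.norm_exp_ofReal_mul_I, mul_one,
            ← Complex.ofReal_sub, Complex.norm_real, dist_eq_norm]
      simp only [Prod.swap_prod_mk, this]
      rw [setIntegral_const, Real.volume_real_Ioo_of_le (by linarith [Real.pi_pos]),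
        Complex.real_smul]
      push_cast
      ring
    · exact hAi.swap
  have hIB : ∫ q in Set.Ioi (0 : ℝ) ×ˢ Set.Ioo (-Real.pi) Real.pi, B q = 0 := by
    rw [Measure.volume_eq_prod, setIntegral_prod _ hBi]
    refine setIntegral_eq_zero_of_forall_eq_zero fun r hr => ?_
    have hr0 : (r : ℂ) ≠ 0 := by exact_mod_cast (ne_of_gt hr)
    have hd : ∀ θ : ℝ, HasDerivAt
        (fun θ : ℝ => g (r * Complex.exp (θ * Complex.I))) (r * B (r, θ)) θ := by
      intro θ
      have h1 : HasDerivAt (fun θ : ℝ => (r : ℂ) * Complex.exp (θ * Complex.I))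
          (r • (Complex.I * Complex.exp (θ * Complex.I))) θ := by
        have := (((Complex.ofRealCLM.hasDerivAt (x := θ)).mul_const Complex.I).cexp.const_mul
            (r : ℂ))
        simpa [mul_comm, mul_left_comm] using this
      have := (hdiff _).hasFDerivAt.comp_hasDerivAt θ h1
      rw [← Complex.real_smul, ← map_smul]
      exact this
    have := intervalIntegral.integral_eq_sub_of_hasDerivAt (a := -Real.pi) (b := Real.pi)
      (fun θ _ => hd θ) (Continuous.intervalIntegrable (by fun_prop) _ _)
    rw [intervalIntegral.integral_const_mul,
        intervalIntegral.integral_of_le (by linarith [Real.pi_pos]),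
      integral_Ioc_eq_integral_Ioo] at this
    have h2 : Complex.exp (((-Real.pi : ℝ) : ℂ) * Complex.I) =
        Complex.exp ((Real.pi : ℂ) * Complex.I) := by
      push_cast
      rw [Complex.exp_pi_mul_I, neg_mul, Complex.exp_neg, Complex.exp_pi_mul_I]; norm_num
    rw [h2, sub_self] at this
    exact (mul_eq_zero.1 this).resolve_left hr0
  rw [← Complex.integral_comp_polarCoord_symm]
  have : ∀ q ∈ polarCoord.target, q.1 • ((Complex.polarCoord.symm q)⁻¹ *
      wirt Complex.I 1 g (Complex.polarCoord.symm q)) = (1 / 2) * (A q + Complex.I * B q) := by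
    intro q hq
    have hq1 : (q.1 : ℂ) ≠ 0 := by
      have : 0 < q.1 := hq.1
      exact_mod_cast this.ne'
    have he : Complex.exp (q.2 * Complex.I) ≠ 0 := Complex.exp_ne_zero _
    have h1 : Complex.polarCoord.symm q = q.1 * Complex.exp (q.2 * Complex.I) := by
      rw [Complex.polarCoord_symm_apply, Complex.exp_mul_I]
      push_cast; ring
    rw [h1]
    simp only [hA, hB, wirt]
    generalize fderiv ℝ g (q.1 * Complex.exp (q.2 * Complex.I)) = L
    -- a real-linear map `L` satisfies `L w + i L (i w) = w̄ (L 1 + i L i)`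
    have hL : ∀ w : ℂ, L w = w.re * L 1 + w.im * L Complex.I := by
      intro w
      conv_lhs => rw [← Complex.re_add_im w]
      rw [map_add, ← Complex.real_smul, ← mul_one ((w.re : ℂ)), ← Complex.real_smul, map_smul,
          map_smul]
      simp
    have h2 : L (Complex.exp (q.2 * Complex.I)) + Complex.I *
        L (Complex.I * Complex.exp (q.2 * Complex.I))
        = (Complex.exp (q.2 * Complex.I))⁻¹ * (L 1 + Complex.I * L (Complex.I * 1)) := by
      rw [← Complex.exp_neg, hL (Complex.exp _), hL (Complex.I * Complex.exp _)]
      have e1 : Complex.exp (-(q.2 * Complex.I)) = Real.cos q.2 - Real.sin q.2 * Complex.I := by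
        rw [← neg_mul, ← Complex.ofReal_neg, Complex.exp_mul_I]
        push_cast; simp; ring
      rw [e1]
      simp only [Complex.exp_ofReal_mul_I_re, Complex.exp_ofReal_mul_I_im, Complex.mul_re,
        Complex.mul_im, Complex.I_re, Complex.I_im, mul_one, zero_mul, one_mul, zero_sub, zero_add]
      push_cast
      linear_combination (Complex.sin q.2 * L Complex.I) * Complex.I_mul_I
    rw [h2]
    simp only [smul_eq_mul, Complex.real_smul]
    field_simp
  rw [setIntegral_congr_fun (by exact measurableSet_Ioi.prod measurableSet_Ioo) this]
  change ∫ q in Set.Ioi (0 : ℝ) ×ˢ Set.Ioo (-Real.pi) Real.pi, _ = _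
  rw [integral_const_mul, integral_add hAi (hBi.const_mul _), integral_const_mul, hIA, hIB]
  ring

/-- The Cauchy-Pompeiu formula: `1 / (π (t - a))` is a fundamental solution of `∂̄`. -/
theorem integral_inv_sub_mul_wirt {g : ℂ → ℂ} (hg : ContDiff ℝ ∞ g) (hc : HasCompactSupport g)
    (a : ℂ) : ∫ t : ℂ, (t - a)⁻¹ * wirt Complex.I 1 g t = -Real.pi * g a := by
  have h := integral_inv_mul_wirt (g := fun t => g (t + a))
    (hg.comp (contDiff_id.add contDiff_const))
    (hc.comp_homeomorph (Homeomorph.addRight a))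
  rw [zero_add] at h
  rw [← h, ← integral_add_right_eq_self _ a]
  refine integral_congr_ae (.of_forall fun t => ?_)
  simp [wirt, fderiv_comp_add_right]

end CauchyKernel

/-! ### Rational functions of one variable -/

section PolynomialSlices

open Polynomial

theorem ae_eval_ne_zero {q : ℂ[X]} (hq : q ≠ 0) : ∀ᵐ t : ℂ, q.eval t ≠ 0 := by
  have h : {t : ℂ | ¬ q.eval t ≠ 0} ⊆ (q.roots.toFinset : Set ℂ) := by
    intro t ht
    simpa [hq] using ht
  exact measure_mono_null h (Finset.measure_zero _ _)

/-- A logarithmic derivative of a polynomial has integral over a ball bounded in terms of the degree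
alone. -/
theorem lintegral_ball_logDeriv_le {R : ℝ} {C : ENNReal}
    (hC : ∀ a : ℂ, ∫⁻ t in Metric.ball 0 R, ‖(t - a)⁻¹‖ₑ ≤ C) (q : ℂ[X]) :
    ∫⁻ t in Metric.ball 0 R, ‖q.derivative.eval t / q.eval t‖ₑ ≤ q.natDegree * C := by
  rcases eq_or_ne q 0 with rfl | hq
  · simp
  calc ∫⁻ t in Metric.ball 0 R, ‖q.derivative.eval t / q.eval t‖ₑ
      ≤ ∫⁻ t in Metric.ball 0 R, (q.roots.map fun a => ‖(t - a)⁻¹‖ₑ).sum := by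
        refine lintegral_mono_ae (ae_restrict_of_ae ?_)
        filter_upwards [ae_eval_ne_zero hq] with t ht
        rw [(IsAlgClosed.splits q).eval_derivative_div_eval_of_ne_zero ht]
        generalize q.roots = S
        induction S using Multiset.induction with
        | empty => simp
        | cons a S ih =>
          simp only [Multiset.map_cons, Multiset.sum_cons]
          refine (enorm_add_le _ _).trans (add_le_add ?_ ih)
          rw [one_div]
    _ = (q.roots.map fun a => ∫⁻ t in Metric.ball 0 R, ‖(t - a)⁻¹‖ₑ).sum := by
        generalize q.roots = S
        induction S using Multiset.induction with
        | empty => simp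
        | cons a S ih =>
          simp only [Multiset.map_cons, Multiset.sum_cons]
          rw [lintegral_add_left (by fun_prop), ih]
    _ ≤ (q.roots.map fun _ => C).sum := Multiset.sum_map_le_sum_map _ _ fun a _ => hC a
    _ ≤ q.natDegree * C := by
        rw [Multiset.map_const', Multiset.sum_replicate, nsmul_eq_mul]
        gcongr
        exact Polynomial.card_roots' q

/-- The partial fraction decomposition of `1 / q`, for a polynomial `q` with simple roots. -/
theorem inv_eval_eq_sum {q : ℂ[X]} (hd : 0 < q.natDegree)
    (hq : ∀ a, q.eval a = 0 → q.derivative.eval a ≠ 0) {t : ℂ} (ht : q.eval t ≠ 0) :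
    (q.eval t)⁻¹ = ∑ a ∈ q.roots.toFinset, (q.derivative.eval a)⁻¹ * (t - a)⁻¹ := by
  have hq0 : q ≠ 0 := by rintro rfl; simp at ht
  have hlead : q.leadingCoeff ≠ 0 := leadingCoeff_ne_zero.2 hq0
  have hnd : q.roots.Nodup := by
    refine Multiset.nodup_iff_count_le_one.2 fun a => ?_
    rw [count_roots]
    by_contra! h
    have h2 := (one_lt_rootMultiplicity_iff_isRoot hq0).1 h
    exact hq a h2.1 h2.2
  have hne : q.roots.toFinset.Nonempty := by
    obtain ⟨a, ha⟩ := IsAlgClosed.exists_root q (by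
      rw [degree_eq_natDegree hq0]; exact_mod_cast hd.ne')
    exact ⟨a, by simpa [hq0] using ha⟩
  have hnod : q = C q.leadingCoeff * Lagrange.nodal q.roots.toFinset id := by
    conv_lhs => rw [(IsAlgClosed.splits q).eq_prod_roots]
    congr 1
    rw [Lagrange.nodal, Finset.prod_multiset_map_count]
    refine Finset.prod_congr rfl fun a ha => ?_
    rw [Multiset.count_eq_one_of_mem hnd (by simpa using ha)]
    simp
  have hne' : ∀ a ∈ q.roots.toFinset, t ≠ id a := by
    rintro a ha rfl
    simp [hq0] at ha
    exact ht ha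
  have h1 := Lagrange.eval_interpolate_not_at_node (s := q.roots.toFinset) (v := id) 1 hne'
  rw [Lagrange.interpolate_one Function.injective_id.injOn hne, eval_one] at h1
  have h2 : q.eval t = q.leadingCoeff * eval t (Lagrange.nodal q.roots.toFinset id) := by
    conv_lhs => rw [hnod]
    simp
  have h3 : ∀ a ∈ q.roots.toFinset, q.derivative.eval a =
      q.leadingCoeff * (Lagrange.nodalWeight q.roots.toFinset id a)⁻¹ := by
    intro a ha
    rw [Lagrange.nodalWeight_eq_eval_derivative_nodal ha, inv_inv]
    conv_lhs => rw [hnod]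
    simp
  have h4 : eval t (Lagrange.nodal q.roots.toFinset id) ≠ 0 := by
    intro h; rw [h2, h, mul_zero] at ht; exact ht rfl
  rw [h2, Finset.sum_congr rfl fun a ha => by rw [h3 a ha]]
  simp only [mul_inv, inv_inv, mul_assoc, ← Finset.mul_sum]
  congr 1
  exact inv_eq_of_mul_eq_one_right (by simpa using h1.symm)

/-- `∂̄ (p / q) = π ∑ (p(a) / q'(a)) δ_a` if all roots `a` of `q` are simple. -/
theorem integral_div_mul_wirt {g : ℂ → ℂ} (hg : ContDiff ℝ ∞ g) (hc : HasCompactSupport g)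
    (p : ℂ[X]) {q : ℂ[X]} (hq : ∀ a, q.eval a = 0 → q.derivative.eval a ≠ 0) :
    ∫ t, p.eval t / q.eval t * wirt Complex.I 1 g t =
      -Real.pi * ∑ a ∈ q.roots.toFinset, p.eval a / q.derivative.eval a * g a := by
  have hq0 : q ≠ 0 := by rintro rfl; exact hq 0 (by simp) (by simp)
  have hp : ContDiff ℂ ∞ fun t => p.eval t := by simpa using p.contDiff_aeval (𝕜 := ℂ) ∞
  have hpr : ContDiff ℝ ∞ fun t => p.eval t := hp.restrict_scalars ℝ
  have hpg : ContDiff ℝ ∞ fun t => p.eval t * g t := hpr.mul hg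
  have hpc : HasCompactSupport fun t => p.eval t * g t := hc.mul_left
  have hw : ∀ t, wirt Complex.I 1 (fun t => p.eval t * g t) t =
      p.eval t * wirt Complex.I 1 g t := by
    intro t
    rw [wirt_mul (hpr.differentiable (by simp) t) (hg.differentiable (by simp) t),
      wirt_I_of_differentiableAt (hp.differentiable (by simp) t)]
    ring
  rcases Nat.eq_zero_or_pos q.natDegree with hd | hd
  · obtain ⟨c, rfl⟩ := natDegree_eq_zero.1 hd
    have : ∀ t, p.eval t / (C c).eval t * wirt Complex.I 1 g t =
        c⁻¹ * wirt Complex.I 1 (fun t => p.eval t * g t) t := by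
      intro t; rw [hw, eval_C]; ring
    simp only [this]
    rw [integral_const_mul, integral_wirt_eq_zero hpg hpc]
    simp
  · have h1 : ∫ t, p.eval t / q.eval t * wirt Complex.I 1 g t =
        ∫ t, ∑ a ∈ q.roots.toFinset, (q.derivative.eval a)⁻¹ *
          ((t - a)⁻¹ * wirt Complex.I 1 (fun t => p.eval t * g t) t) := by
      refine integral_congr_ae ?_
      filter_upwards [ae_eval_ne_zero hq0] with t ht
      rw [div_eq_mul_inv, inv_eval_eq_sum hd hq ht, Finset.mul_sum, Finset.sum_mul]
      refine Finset.sum_congr rfl fun a _ => ?_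
      rw [hw]; ring
    rw [h1, integral_finsetSum, Finset.mul_sum]
    · refine Finset.sum_congr rfl fun a _ => ?_
      rw [integral_const_mul, integral_inv_sub_mul_wirt hpg hpc]
      ring
    · intro a _
      exact (integrable_inv_sub_mul (contDiff_wirt hpg).continuous (hasCompactSupport_wirt hpc)
          a).const_mul _

end PolynomialSlices

/-! ### Jensen's formula for polynomials -/

section Jensen

open Polynomial Real

theorem analyticOnNhd_eval (q : ℂ[X]) (s : Set ℂ) : AnalyticOnNhd ℂ (fun τ => q.eval τ) s :=
  fun τ _ => q.differentiable.analyticAt τ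

theorem meromorphic_eval (q : ℂ[X]) : Meromorphic fun τ => q.eval τ := fun τ =>
  (analyticOnNhd_eval q Set.univ τ (Set.mem_univ _)).meromorphicAt

theorem circleIntegrable_log_norm_eval (q : ℂ[X]) (r : ℝ) :
    CircleIntegrable (fun τ => log ‖q.eval τ‖) 0 r :=
  MeromorphicOn.circleIntegrable_log_norm fun τ _ => meromorphic_eval q τ

/-- By Jensen's formula, the mean of `log |q|` over the circle of radius `r` is a constant plus the
logarithmic counting function of the zeros of `q`, which increases with `r`. -/
theorem circleAverage_log_norm_eval_mono (q : ℂ[X]) {r s : ℝ} (hr : 0 < r) (hrs : r ≤ s) :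
    circleAverage (fun τ => log ‖q.eval τ‖) 0 r ≤ circleAverage (fun τ => log ‖q.eval τ‖) 0 s := by
  have hq := meromorphic_eval q
  have hD : 0 ≤ MeromorphicOn.divisor (fun τ => q.eval τ) Set.univ :=
    MeromorphicOn.AnalyticOnNhd.divisor_nonneg (analyticOnNhd_eval q _)
  have h := Function.locallyFinsuppWithin.logCounting_mono hD hr (hr.trans_le hrs) hrs
  rw [Function.locallyFinsuppWithin.logCounting_divisor_eq_circleAverage_sub_const hq hr.ne',
    Function.locallyFinsuppWithin.logCounting_divisor_eq_circleAverage_sub_const hq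
      (hr.trans_le hrs).ne'] at h
  simpa using h

theorem log_norm_eval_zero_le_circleAverage (q : ℂ[X]) (hq : q.eval 0 ≠ 0) {s : ℝ} (hs : 0 < s) :
    log ‖q.eval 0‖ ≤ circleAverage (fun τ => log ‖q.eval τ‖) 0 s := by
  have hcont : Continuous fun τ => q.eval τ := q.continuous
  obtain ⟨δ, hδ, hball⟩ := Metric.eventually_nhds_iff_ball.1 (hcont.continuousAt.eventually_ne hq)
  have hpos : 0 < min s (δ / 2) := lt_min hs (by positivity)
  refine le_trans (le_of_eq ?_) (circleAverage_log_norm_eval_mono q hpos (min_le_left _ _))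
  symm
  refine AnalyticOnNhd.circleAverage_log_norm_of_ne_zero (analyticOnNhd_eval q _) fun u hu => ?_
  refine hball u ?_
  rw [abs_of_pos hpos, Metric.mem_closedBall] at hu
  rw [Metric.mem_ball]
  linarith [min_le_right s (δ / 2)]

end Jensen

/-! ### Restriction to complex lines -/

section LineSlices

open Polynomial

variable (Q : MvPolynomial (Fin 2) ℂ) (p b : ℂ × ℂ)

/-- The restriction `τ ↦ Q(p + τ b)` of `Q` to a complex line. -/
def lineSlice : ℂ[X] := MvPolynomial.aeval ![C p.1 + C b.1 * X, C p.2 + C b.2 * X] Q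

theorem eval_lineSlice (τ : ℂ) : (lineSlice Q p b).eval τ = ev Q (p + τ • b) := by
  induction Q using MvPolynomial.induction_on with
  | C a => simp [lineSlice]
  | add P Q hP hQ =>
    simp only [lineSlice, map_add, eval_add, ev_add] at *
    rw [hP, hQ]
  | mul_X P i hP =>
    simp only [lineSlice, map_mul, eval_mul, ev_mul] at *
    rw [hP]
    congr 1
    fin_cases i
    · simp [ev_X_zero]; ring
    · simp [ev_X_one]; ring

theorem eval_derivative_lineSlice (τ : ℂ) : (lineSlice Q p b).derivative.eval τ =
    evDeriv Q 0 (p + τ • b) * b.1 + evDeriv Q 1 (p + τ • b) * b.2 := by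
  have h1 := (lineSlice Q p b).hasDerivAt τ
  have h2 : HasDerivAt (fun τ : ℂ => p + τ • b) b τ := by
    simpa using ((hasDerivAt_id τ).smul_const b).const_add p
  have h3 := (hasFDerivAt_ev Q (p + τ • b)).comp_hasDerivAt τ h2
  have h4 : (fun x => eval x (lineSlice Q p b)) = ev Q ∘ fun τ => p + τ • b := by
    funext x; exact eval_lineSlice Q p b x
  rw [h4] at h1
  simpa using h1.unique h3

theorem exists_natDegree_lineSlice_le : ∃ N : ℕ, ∀ p b, (lineSlice Q p b).natDegree ≤ N := by
  induction Q using MvPolynomial.induction_on with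
  | C a => exact ⟨0, fun p b => by simp [lineSlice]⟩
  | add P Q hP hQ =>
    obtain ⟨N, hN⟩ := hP
    obtain ⟨M, hM⟩ := hQ
    refine ⟨max N M, fun p b => ?_⟩
    simp only [lineSlice, map_add] at *
    exact (natDegree_add_le _ _).trans (max_le_max (hN p b) (hM p b))
  | mul_X P i hP =>
    obtain ⟨N, hN⟩ := hP
    refine ⟨N + 1, fun p b => ?_⟩
    simp only [lineSlice, map_mul] at *
    refine natDegree_mul_le.trans (add_le_add (hN p b) ?_)
    fin_cases i <;> simp <;> compute_degree

/-- The polynomial `t ↦ Q(z, t)`. -/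
abbrev sliceT (z : ℂ) : ℂ[X] := lineSlice Q (z, 0) (0, 1)

/-- The polynomial `z ↦ Q(z, t)`. -/
abbrev sliceZ (t : ℂ) : ℂ[X] := lineSlice Q (0, t) (1, 0)

@[simp] theorem eval_sliceT (z t : ℂ) : (sliceT Q z).eval t = ev Q (z, t) := by
  rw [eval_lineSlice]; simp

@[simp] theorem eval_sliceZ (z t : ℂ) : (sliceZ Q t).eval z = ev Q (z, t) := by
  rw [eval_lineSlice]; simp

@[simp] theorem eval_derivative_sliceT (z t : ℂ) :
    (sliceT Q z).derivative.eval t = evDeriv Q 1 (z, t) := by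
  rw [eval_derivative_lineSlice]; simp

@[simp] theorem eval_derivative_sliceZ (z t : ℂ) :
    (sliceZ Q t).derivative.eval z = evDeriv Q 0 (z, t) := by
  rw [eval_derivative_lineSlice]; simp

variable {Q p}

theorem log_norm_ev_le_circleAverage (hp : ev Q p ≠ 0) :
    Real.log ‖ev Q p‖ ≤ Real.circleAverage (fun τ => Real.log ‖ev Q (p + τ • b)‖) 0 1 := by
  have := log_norm_eval_zero_le_circleAverage (lineSlice Q p b) (by simpa [eval_lineSlice] using hp)
    one_pos
  simpa [eval_lineSlice] using this

variable (Q p)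

theorem circleAverage_log_norm_ev_mono {r s : ℝ} (hr : 0 < r) (hrs : r ≤ s) :
    Real.circleAverage (fun τ => Real.log ‖ev Q (p + τ • b)‖) 0 r ≤
      Real.circleAverage (fun τ => Real.log ‖ev Q (p + τ • b)‖) 0 s := by
  simpa [eval_lineSlice] using circleAverage_log_norm_eval_mono (lineSlice Q p b) hr hrs

theorem circleIntegrable_log_norm_ev (r : ℝ) :
    CircleIntegrable (fun τ => Real.log ‖ev Q (p + τ • b)‖) 0 r := by
  simpa [eval_lineSlice] using circleIntegrable_log_norm_eval (lineSlice Q p b) r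

end LineSlices

/-! ### Local integrability of `log |Q|` and of `∂Q / Q` -/

section LocalIntegrability

theorem measurePreserving_smul_of_norm_eq_one {c : ℂ} (hc : ‖c‖ = 1) :
    MeasurePreserving (fun b : ℂ × ℂ => c • b) := by
  have h : MeasurePreserving (fun z : ℂ => c * z) :=
    (rotation ⟨c, by simp [Submonoid.unitSphere, hc]⟩).measurePreserving
  exact h.prod h

theorem setLIntegral_ball_smul {c : ℂ} (hc : ‖c‖ = 1) (R : ℝ) (g : ℂ × ℂ → ENNReal) :
    ∫⁻ b in Metric.ball 0 R, g (c • b) = ∫⁻ b in Metric.ball 0 R, g b := by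
  have hc0 : c ≠ 0 := by rintro rfl; simp at hc
  have h := (measurePreserving_smul_of_norm_eq_one hc).setLIntegral_comp_preimage_emb
    (Homeomorph.smulOfNeZero c hc0).measurableEmbedding g (Metric.ball 0 R)
  rw [← h]
  congr 2
  ext b
  simp [norm_smul, hc]

variable {Q : MvPolynomial (Fin 2) ℂ}

theorem exists_ev_ne_zero (hQ : Q ≠ 0) : ∃ p, ev Q p ≠ 0 := by
  by_contra! h
  refine hQ (MvPolynomial.funext fun x => ?_)
  have := h (x 0, x 1)
  have hx : ![x 0, x 1] = x := by ext i; fin_cases i <;> rfl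
  simpa [ev, hx] using this

variable (Q) in
theorem measurable_log_norm_ev : Measurable fun p => Real.log ‖ev Q p‖ :=
  Real.measurable_log.comp (continuous_ev Q).norm.measurable

/-- If `Q(p₀) ≠ 0`, then `log |Q(p₀)|` is at most the mean of `log |Q|` over almost every circle
around `p₀`, hence over balls around `p₀`. As `log |Q|` is locally bounded above,
it is integrable on these balls. -/
theorem locallyIntegrable_log_norm_ev (hQ : Q ≠ 0) :
    LocallyIntegrable fun p => Real.log ‖ev Q p‖ := by
  obtain ⟨p₀, hp₀⟩ := exists_ev_ne_zero hQ
  have hmeas := measurable_log_norm_ev Q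
  suffices h : ∀ R : ℝ, 0 < R →
      IntegrableOn (fun b => Real.log ‖ev Q (p₀ + b)‖) (Metric.ball 0 R) by
    intro p
    refine ⟨Metric.ball p₀ (dist p p₀ + 1), Metric.isOpen_ball.mem_nhds (by simp), ?_⟩
    have h1 := h (dist p p₀ + 1) (by positivity)
    have h2 := (measurePreserving_add_left (volume : Measure (ℂ × ℂ)) p₀).integrableOn_comp_preimage
      (measurableEmbedding_addLeft p₀) (f := fun p => Real.log ‖ev Q p‖)
      (s := Metric.ball p₀ (dist p p₀ + 1))
    refine h2.1 (h1.congr_set_ae ?_)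
    refine Eventually.of_forall fun b => ?_
    apply propext
    change p₀ + b ∈ Metric.ball p₀ _ ↔ b ∈ Metric.ball 0 _
    simp
  intro R hR
  obtain ⟨K, hK⟩ := (isCompact_closedBall p₀ R).exists_bound_of_continuousOn
    (continuous_ev Q).continuousOn
  set M : ℝ := Real.log (max K 1) with hM
  have hfM : ∀ b : ℂ × ℂ, ‖b‖ < R → Real.log ‖ev Q (p₀ + b)‖ ≤ M := by
    intro b hb
    rcases eq_or_ne (ev Q (p₀ + b)) 0 with h0 | h0
    · rw [h0, norm_zero, Real.log_zero]
      exact Real.log_nonneg (le_max_right _ _)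
    · exact Real.log_le_log (norm_pos_iff.2 h0)
        ((hK _ (by simpa using hb.le)).trans (le_max_left _ _))
  set μθ := (volume : Measure ℝ).restrict (Set.Ioc 0 (2 * Real.pi)) with hμθ
  have hcirc : ∀ b : ℂ × ℂ, ‖b‖ < R →
      ∫⁻ θ, ENNReal.ofReal (M - Real.log ‖ev Q (p₀ + circleMap 0 1 θ • b)‖) ∂μθ ≤
        ENNReal.ofReal (2 * Real.pi * (M - Real.log ‖ev Q p₀‖)) := by
    intro b hb
    have hint : IntervalIntegrable
        (fun θ => M - Real.log ‖ev Q (p₀ + circleMap 0 1 θ • b)‖) volume 0 (2 * Real.pi) :=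
      intervalIntegrable_const.sub (circleIntegrable_log_norm_ev Q p₀ b 1)
    have hint' : IntegrableOn (fun θ => M - Real.log ‖ev Q (p₀ + circleMap 0 1 θ • b)‖)
      (Set.Ioc 0 (2 * Real.pi)) :=
          (intervalIntegrable_iff_integrableOn_Ioc_of_le Real.two_pi_pos.le).1 hint
    rw [← ofReal_integral_eq_lintegral_ofReal hint']
    · refine ENNReal.ofReal_le_ofReal ?_
      have h1 := log_norm_ev_le_circleAverage b hp₀
      rw [Real.circleAverage_def, smul_eq_mul, inv_mul_eq_div, le_div_iff₀ Real.two_pi_pos] at h1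
      rw [← intervalIntegral.integral_of_le Real.two_pi_pos.le, intervalIntegral.integral_sub
        intervalIntegrable_const (circleIntegrable_log_norm_ev Q p₀ b 1)]
      simp only [intervalIntegral.integral_const, sub_zero, smul_eq_mul]
      linarith
    · refine .of_forall fun θ => sub_nonneg.2 (hfM _ ?_)
      simpa [norm_smul] using hb
  have hmeas2 : Measurable fun x : (ℂ × ℂ) × ℝ =>
      ENNReal.ofReal (M - Real.log ‖ev Q (p₀ + circleMap 0 1 x.2 • x.1)‖) := by
    refine (measurable_const.sub (hmeas.comp ?_)).ennreal_ofReal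
    exact Continuous.measurable (by fun_prop)
  have hfin : ∫⁻ b in Metric.ball 0 R, ENNReal.ofReal (M - Real.log ‖ev Q (p₀ + b)‖) ≠ ⊤ := by
    have h1 : ∫⁻ b in Metric.ball 0 R, ∫⁻ θ,
        ENNReal.ofReal (M - Real.log ‖ev Q (p₀ + circleMap 0 1 θ • b)‖) ∂μθ ≤
        ∫⁻ b in Metric.ball (0 : ℂ × ℂ) R,
            ENNReal.ofReal (2 * Real.pi * (M - Real.log ‖ev Q p₀‖)) :=
      setLIntegral_mono measurable_const fun b hb => hcirc b (by simpa using hb)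
    rw [lintegral_lintegral_swap hmeas2.aemeasurable] at h1
    have h2 : ∀ θ : ℝ, ∫⁻ b in Metric.ball 0 R,
        ENNReal.ofReal (M - Real.log ‖ev Q (p₀ + circleMap 0 1 θ • b)‖) =
        ∫⁻ b in Metric.ball 0 R, ENNReal.ofReal (M - Real.log ‖ev Q (p₀ + b)‖) := fun θ =>
      setLIntegral_ball_smul (by simp) R
        (fun b => ENNReal.ofReal (M - Real.log ‖ev Q (p₀ + b)‖))
    simp only [h2, lintegral_const] at h1
    intro htop
    rw [htop, ENNReal.top_mul (by simp [hμθ, Real.pi_pos])] at h1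
    exact ENNReal.mul_ne_top ENNReal.ofReal_ne_top (by simpa using measure_ball_lt_top.ne)
      (top_le_iff.1 h1)
  have hint : IntegrableOn (fun b => M - Real.log ‖ev Q (p₀ + b)‖) (Metric.ball 0 R) := by
    refine ⟨(measurable_const.sub (hmeas.comp (measurable_const_add p₀))).aestronglyMeasurable, ?_⟩
    rw [hasFiniteIntegral_iff_ofReal]
    · exact hfin.lt_top
    · refine (ae_restrict_iff' measurableSet_ball).2 (.of_forall fun b hb => ?_)
      exact sub_nonneg.2 (hfM b (by simpa using hb))
  have := (integrableOn_const (μ := volume) (s := Metric.ball (0 : ℂ × ℂ) R) (C := M)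
    measure_ball_lt_top.ne).sub hint
  exact this.congr (.of_forall fun b => by simp)

variable (Q)

/-- On each coordinate line the logarithmic derivative is a sum of Cauchy kernels, whose number is
bounded by the degree of `Q`; on the lines where `Q` vanishes it is `0` by convention. -/
theorem locallyIntegrable_logDeriv (j : Fin 2) :
    LocallyIntegrable fun p => evDeriv Q j p / ev Q p := by
  have hmeas : Measurable fun p => evDeriv Q j p / ev Q p :=
    (continuous_evDeriv Q j).measurable.div (continuous_ev Q).measurable
  obtain ⟨N, hN⟩ := exists_natDegree_lineSlice_le Q
  intro p
  refine ⟨Metric.ball 0 (‖p‖ + 1), Metric.isOpen_ball.mem_nhds (by simp),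
    hmeas.aestronglyMeasurable, ?_⟩
  obtain ⟨C, hC, hle⟩ := exists_lintegral_ball_inv_sub_le (‖p‖ + 1)
  have hfin : N * C * volume (Metric.ball (0 : ℂ) (‖p‖ + 1)) < ⊤ :=
    ENNReal.mul_lt_top (ENNReal.mul_lt_top (by simp) hC.lt_top) measure_ball_lt_top
  have hball : Metric.ball (0 : ℂ × ℂ) (‖p‖ + 1) =
      Metric.ball 0 (‖p‖ + 1) ×ˢ Metric.ball 0 (‖p‖ + 1) := by
    rw [ball_prod_same]; rfl
  rw [HasFiniteIntegral, hball, Measure.volume_eq_prod, ← Measure.prod_restrict]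
  refine lt_of_le_of_lt ?_ hfin
  fin_cases j
  · rw [lintegral_prod_symm _ hmeas.enorm.aemeasurable, ← setLIntegral_const]
    refine lintegral_mono fun t => ?_
    refine le_trans ?_ ((lintegral_ball_logDeriv_le hle (sliceZ Q t)).trans
      (by gcongr; exact hN _ _))
    simp
  · rw [lintegral_prod _ hmeas.enorm.aemeasurable, ← setLIntegral_const]
    refine lintegral_mono fun z => ?_
    refine le_trans ?_ ((lintegral_ball_logDeriv_le hle (sliceT Q z)).trans
      (by gcongr; exact hN _ _))
    simp

end LocalIntegrability

/-! ### Generic separability of irreducible polynomials -/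

section GenericSeparability

open Polynomial Bivariate

/-- In Mathlib's identification of `ℂ[z][t]` with polynomials in two variables, the variable of the
coefficients is `X 0` and the outer variable is `X 1`. -/
theorem evalEval_equivMvPolynomial_symm (Q : MvPolynomial (Fin 2) ℂ) (z t : ℂ) :
    ((Polynomial.Bivariate.equivMvPolynomial ℂ).symm Q).evalEval z t = ev Q (z, t) := by
  induction Q using MvPolynomial.induction_on with
  | C a => simp
  | add P Q hP hQ => simp [hP, hQ]
  | mul_X P i hP =>
    rw [map_mul, evalEval_mul, ev_mul, hP]
    congr 1
    fin_cases i
    · simp [ev_X_zero, evalEval_C]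
    · simp [ev_X_one]

theorem equivMvPolynomial_symm_pderiv (Q : MvPolynomial (Fin 2) ℂ) :
    (Polynomial.Bivariate.equivMvPolynomial ℂ).symm (MvPolynomial.pderiv 1 Q) =
      derivative ((Polynomial.Bivariate.equivMvPolynomial ℂ).symm Q) := by
  induction Q using MvPolynomial.induction_on with
  | C a => simp
  | add P Q hP hQ => simp [hP, hQ]
  | mul_X P i hP =>
    fin_cases i
    · simp [Derivation.leibniz, MvPolynomial.pderiv_X, hP, mul_comm]
    · simp [Derivation.leibniz, MvPolynomial.pderiv_X, hP]
      ring

/-- By Gauss' lemma an irreducible polynomial of positive degree in `t` is separable over `ℂ(z)`, so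
that its resultant with its `t`-derivative is a nonzero polynomial in `z`. -/
theorem finite_setOf_ev_evDeriv_one_eq_zero {Q : MvPolynomial (Fin 2) ℂ} (hQ : Irreducible Q) :
    {z : ℂ | ∃ t, ev Q (z, t) = 0 ∧ evDeriv Q 1 (z, t) = 0}.Finite := by
  set P : ℂ[X][X] := (Polynomial.Bivariate.equivMvPolynomial ℂ).symm Q with hP
  have hPi : Irreducible P :=
      (MulEquiv.irreducible_iff (Polynomial.Bivariate.equivMvPolynomial ℂ).symm).2 hQ
  have hev : ∀ z t, ev Q (z, t) = P.evalEval z t := fun z t =>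
    (evalEval_equivMvPolynomial_symm Q z t).symm
  have hev' : ∀ z t, evDeriv Q 1 (z, t) = (derivative P).evalEval z t := fun z t => by
    rw [evDeriv, ← evalEval_equivMvPolynomial_symm, equivMvPolynomial_symm_pderiv]
  suffices h : ∃ r : ℂ[X], r ≠ 0 ∧ ∃ a b, P * a + derivative P * b = C r by
    obtain ⟨r, hr, a, b, h⟩ := h
    refine r.roots.toFinset.finite_toSet.subset ?_
    rintro z ⟨t, h1, h2⟩
    have h3 := congrArg (evalEval z t) h
    rw [evalEval_add, evalEval_mul, evalEval_mul, ← hev, ← hev', h1, h2, evalEval_C] at h3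
    simp [hr, ← h3]
  rcases Nat.eq_zero_or_pos P.natDegree with hd | hd
  · obtain ⟨r, hr⟩ := natDegree_eq_zero.1 hd
    refine ⟨r, ?_, 1, 0, by simp [hr]⟩
    rintro rfl
    exact hPi.ne_zero (by simp [← hr])
  · have hprim : P.IsPrimitive := hPi.isPrimitive hd.ne'
    have hirr : Irreducible (P.map (algebraMap ℂ[X] (FractionRing ℂ[X]))) :=
      (hprim.irreducible_iff_irreducible_map_fraction_map).1 hPi
    have hsep : IsCoprime (P.map (algebraMap ℂ[X] (FractionRing ℂ[X])))
      (derivative (P.map (algebraMap ℂ[X] (FractionRing ℂ[X])))) := hirr.separable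
    have hinj : Function.Injective (algebraMap ℂ[X] (FractionRing ℂ[X])) :=
      IsFractionRing.injective _ _
    refine ⟨resultant P (derivative P), fun h0 => ?_, ?_⟩
    · refine resultant_ne_zero _ _ hsep ?_
      rw [derivative_map, natDegree_map_eq_of_injective hinj, natDegree_map_eq_of_injective hinj,
        resultant_map_map, h0, map_zero]
    · obtain ⟨a, b, _, _, h⟩ := exists_mul_add_mul_eq_C_resultant P (derivative P) le_rfl le_rfl
        (Or.inl hd.ne')
      exact ⟨a, b, h⟩

theorem finite_setOf_ev_evDeriv_zero_eq_zero {Q : MvPolynomial (Fin 2) ℂ} (hQ : Irreducible Q) :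
    {t : ℂ | ∃ z, ev Q (z, t) = 0 ∧ evDeriv Q 0 (z, t) = 0}.Finite := by
  set s : Equiv.Perm (Fin 2) := Equiv.swap 0 1 with hs
  have hev : ∀ (P : MvPolynomial (Fin 2) ℂ) z t, ev (MvPolynomial.rename s P) (t, z) =
      ev P (z, t) := by
    intro P z t
    rw [ev, MvPolynomial.eval_rename, ev]
    congr 2
    ext i
    fin_cases i <;> simp [hs]
  have hi : Irreducible (MvPolynomial.rename s Q) :=
    (MulEquiv.irreducible_iff (MvPolynomial.renameEquiv ℂ s)).2 hQ
  refine (finite_setOf_ev_evDeriv_one_eq_zero hi).subset ?_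
  rintro t ⟨z, h1, h2⟩
  refine ⟨z, by rw [hev, h1], ?_⟩
  have h3 := MvPolynomial.pderiv_rename (R := ℂ) (f := s) s.injective 0 Q
  have h4 : s 0 = 1 := by simp [hs]
  rw [h4] at h3
  rw [evDeriv, h3, hev]
  exact h2

theorem ae_evDeriv_one_ne_zero {Q : MvPolynomial (Fin 2) ℂ} (hQ : Irreducible Q) :
    ∀ᵐ z : ℂ, ∀ t, ev Q (z, t) = 0 → evDeriv Q 1 (z, t) ≠ 0 := by
  refine measure_mono_null (fun z hz => ?_)
    ((finite_setOf_ev_evDeriv_one_eq_zero hQ).measure_zero volume)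
  simpa using hz

theorem ae_evDeriv_zero_ne_zero {Q : MvPolynomial (Fin 2) ℂ} (hQ : Irreducible Q) :
    ∀ᵐ t : ℂ, ∀ z, ev Q (z, t) = 0 → evDeriv Q 0 (z, t) ≠ 0 := by
  refine measure_mono_null (fun z hz => ?_)
    ((finite_setOf_ev_evDeriv_zero_eq_zero hQ).measure_zero volume)
  simpa using hz

end GenericSeparability

/-! ### Wirtinger derivatives of inverses and logarithms -/

section WirtingerQuotients

variable {E : Type*} [NormedAddCommGroup E] [NormedSpace ℂ E] {f : E → ℂ} {s : ℂ} {v p : E}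

theorem wirt_inv (hf : DifferentiableAt ℝ f p) (h0 : f p ≠ 0) :
    wirt s v (fun q => (f q)⁻¹) p = -wirt s v f p / f p ^ 2 := by
  have h1 : wirt s v (fun q => f q * (f q)⁻¹) p = 0 := by
    have : (fun q => f q * (f q)⁻¹) =ᶠ[𝓝 p] fun _ => 1 := by
      filter_upwards [hf.continuousAt.eventually_ne h0] with q hq using mul_inv_cancel₀ hq
    rw [wirt_congr this]
    simp [wirt]
  rw [wirt_mul (g := fun q => (f q)⁻¹) hf (hf.inv h0)] at h1
  field_simp
  field_simp at h1
  linear_combination h1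

theorem wirt_clog (hf : DifferentiableAt ℝ f p) (h0 : f p ∈ Complex.slitPlane) :
    wirt s v (fun q => Complex.log (f q)) p = wirt s v f p / f p := by
  have h := ((((Complex.hasStrictDerivAt_log h0).hasDerivAt.hasFDerivAt.restrictScalars ℝ).comp p
    hf.hasFDerivAt).fderiv :)
  change fderiv ℝ (fun q => Complex.log (f q)) p = _ at h
  simp only [wirt, h]
  simp
  ring

end WirtingerQuotients

/-! ### Regularization of `log |Q|` and `1 / Q` -/

section Regularization

variable (Q : MvPolynomial (Fin 2) ℂ)

/-- The smooth positive function `|Q|² + ε`, for `ε > 0`. -/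
def regNormSq (ε : ℝ) (p : ℂ × ℂ) : ℂ := ev Q p * conj (ev Q p) + ε

theorem regNormSq_eq (ε : ℝ) (p : ℂ × ℂ) : regNormSq Q ε p = ((‖ev Q p‖ ^ 2 + ε : ℝ) : ℂ) := by
  rw [regNormSq, Complex.mul_conj, Complex.normSq_eq_norm_sq]; push_cast; rfl

theorem norm_regNormSq {ε : ℝ} (hε : 0 < ε) (p : ℂ × ℂ) :
    ‖regNormSq Q ε p‖ = ‖ev Q p‖ ^ 2 + ε := by
  rw [regNormSq_eq, Complex.norm_real, Real.norm_of_nonneg (by positivity)]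

theorem regNormSq_ne_zero {ε : ℝ} (hε : 0 < ε) (p : ℂ × ℂ) : regNormSq Q ε p ≠ 0 := by
  rw [← norm_pos_iff, norm_regNormSq Q hε]
  positivity

theorem contDiff_conj_ev {n : WithTop ℕ∞} : ContDiff ℝ n fun p => conj (ev Q p) :=
  Complex.conjCLE.contDiff.comp (contDiff_real_ev Q)

theorem contDiff_regNormSq (ε : ℝ) {n : WithTop ℕ∞} : ContDiff ℝ n (regNormSq Q ε) :=
  ((contDiff_real_ev Q).mul (contDiff_conj_ev Q)).add contDiff_const

theorem dHol_conj_ev (j : Fin 2) (p : ℂ × ℂ) : dHol j (fun q => conj (ev Q q)) p = 0 := by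
  rw [dHol_eq_wirt, wirt_comp_conj ((contDiff_real_ev Q (n := 1)).differentiable (by simp) p)]
  simp [← dAnti_eq_wirt, dAnti_ev]

theorem wirt_regNormSq (s : ℂ) (v p : ℂ × ℂ) (ε : ℝ) : wirt s v (regNormSq Q ε) p =
    wirt s v (ev Q) p * conj (ev Q p) + ev Q p * wirt s v (fun q => conj (ev Q q)) p := by
  have h1 := (contDiff_real_ev Q (n := 1)).differentiable (by simp) p
  have h2 := (contDiff_conj_ev Q (n := 1)).differentiable (by simp) p
  change wirt s v (fun q => ev Q q * conj (ev Q q) + ε) p = _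
  rw [wirt_add (f := fun q => ev Q q * conj (ev Q q)) (g := fun _ => (ε : ℂ)) (h1.mul h2)
    (differentiableAt_const _), wirt_mul h1 h2]
  simp [wirt]

theorem dHol_regNormSq (j : Fin 2) (p : ℂ × ℂ) (ε : ℝ) :
    dHol j (regNormSq Q ε) p = evDeriv Q j p * conj (ev Q p) := by
  rw [dHol_eq_wirt, wirt_regNormSq, ← dHol_eq_wirt, dHol_ev, dHol_conj_ev, mul_zero, add_zero]

theorem dAnti_regNormSq (j : Fin 2) (p : ℂ × ℂ) (ε : ℝ) :
    dAnti j (regNormSq Q ε) p = ev Q p * conj (evDeriv Q j p) := by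
  rw [dAnti_eq_wirt, wirt_regNormSq, ← dAnti_eq_wirt, dAnti_ev, dAnti_conj_ev, zero_mul, zero_add]

/-- The smooth function `Q̄ / (|Q|² + ε)`, which tends to `1 / Q` as `ε → 0`. -/
def regInv (ε : ℝ) (p : ℂ × ℂ) : ℂ := conj (ev Q p) * (regNormSq Q ε p)⁻¹

theorem contDiff_regInv {ε : ℝ} (hε : 0 < ε) {n : WithTop ℕ∞} : ContDiff ℝ n (regInv Q ε) :=
  (contDiff_conj_ev Q).mul ((contDiff_regNormSq Q ε).inv (regNormSq_ne_zero Q hε))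

theorem dAnti_regInv {ε : ℝ} (hε : 0 < ε) (j : Fin 2) (p : ℂ × ℂ) :
    dAnti j (regInv Q ε) p = ε * conj (evDeriv Q j p) / regNormSq Q ε p ^ 2 := by
  have h2 := (contDiff_conj_ev Q (n := 1)).differentiable (by simp) p
  have h3 := (contDiff_regNormSq Q ε (n := 1)).differentiable (by simp) p
  have h0 := regNormSq_ne_zero Q hε p
  change wirt _ _ (fun q => conj (ev Q q) * (regNormSq Q ε q)⁻¹) p = _
  rw [wirt_mul (g := fun q => (regNormSq Q ε q)⁻¹) h2 (h3.inv h0), wirt_inv h3 h0, ← dAnti_eq_wirt,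
      dAnti_conj_ev, dAnti_regNormSq]
  field_simp
  rw [regNormSq]
  ring

theorem norm_regInv_le {ε : ℝ} (hε : 0 < ε) (p : ℂ × ℂ) : ‖regInv Q ε p‖ ≤ ‖(ev Q p)⁻¹‖ := by
  rw [regInv, norm_mul, norm_inv, norm_inv, norm_regNormSq Q hε, RCLike.norm_conj]
  rcases eq_or_ne (ev Q p) 0 with h0 | h0
  · simp [h0]
  · have : 0 < ‖ev Q p‖ := norm_pos_iff.2 h0
    rw [← div_eq_mul_inv, ← one_div, div_le_div_iff₀ (by positivity) this]
    nlinarith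

theorem tendsto_regInv (p : ℂ × ℂ) :
    Tendsto (fun n : ℕ => regInv Q (1 / ((n : ℝ) + 1)) p) atTop (𝓝 (ev Q p)⁻¹) := by
  rcases eq_or_ne (ev Q p) 0 with h0 | h0
  · simp [regInv, h0]
  · have h1 : Tendsto (fun n : ℕ => regNormSq Q (1 / ((n : ℝ) + 1)) p) atTop
        (𝓝 (ev Q p * conj (ev Q p) + (0 : ℝ))) :=
      tendsto_const_nhds.add
        ((Complex.continuous_ofReal.tendsto _).comp tendsto_one_div_add_atTop_nhds_zero_nat)
    have h2 : conj (ev Q p) ≠ 0 := by simpa using h0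
    rw [Complex.ofReal_zero, add_zero] at h1
    have h3 := (h1.inv₀ (mul_ne_zero h0 h2)).const_mul (conj (ev Q p))
    have h4 : conj (ev Q p) * (ev Q p * conj (ev Q p))⁻¹ = (ev Q p)⁻¹ := by field_simp
    rw [h4] at h3
    exact h3

variable {Q} {ψ ψ₀ ψ₁ : ℂ × ℂ → ℂ}

theorem integrable_logDeriv_mul (j : Fin 2) (hψ : Continuous ψ) (hc : HasCompactSupport ψ) :
    Integrable fun p => evDeriv Q j p / ev Q p * ψ p := by
  simpa [mul_comm] using
    (locallyIntegrable_logDeriv Q j).integrable_smul_left_of_hasCompactSupport hψ hc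

theorem tendsto_integral_regInv (j : Fin 2) (hψ : Continuous ψ) (hc : HasCompactSupport ψ) :
    Tendsto (fun n : ℕ => ∫ p, evDeriv Q j p * regInv Q (1 / ((n : ℝ) + 1)) p * ψ p) atTop
      (𝓝 (∫ p, evDeriv Q j p / ev Q p * ψ p)) := by
  refine tendsto_integral_of_dominated_convergence (fun p => ‖evDeriv Q j p / ev Q p * ψ p‖) ?_
    (integrable_logDeriv_mul j hψ hc).norm ?_ ?_
  · intro n
    have := (contDiff_regInv Q (ε := 1 / ((n : ℝ) + 1)) (by positivity) (n := 0)).continuous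
    exact (((continuous_evDeriv Q j).mul this).mul hψ).aestronglyMeasurable
  · refine fun n => .of_forall fun p => ?_
    rw [div_eq_mul_inv (evDeriv Q j p), norm_mul, norm_mul, norm_mul, norm_mul]
    gcongr
    exact norm_regInv_le Q (by positivity) p
  · refine .of_forall fun p => ?_
    rw [div_eq_mul_inv]
    exact ((tendsto_regInv Q p).const_mul _).mul_const _

theorem ae_ev_ne_zero (hQ : Q ≠ 0) : ∀ᵐ p, ev Q p ≠ 0 := by
  obtain ⟨p₀, hp₀⟩ := exists_ev_ne_zero hQ
  rw [Measure.volume_eq_prod, Measure.ae_prod_iff_ae_ae]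
  · have h : sliceZ Q p₀.2 ≠ 0 := by
      intro h
      have := eval_sliceZ Q p₀.1 p₀.2
      rw [h] at this
      exact hp₀ (by simpa using this.symm)
    filter_upwards [ae_eval_ne_zero h] with z hz
    have h' : sliceT Q z ≠ 0 := by
      intro h
      have := eval_sliceT Q z p₀.2
      rw [h] at this
      rw [eval_sliceZ] at hz
      exact hz (by simpa using this.symm)
    filter_upwards [ae_eval_ne_zero h'] with t ht
    simpa using ht
  · exact (measurableSet_eq_fun (continuous_ev Q).measurable measurable_const).compl

theorem integrable_log_mul (hQ : Q ≠ 0) (hψ : Continuous ψ) (hc : HasCompactSupport ψ) :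
    Integrable fun p => (Real.log ‖ev Q p‖ : ℂ) * ψ p := by
  have h : LocallyIntegrable fun p => (Real.log ‖ev Q p‖ : ℂ) := fun p => by
    obtain ⟨s, hs, h⟩ := locallyIntegrable_log_norm_ev hQ p
    exact ⟨s, hs, h.ofReal⟩
  simpa [mul_comm] using h.integrable_smul_left_of_hasCompactSupport hψ hc

/-- `∂ log |Q| = ∂Q / (2 Q)` in the sense of distributions. -/
theorem integral_log_mul_dHol (hQ : Q ≠ 0) (j : Fin 2) (hψ : ContDiff ℝ ∞ ψ)
    (hc : HasCompactSupport ψ) :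
    ∫ p, (Real.log ‖ev Q p‖ : ℂ) * dHol j ψ p = -(1 / 2) * ∫ p, evDeriv Q j p / ev Q p * ψ p := by
  have hdψ : Continuous (dHol j ψ) := by
    rw [dHol_eq_wirt]; exact (contDiff_wirt hψ).continuous
  have hcd : HasCompactSupport (dHol j ψ) := by
    rw [dHol_eq_wirt]; exact hasCompactSupport_wirt hc
  have hε : ∀ n : ℕ, (0 : ℝ) < 1 / ((n : ℝ) + 1) := fun n => by positivity
  have hslit : ∀ (n : ℕ) p, regNormSq Q (1 / ((n : ℝ) + 1)) p ∈ Complex.slitPlane := by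
    intro n p
    rw [regNormSq_eq]
    refine Complex.ofReal_mem_slitPlane.2 ?_
    have := hε n
    positivity
  have hsm : ∀ n : ℕ, ContDiff ℝ ∞ fun p => Complex.log (regNormSq Q (1 / ((n : ℝ) + 1)) p) :=
    fun n => contDiff_iff_contDiffAt.2 fun p =>
      ((Complex.contDiffAt_log (hslit n p)).restrict_scalars ℝ).comp p
        (contDiff_regNormSq Q _).contDiffAt
  -- the identity holds with `½ log (|Q|² + ε)` in place of `log |Q|`, and with
  -- `Q̄ / (|Q|² + ε)` in place of `1 / Q`
  have key : ∀ n : ℕ, ∫ p, (1 / 2 : ℂ) * Complex.log (regNormSq Q (1 / ((n : ℝ) + 1)) p) *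
      dHol j ψ p =
      -(1 / 2) * ∫ p, evDeriv Q j p * regInv Q (1 / ((n : ℝ) + 1)) p * ψ p := by
    intro n
    have h1 := integral_mul_wirt (μ := volume) (s := -Complex.I) (v := basisVec j) (hsm n) hψ hc
    simp only [mul_assoc, integral_const_mul]
    rw [dHol_eq_wirt, h1, mul_neg, neg_mul]
    congr 3
    funext p
    rw [wirt_clog ((contDiff_regNormSq Q _ (n := 1)).differentiable (by simp) p) (hslit n p),
      ← dHol_eq_wirt, dHol_regNormSq, regInv]
    ring
  have hlim := (tendsto_integral_regInv (Q := Q) j hψ.continuous hc).const_mul (-(1 / 2) : ℂ)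
  simp only [← key] at hlim
  refine tendsto_nhds_unique ?_ hlim
  refine tendsto_integral_of_dominated_convergence
    (fun p => ‖(Real.log ‖ev Q p‖ : ℂ) * dHol j ψ p‖ + ‖ev Q p ^ 2 * dHol j ψ p‖) ?_ ?_ ?_ ?_
  · intro n
    exact ((continuous_const.mul (hsm n).continuous).mul hdψ).aestronglyMeasurable
  · refine (integrable_log_mul hQ hdψ hcd).norm.add ?_
    exact ((((continuous_ev Q).pow 2).mul hdψ).integrable_of_hasCompactSupport hcd.mul_left).norm
  · intro n
    filter_upwards [ae_ev_ne_zero hQ] with p hp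
    have hp' : 0 < ‖ev Q p‖ := norm_pos_iff.2 hp
    rw [norm_mul _ (dHol j ψ p), norm_mul _ (dHol j ψ p), norm_mul _ (dHol j ψ p), ← add_mul]
    gcongr
    rw [regNormSq_eq, ← Complex.ofReal_log (by have := hε n; positivity)]
    have e1 : (1 / 2 : ℂ) = ((1 / 2 : ℝ) : ℂ) := by norm_num
    rw [e1, ← Complex.ofReal_mul, Complex.norm_real, Complex.norm_real, norm_pow, Real.norm_eq_abs,
      Real.norm_eq_abs]
    set x := ‖ev Q p‖
    have hn := hε n
    have hn1 : 1 / ((n : ℝ) + 1) ≤ 1 := by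
      rw [div_le_one (by positivity)]; linarith [(Nat.cast_nonneg n : (0 : ℝ) ≤ n)]
    have lo : Real.log x ≤ 1 / 2 * Real.log (x ^ 2 + 1 / ((n : ℝ) + 1)) := by
      have := Real.log_le_log (by positivity) (show x ^ 2 ≤ x ^ 2 + 1 / ((n : ℝ) + 1) by linarith)
      rw [Real.log_pow] at this
      push_cast at this
      linarith
    have hi : 1 / 2 * Real.log (x ^ 2 + 1 / ((n : ℝ) + 1)) ≤ x ^ 2 := by
      have := Real.log_le_sub_one_of_pos (show 0 < x ^ 2 + 1 / ((n : ℝ) + 1) by positivity)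
      nlinarith [sq_nonneg x]
    rw [abs_le]
    constructor
    · linarith [neg_abs_le (Real.log x), sq_nonneg x]
    · linarith [abs_nonneg (Real.log x)]
  · filter_upwards [ae_ev_ne_zero hQ] with p hp
    have hp' : 0 < ‖ev Q p‖ := norm_pos_iff.2 hp
    refine Tendsto.mul_const _ ?_
    have h1 : Tendsto (fun n : ℕ => 1 / 2 * Real.log (‖ev Q p‖ ^ 2 + 1 / ((n : ℝ) + 1))) atTop
        (𝓝 (1 / 2 * Real.log (‖ev Q p‖ ^ 2 + 0))) := by
      refine Tendsto.const_mul _ (Tendsto.log ?_ (by positivity))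
      exact tendsto_const_nhds.add tendsto_one_div_add_atTop_nhds_zero_nat
    have h2 : 1 / 2 * Real.log (‖ev Q p‖ ^ 2 + 0) = Real.log ‖ev Q p‖ := by
      rw [add_zero, Real.log_pow]; push_cast; ring
    rw [h2] at h1
    refine ((Complex.continuous_ofReal.tendsto _).comp h1).congr fun n => ?_
    rw [Function.comp_apply, regNormSq_eq, ← Complex.ofReal_log (by have := hε n; positivity)]
    push_cast
    ring

/-- The current `∂̄ (1 / Q)` is annihilated by the `(0,1)`-forms `ψ₀ dz̄₁ - ψ₁ dz̄₀` for which
`conj(∂₀Q) ψ₀ + conj(∂₁Q) ψ₁` vanishes to second order on the curve, as a multiple of `|Q|²`. -/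
theorem integral_logDeriv_mul_dAnti_add_eq_zero (hQ : Q ≠ 0) (j : Fin 2)
    (hψ₀ : ContDiff ℝ ∞ ψ₀) (hc₀ : HasCompactSupport ψ₀)
    (hψ₁ : ContDiff ℝ ∞ ψ₁) (hc₁ : HasCompactSupport ψ₁)
    {κ : ℂ × ℂ → ℂ} (hκ : Continuous κ) (hcκ : HasCompactSupport κ)
    (h : ∀ p, conj (evDeriv Q 0 p) * ψ₀ p + conj (evDeriv Q 1 p) * ψ₁ p =
      ev Q p * conj (ev Q p) * κ p) :
    (∫ p, evDeriv Q j p / ev Q p * dAnti 0 ψ₀ p) +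
      ∫ p, evDeriv Q j p / ev Q p * dAnti 1 ψ₁ p = 0 := by
  have hlim := (tendsto_integral_regInv (Q := Q) j (contDiff_wirt (s := Complex.I)
    (v := basisVec 0) hψ₀).continuous (hasCompactSupport_wirt hc₀)).add
    (tendsto_integral_regInv (Q := Q) j (contDiff_wirt (s := Complex.I)
    (v := basisVec 1) hψ₁).continuous (hasCompactSupport_wirt hc₁))
  refine tendsto_nhds_unique hlim ?_
  have hε : ∀ n : ℕ, (0 : ℝ) < 1 / ((n : ℝ) + 1) := fun n => by positivity
  have hsm : ∀ n : ℕ, ContDiff ℝ ∞ fun p => evDeriv Q j p * regInv Q (1 / ((n : ℝ) + 1)) p :=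
      fun n =>
    (contDiff_real_evDeriv Q j).mul (contDiff_regInv Q (hε n))
  have hd : ∀ (n : ℕ) k p, wirt Complex.I (basisVec k)
      (fun p => evDeriv Q j p * regInv Q (1 / ((n : ℝ) + 1)) p) p =
      evDeriv Q j p * ((1 / ((n : ℝ) + 1) : ℝ) * conj (evDeriv Q k p) /
        regNormSq Q (1 / ((n : ℝ) + 1)) p ^ 2) := by
    intro n k p
    have h0 : dAnti k (evDeriv Q j) p = 0 := dAnti_ev _ k p
    rw [wirt_mul ((contDiff_real_evDeriv Q j (n := 1)).differentiable (by simp) p)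
      ((contDiff_regInv Q (hε n) (n := 1)).differentiable (by simp) p), ← dAnti_eq_wirt,
      dAnti_regInv Q (hε n), h0]
    ring
  have key : ∀ n : ℕ, (∫ p, evDeriv Q j p * regInv Q (1 / ((n : ℝ) + 1)) p *
        wirt Complex.I (basisVec 0) ψ₀ p) +
      (∫ p, evDeriv Q j p * regInv Q (1 / ((n : ℝ) + 1)) p * wirt Complex.I (basisVec 1) ψ₁ p) =
      -∫ p, (1 / ((n : ℝ) + 1) : ℝ) * (ev Q p * conj (ev Q p)) /
        regNormSq Q (1 / ((n : ℝ) + 1)) p ^ 2 * (evDeriv Q j p * κ p) := by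
    intro n
    rw [integral_mul_wirt (hsm n) hψ₀ hc₀, integral_mul_wirt (hsm n) hψ₁ hc₁, ← neg_add,
      ← integral_add]
    · congr 2
      funext p
      rw [hd, hd]
      linear_combination (evDeriv Q j p * ((1 / ((n : ℝ) + 1) : ℝ) /
        regNormSq Q (1 / ((n : ℝ) + 1)) p ^ 2)) * h p
    · exact ((contDiff_wirt (hsm n)).continuous.mul hψ₀.continuous).integrable_of_hasCompactSupport
        hc₀.mul_left
    · exact ((contDiff_wirt (hsm n)).continuous.mul hψ₁.continuous).integrable_of_hasCompactSupport
        hc₁.mul_left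
  simp only [key]
  have h0 : (0 : ℂ) = -∫ p : ℂ × ℂ, (0 : ℂ) := by simp
  rw [h0]
  refine Tendsto.neg ?_
  have hDc : ∀ n : ℕ, Continuous fun p => regNormSq Q (1 / ((n : ℝ) + 1)) p := fun n =>
    (contDiff_regNormSq Q _ (n := 0)).continuous
  refine tendsto_integral_of_dominated_convergence (fun p => ‖evDeriv Q j p * κ p‖) ?_ ?_ ?_ ?_
  · intro n
    refine Continuous.aestronglyMeasurable ?_
    refine Continuous.mul (Continuous.div ?_ ((hDc n).pow 2) fun p =>
      pow_ne_zero _ (regNormSq_ne_zero Q (hε n) p)) ((continuous_evDeriv Q j).mul hκ)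
    exact continuous_const.mul ((continuous_ev Q).mul (contDiff_conj_ev Q (n := 0)).continuous)
  · exact (((continuous_evDeriv Q j).mul hκ).integrable_of_hasCompactSupport hcκ.mul_left).norm
  · refine fun n => .of_forall fun p => ?_
    rw [norm_mul]
    refine mul_le_of_le_one_left (norm_nonneg _) ?_
    rw [norm_div, norm_pow, norm_regNormSq Q (hε n), norm_mul, norm_mul, RCLike.norm_conj,
      Complex.norm_real, Real.norm_of_nonneg (hε n).le]
    have := hε n
    rw [div_le_one (by positivity)]
    nlinarith [sq_nonneg (‖ev Q p‖ ^ 2), mul_nonneg (hε n).le (sq_nonneg ‖ev Q p‖),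
        sq_nonneg (1 / ((n : ℝ) + 1))]
  · filter_upwards [ae_ev_ne_zero hQ] with p hp
    have h1 : Tendsto (fun n : ℕ => regNormSq Q (1 / ((n : ℝ) + 1)) p) atTop
        (𝓝 (ev Q p * conj (ev Q p) + (0 : ℝ))) :=
      tendsto_const_nhds.add
        ((Complex.continuous_ofReal.tendsto _).comp tendsto_one_div_add_atTop_nhds_zero_nat)
    have h2 : conj (ev Q p) ≠ 0 := by simpa using hp
    rw [Complex.ofReal_zero, add_zero] at h1
    have h3 : Tendsto (fun n : ℕ => ((1 / ((n : ℝ) + 1) : ℝ) : ℂ)) atTop (𝓝 ((0 : ℝ) : ℂ)) :=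
      (Complex.continuous_ofReal.tendsto _).comp tendsto_one_div_add_atTop_nhds_zero_nat
    have h4 := ((h3.mul_const (ev Q p * conj (ev Q p))).div (h1.pow 2)
      (pow_ne_zero _ (mul_ne_zero hp h2))).mul_const (evDeriv Q j p * κ p)
    simpa using h4

end Regularization

/-! ### Slicing by the coordinate lines -/

section Slicing

theorem isClosedEmbedding_prodMk_left (z : ℂ) : IsClosedEmbedding fun t : ℂ => (z, t) :=
  (Isometry.of_dist_eq fun x y => by simp [Prod.dist_eq]).isClosedEmbedding

theorem isClosedEmbedding_prodMk_right (t : ℂ) : IsClosedEmbedding fun z : ℂ => (z, t) :=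
  (Isometry.of_dist_eq fun x y => by simp [Prod.dist_eq]).isClosedEmbedding

variable {Q : MvPolynomial (Fin 2) ℂ} {ψ : ℂ × ℂ → ℂ}

theorem wirt_slice_one (hψ : ContDiff ℝ ∞ ψ) (z t : ℂ) :
    wirt Complex.I 1 (fun t => ψ (z, t)) t = dAnti 1 ψ (z, t) := by
  have h : HasFDerivAt (fun t => ψ (z, t)) ((fderiv ℝ ψ (z, t)).comp (.inr ℝ ℂ ℂ)) t :=
    (hψ.differentiable (by simp) (z, t)).hasFDerivAt.comp t (hasFDerivAt_prodMk_right z t)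
  simp [wirt, dAnti, h.fderiv]

theorem wirt_slice_zero (hψ : ContDiff ℝ ∞ ψ) (z t : ℂ) :
    wirt Complex.I 1 (fun z => ψ (z, t)) z = dAnti 0 ψ (z, t) := by
  have h : HasFDerivAt (fun z => ψ (z, t)) ((fderiv ℝ ψ (z, t)).comp (.inl ℝ ℂ ℂ)) z :=
    (hψ.differentiable (by simp) (z, t)).hasFDerivAt.comp z (hasFDerivAt_prodMk_left z t)
  simp [wirt, dAnti, h.fderiv]

variable (Q) in
/-- The roots of `t ↦ Q(z, t)`; the empty set if this polynomial vanishes. -/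
def rootsT (z : ℂ) : Finset ℂ := (sliceT Q z).roots.toFinset

variable (Q) in
/-- The roots of `z ↦ Q(z, t)`; the empty set if this polynomial vanishes. -/
def rootsZ (t : ℂ) : Finset ℂ := (sliceZ Q t).roots.toFinset

theorem mem_rootsT {z : ℂ} (hz : ∀ t, ev Q (z, t) = 0 → evDeriv Q 1 (z, t) ≠ 0) {t : ℂ} :
    t ∈ rootsT Q z ↔ ev Q (z, t) = 0 := by
  have h0 : sliceT Q z ≠ 0 := by
    intro h
    refine hz 0 ?_ ?_
    · rw [← eval_sliceT, h]; simp
    · rw [← eval_derivative_sliceT, h]; simp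
  simp [rootsT, h0]

theorem mem_rootsZ {t : ℂ} (ht : ∀ z, ev Q (z, t) = 0 → evDeriv Q 0 (z, t) ≠ 0) {z : ℂ} :
    z ∈ rootsZ Q t ↔ ev Q (z, t) = 0 := by
  have h0 : sliceZ Q t ≠ 0 := by
    intro h
    refine ht 0 ?_ ?_
    · rw [← eval_sliceZ, h]; simp
    · rw [← eval_derivative_sliceZ, h]; simp
  simp [rootsZ, h0]

/-- On almost every line `{z} × ℂ`, the function `∂_jQ / Q` has simple poles with residues
`∂_jQ / ∂_tQ`. -/
theorem integral_logDeriv_mul_dAnti_one (hQ : Irreducible Q) (j : Fin 2) (hψ : ContDiff ℝ ∞ ψ)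
    (hc : HasCompactSupport ψ) :
    Integrable (fun z => ∑ t ∈ rootsT Q z, evDeriv Q j (z, t) / evDeriv Q 1 (z, t) * ψ (z, t)) ∧
    ∫ p, evDeriv Q j p / ev Q p * dAnti 1 ψ p =
      -Real.pi * ∫ z, ∑ t ∈ rootsT Q z, evDeriv Q j (z, t) / evDeriv Q 1 (z, t) * ψ (z, t) := by
  have hi : Integrable fun p => evDeriv Q j p / ev Q p * dAnti 1 ψ p :=
    integrable_logDeriv_mul j (contDiff_wirt hψ).continuous (hasCompactSupport_wirt hc)
  rw [Measure.volume_eq_prod] at hi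
  have hπ : (-Real.pi : ℂ) ≠ 0 := by simp [Real.pi_ne_zero]
  have key : ∀ᵐ z, ∫ t, evDeriv Q j (z, t) / ev Q (z, t) * dAnti 1 ψ (z, t) =
      -Real.pi * ∑ t ∈ rootsT Q z, evDeriv Q j (z, t) / evDeriv Q 1 (z, t) * ψ (z, t) := by
    filter_upwards [ae_evDeriv_one_ne_zero hQ] with z hz
    have h := integral_div_mul_wirt (g := fun t => ψ (z, t))
      (hψ.comp (contDiff_const.prodMk contDiff_id))
      (hc.comp_isClosedEmbedding (isClosedEmbedding_prodMk_left z))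
      (sliceT (MvPolynomial.pderiv j Q) z) (q := sliceT Q z) (by simpa using hz)
    simp only [eval_sliceT, eval_derivative_sliceT, wirt_slice_one hψ] at h
    exact h
  constructor
  · refine (hi.integral_prod_left.const_mul (-Real.pi : ℂ)⁻¹).congr ?_
    filter_upwards [key] with z hz
    rw [hz, inv_mul_cancel_left₀ hπ]
  · rw [Measure.volume_eq_prod, integral_prod _ hi, ← integral_const_mul]
    exact integral_congr_ae key

/-- On almost every line `ℂ × {t}`, the function `∂_zQ / Q` has simple poles with residue `1`. -/
theorem integral_logDeriv_mul_dAnti_zero (hQ : Irreducible Q) (hψ : ContDiff ℝ ∞ ψ)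
    (hc : HasCompactSupport ψ) :
    Integrable (fun t => ∑ z ∈ rootsZ Q t, ψ (z, t)) ∧
    ∫ p, evDeriv Q 0 p / ev Q p * dAnti 0 ψ p =
      -Real.pi * ∫ t, ∑ z ∈ rootsZ Q t, ψ (z, t) := by
  have hi : Integrable fun p => evDeriv Q 0 p / ev Q p * dAnti 0 ψ p :=
    integrable_logDeriv_mul 0 (contDiff_wirt hψ).continuous (hasCompactSupport_wirt hc)
  rw [Measure.volume_eq_prod] at hi
  have hπ : (-Real.pi : ℂ) ≠ 0 := by simp [Real.pi_ne_zero]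
  have key : ∀ᵐ t, ∫ z, evDeriv Q 0 (z, t) / ev Q (z, t) * dAnti 0 ψ (z, t) =
      -Real.pi * ∑ z ∈ rootsZ Q t, ψ (z, t) := by
    filter_upwards [ae_evDeriv_zero_ne_zero hQ] with t ht
    have h := integral_div_mul_wirt (g := fun z => ψ (z, t))
      (hψ.comp (contDiff_id.prodMk contDiff_const))
      (hc.comp_isClosedEmbedding (isClosedEmbedding_prodMk_right t))
      (sliceZ (MvPolynomial.pderiv 0 Q) t) (q := sliceZ Q t) (by simpa using ht)
    simp only [eval_sliceZ, eval_derivative_sliceZ, wirt_slice_zero hψ] at h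
    refine h.trans ?_
    congr 1
    refine Finset.sum_congr rfl fun z hz => ?_
    have h0 : evDeriv Q 0 (z, t) ≠ 0 := ht z ((mem_rootsZ ht).1 hz)
    change evDeriv Q 0 (z, t) / evDeriv Q 0 (z, t) * ψ (z, t) = _
    rw [div_self h0, one_mul]
  constructor
  · refine (hi.integral_prod_right.const_mul (-Real.pi : ℂ)⁻¹).congr ?_
    filter_upwards [key] with z hz
    rw [hz, inv_mul_cancel_left₀ hπ]
  · rw [Measure.volume_eq_prod, integral_prod_symm _ hi, ← integral_const_mul]
    exact integral_congr_ae key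

end Slicing

/-! ### Change of coordinate on a curve -/

section ChangeOfCoordinate

variable {Q : MvPolynomial (Fin 2) ℂ} {ψ : ℂ × ℂ → ℂ}

theorem contDiff_conj_evDeriv (j : Fin 2) {n : WithTop ℕ∞} :
    ContDiff ℝ n fun p => conj (evDeriv Q j p) := contDiff_conj_ev (MvPolynomial.pderiv j Q)

theorem exists_contDiff_norm_le (hψ : Continuous ψ) (hc : HasCompactSupport ψ) :
    ∃ Ψ : ℂ × ℂ → ℝ, ContDiff ℝ ∞ Ψ ∧ HasCompactSupport Ψ ∧ (∀ p, 0 ≤ Ψ p) ∧ ∀ p, ‖ψ p‖ ≤ Ψ p := by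
  obtain ⟨C, hC⟩ := hc.exists_bound_of_continuous hψ
  obtain ⟨R, hR0, hR⟩ := hc.isCompact.isBounded.subset_closedBall_lt 0 0
  let f : ContDiffBump (0 : ℂ × ℂ) := ⟨R, R + 1, hR0, by linarith⟩
  have hC0 : 0 ≤ C := (norm_nonneg _).trans (hC 0)
  refine ⟨fun p => C * f p, contDiff_const.mul f.contDiff, f.hasCompactSupport.mul_left,
    fun p => mul_nonneg hC0 f.nonneg, fun p => ?_⟩
  by_cases hp : p ∈ tsupport ψ
  · change _ ≤ C * f p
    rw [f.one_of_mem_closedBall (hR hp), mul_one]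
    exact hC p
  · rw [image_eq_zero_of_notMem_tsupport hp, norm_zero]
    exact mul_nonneg hC0 f.nonneg

/-- On the curve, the squared modulus of `dt / dz = -∂_zQ / ∂_tQ`, damped by `η > 0` near the points
where the projection to the `z`-line is ramified. -/
def dampedSlope (Q : MvPolynomial (Fin 2) ℂ) (η : ℝ) (p : ℂ × ℂ) : ℝ :=
  ‖evDeriv Q 0 p‖ ^ 2 / (‖evDeriv Q 1 p‖ ^ 2 + η)

/-- On the curve, a function that tends, as `η → 0`, to the indicator function of the set of points
where the projection to the `z`-line is unramified. -/
def dampedUnit (Q : MvPolynomial (Fin 2) ℂ) (η : ℝ) (p : ℂ × ℂ) : ℝ :=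
  ‖evDeriv Q 1 p‖ ^ 2 / (‖evDeriv Q 1 p‖ ^ 2 + η)

/-- A damped form of the change of coordinate from `t` to `z` on the curve `Q = 0`. With
`D = |∂_tQ|² + |Q|² + η`, the functions `(1 - η / D) ψ` and `-(conj(∂_zQ) ∂_tQ / D) ψ` are the
coefficients of a `(0,1)`-form of the kind annihilated by `∂̄ (1 / Q)`. -/
theorem integral_dampedSlope_eq (hQ : Irreducible Q) (hψ : ContDiff ℝ ∞ ψ)
    (hc : HasCompactSupport ψ) {η : ℝ} (hη : 0 < η) :
    Integrable (fun z => ∑ t ∈ rootsT Q z, (dampedSlope Q η (z, t) : ℂ) * ψ (z, t)) ∧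
    Integrable (fun t => ∑ z ∈ rootsZ Q t, (dampedUnit Q η (z, t) : ℂ) * ψ (z, t)) ∧
    ∫ z, ∑ t ∈ rootsT Q z, (dampedSlope Q η (z, t) : ℂ) * ψ (z, t) =
      ∫ t, ∑ z ∈ rootsZ Q t, (dampedUnit Q η (z, t) : ℂ) * ψ (z, t) := by
  set D : ℂ × ℂ → ℂ := fun p =>
    evDeriv Q 1 p * conj (evDeriv Q 1 p) + ev Q p * conj (ev Q p) + η with hD
  have hDeq : ∀ p, D p = ((‖evDeriv Q 1 p‖ ^ 2 + ‖ev Q p‖ ^ 2 + η : ℝ) : ℂ) := fun p => by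
    simp only [hD, Complex.mul_conj, Complex.normSq_eq_norm_sq]; push_cast; rfl
  have hD0 : ∀ p, D p ≠ 0 := fun p => by
    rw [hDeq]; exact_mod_cast (show 0 < ‖evDeriv Q 1 p‖ ^ 2 + ‖ev Q p‖ ^ 2 + η by positivity).ne'
  have hDs : ContDiff ℝ ∞ D :=
    (((contDiff_real_evDeriv Q 1).mul (contDiff_conj_evDeriv 1)).add
      ((contDiff_real_ev Q).mul (contDiff_conj_ev Q))).add contDiff_const
  have hDi : ContDiff ℝ ∞ fun p => (D p)⁻¹ := hDs.inv hD0
  have hc0 : ContDiff ℝ ∞ fun p => conj (evDeriv Q 0 p) :=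
    contDiff_conj_evDeriv 0
  set ψ₀ : ℂ × ℂ → ℂ := fun p => (1 - η * (D p)⁻¹) * ψ p with hψ₀
  set ψ₁ : ℂ × ℂ → ℂ := fun p => -(conj (evDeriv Q 0 p) * evDeriv Q 1 p * (D p)⁻¹) * ψ p with hψ₁
  set κ : ℂ × ℂ → ℂ := fun p => conj (evDeriv Q 0 p) * (D p)⁻¹ * ψ p with hκ
  have hs₀ : ContDiff ℝ ∞ ψ₀ := (contDiff_const.sub (contDiff_const.mul hDi)).mul hψ
  have hs₁ : ContDiff ℝ ∞ ψ₁ := ((hc0.mul (contDiff_real_evDeriv Q 1)).mul hDi).neg.mul hψ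
  have hsκ : ContDiff ℝ ∞ κ := (hc0.mul hDi).mul hψ
  have hzero := integral_logDeriv_mul_dAnti_add_eq_zero hQ.ne_zero 0 hs₀ hc.mul_left hs₁ hc.mul_left
    hsκ.continuous hc.mul_left (fun p => by
      have := hD0 p
      simp only [hψ₀, hψ₁, hκ]
      field_simp
      simp only [hD]
      ring)
  obtain ⟨i0, e0⟩ := integral_logDeriv_mul_dAnti_zero hQ hs₀ hc.mul_left
  obtain ⟨i1, e1⟩ := integral_logDeriv_mul_dAnti_one hQ 0 hs₁ hc.mul_left
  have a0 : (fun t => ∑ z ∈ rootsZ Q t, ψ₀ (z, t)) =ᵐ[volume]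
      fun t => ∑ z ∈ rootsZ Q t, (dampedUnit Q η (z, t) : ℂ) * ψ (z, t) := by
    filter_upwards [ae_evDeriv_zero_ne_zero hQ] with t ht
    refine Finset.sum_congr rfl fun z hz => ?_
    have h0 := (mem_rootsZ ht).1 hz
    have := hD0 (z, t)
    simp only [hψ₀, dampedUnit]
    congr 1
    rw [hDeq, h0] at *
    push_cast at *
    simp only [norm_zero, ne_eq, OfNat.ofNat_ne_zero, not_false_eq_true, zero_pow, add_zero,
      Complex.ofReal_zero] at *
    field_simp
    ring
  have a1 : (fun z => ∑ t ∈ rootsT Q z, evDeriv Q 0 (z, t) / evDeriv Q 1 (z, t) * ψ₁ (z, t))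
      =ᵐ[volume] fun z => -∑ t ∈ rootsT Q z, (dampedSlope Q η (z, t) : ℂ) * ψ (z, t) := by
    filter_upwards [ae_evDeriv_one_ne_zero hQ] with z hz
    rw [← Finset.sum_neg_distrib]
    refine Finset.sum_congr rfl fun t ht => ?_
    have h0 := (mem_rootsT hz).1 ht
    have h1 := hz t h0
    have := hD0 (z, t)
    simp only [hψ₁, dampedSlope]
    have e2 : ((‖evDeriv Q 0 (z, t)‖ ^ 2 : ℝ) : ℂ) =
        evDeriv Q 0 (z, t) * conj (evDeriv Q 0 (z, t)) := by
      rw [Complex.mul_conj, Complex.normSq_eq_norm_sq]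
    rw [hDeq, h0] at *
    rw [Complex.ofReal_div, e2]
    push_cast at *
    simp only [norm_zero, ne_eq, OfNat.ofNat_ne_zero, not_false_eq_true, zero_pow, add_zero,
      Complex.ofReal_zero] at *
    field_simp
  refine ⟨(i1.congr a1).neg.congr (.of_forall fun z => by simp), i0.congr a0, ?_⟩
  rw [e0, e1, integral_congr_ae a0, integral_congr_ae a1, integral_neg] at hzero
  have hπ : (-Real.pi : ℂ) ≠ 0 := by simp [Real.pi_ne_zero]
  refine mul_left_cancel₀ hπ ?_
  linear_combination -hzero

theorem tendsto_dampedUnit (p : ℂ × ℂ) :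
    Tendsto (fun n : ℕ => dampedUnit Q (1 / ((n : ℝ) + 1)) p) atTop
      (𝓝 (if evDeriv Q 1 p = 0 then 0 else 1)) := by
  split_ifs with h
  · simp [dampedUnit, h]
  · have h1 : ‖evDeriv Q 1 p‖ ^ 2 ≠ 0 := by simpa using h
    have := (tendsto_const_nhds (x := ‖evDeriv Q 1 p‖ ^ 2)).div (tendsto_const_nhds.add
      tendsto_one_div_add_atTop_nhds_zero_nat) (by simpa using h1 : ‖evDeriv Q 1 p‖ ^ 2 + 0 ≠ 0)
    rwa [add_zero, div_self h1] at this

theorem tendsto_dampedSlope {p : ℂ × ℂ} (h : evDeriv Q 1 p ≠ 0) :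
    Tendsto (fun n : ℕ => dampedSlope Q (1 / ((n : ℝ) + 1)) p) atTop
      (𝓝 (‖evDeriv Q 0 p / evDeriv Q 1 p‖ ^ 2)) := by
  have h1 : ‖evDeriv Q 1 p‖ ^ 2 ≠ 0 := by simpa using h
  have := (tendsto_const_nhds (x := ‖evDeriv Q 0 p‖ ^ 2)).div (tendsto_const_nhds.add
    tendsto_one_div_add_atTop_nhds_zero_nat) (by simpa using h1 : ‖evDeriv Q 1 p‖ ^ 2 + 0 ≠ 0)
  rwa [add_zero, ← div_pow, ← norm_div] at this

theorem dampedUnit_nonneg {η : ℝ} (hη : 0 ≤ η) (p : ℂ × ℂ) : 0 ≤ dampedUnit Q η p := by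
  unfold dampedUnit; positivity

theorem dampedUnit_le_one {η : ℝ} (hη : 0 ≤ η) (p : ℂ × ℂ) : dampedUnit Q η p ≤ 1 :=
  div_le_one_of_le₀ (by linarith) (by positivity)

theorem dampedSlope_nonneg {η : ℝ} (hη : 0 ≤ η) (p : ℂ × ℂ) : 0 ≤ dampedSlope Q η p := by
  unfold dampedSlope; positivity

theorem dampedSlope_le {η : ℝ} (hη : 0 ≤ η) {p : ℂ × ℂ} (h : evDeriv Q 1 p ≠ 0) :
    dampedSlope Q η p ≤ ‖evDeriv Q 0 p / evDeriv Q 1 p‖ ^ 2 := by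
  rw [dampedSlope, norm_div, div_pow]
  generalize evDeriv Q 1 p = b at *
  generalize evDeriv Q 0 p = a
  have := norm_pos_iff.2 h
  gcongr
  linarith

/-- By Fatou's lemma, the area of a compact piece of the curve, seen from the `z`-line, is
finite: it is bounded by its area seen from the `t`-line. -/
theorem integrable_slope_of_nonneg (hQ : Irreducible Q) {Ψ : ℂ × ℂ → ℝ} (hΨ : ContDiff ℝ ∞ Ψ)
    (hc : HasCompactSupport Ψ) (h0 : ∀ p, 0 ≤ Ψ p) :
    Integrable (fun z => ∑ t ∈ rootsT Q z, ‖evDeriv Q 0 (z, t) / evDeriv Q 1 (z, t)‖ ^ 2 *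
        Ψ (z, t)) := by
  have hs : ContDiff ℝ ∞ fun p => (Ψ p : ℂ) := Complex.ofRealCLM.contDiff.comp hΨ
  have hcs : HasCompactSupport fun p => (Ψ p : ℂ) :=
    hc.comp_left (g := fun x : ℝ => (x : ℂ)) Complex.ofReal_zero
  have hε : ∀ n : ℕ, (0 : ℝ) < 1 / ((n : ℝ) + 1) := fun n => by positivity
  set F : ℕ → ℂ → ℝ := fun n z => ∑ t ∈ rootsT Q z, dampedSlope Q (1 / ((n : ℝ) + 1)) (z, t) *
      Ψ (z, t)
    with hF
  have hFi : ∀ n, Integrable (F n) := fun n => by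
    simpa [hF] using (integral_dampedSlope_eq hQ hs hcs (hε n)).1.re
  have hF0 : ∀ n z, 0 ≤ F n z := fun n z => Finset.sum_nonneg fun t _ =>
    mul_nonneg (dampedSlope_nonneg (hε n).le _) (h0 _)
  have hUi : ∀ n : ℕ, Integrable fun t =>
      ∑ z ∈ rootsZ Q t, dampedUnit Q (1 / ((n : ℝ) + 1)) (z, t) * Ψ (z, t) :=
    fun n => by simpa using (integral_dampedSlope_eq hQ hs hcs (hε n)).2.1.re
  have hTi : Integrable fun t => ∑ z ∈ rootsZ Q t, Ψ (z, t) := by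
    simpa using (integral_logDeriv_mul_dAnti_zero hQ hs hcs).1.re
  have hbound : ∀ n, ∫⁻ z, ‖F n z‖ₑ ≤ ENNReal.ofReal (∫ t, ∑ z ∈ rootsZ Q t, Ψ (z, t)) := by
    intro n
    rw [← ofReal_integral_norm_eq_lintegral_enorm (hFi n)]
    refine ENNReal.ofReal_le_ofReal ?_
    simp only [Real.norm_of_nonneg (hF0 n _)]
    have h1 := (integral_dampedSlope_eq hQ hs hcs (hε n)).2.2
    have h2 : ∫ z, F n z =
        ∫ t, ∑ z ∈ rootsZ Q t, dampedUnit Q (1 / ((n : ℝ) + 1)) (z, t) * Ψ (z, t) := by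
      simp only [← Complex.ofReal_mul, ← Complex.ofReal_sum, integral_complex_ofReal] at h1
      exact Complex.ofReal_injective h1
    rw [h2]
    refine integral_mono (hUi n) hTi fun t => Finset.sum_le_sum fun z _ => ?_
    exact mul_le_of_le_one_left (h0 _) (dampedUnit_le_one (hε n).le _)
  have hlim : ∀ᵐ z, Tendsto (fun n => F n z) atTop (𝓝 (∑ t ∈ rootsT Q z,
      ‖evDeriv Q 0 (z, t) / evDeriv Q 1 (z, t)‖ ^ 2 * Ψ (z, t))) := by
    filter_upwards [ae_evDeriv_one_ne_zero hQ] with z hz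
    refine tendsto_finsetSum _ fun t ht => ?_
    exact (tendsto_dampedSlope (hz t ((mem_rootsT hz).1 ht))).mul_const _
  refine ⟨aestronglyMeasurable_of_tendsto_ae _ (fun n => (hFi n).aestronglyMeasurable) hlim, ?_⟩
  refine lt_of_le_of_lt ?_ (ENNReal.ofReal_lt_top (r := ∫ t, ∑ z ∈ rootsZ Q t, Ψ (z, t)))
  refine (lintegral_congr_ae (hlim.mono fun z hz => hz.enorm.liminf_eq.symm)).trans_le ?_
  refine (lintegral_liminf_le' fun n => (hFi n).aestronglyMeasurable.aemeasurable.enorm).trans ?_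
  exact le_trans liminf_le_limsup (limsup_le_of_le (h := .of_forall hbound))

/-- The change of coordinate from `t` to `z` on the curve `Q = 0`. The points where `z` is not a
local coordinate contribute the last term. -/
theorem integral_slope_add_eq (hQ : Irreducible Q) (hψ : ContDiff ℝ ∞ ψ)
    (hc : HasCompactSupport ψ) :
    Integrable (fun z => ∑ t ∈ rootsT Q z,
      (‖evDeriv Q 0 (z, t) / evDeriv Q 1 (z, t)‖ ^ 2 : ℝ) * ψ (z, t)) ∧
    Integrable (fun t => ∑ z ∈ rootsZ Q t, if evDeriv Q 1 (z, t) = 0 then ψ (z, t) else 0) ∧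
    ∫ t, ∑ z ∈ rootsZ Q t, ψ (z, t) =
      (∫ z, ∑ t ∈ rootsT Q z, (‖evDeriv Q 0 (z, t) / evDeriv Q 1 (z, t)‖ ^ 2 : ℝ) * ψ (z, t)) +
        ∫ t, ∑ z ∈ rootsZ Q t, if evDeriv Q 1 (z, t) = 0 then ψ (z, t) else 0 := by
  obtain ⟨Ψ, hΨ, hcΨ, hΨ0, hle⟩ := exists_contDiff_norm_le hψ.continuous hc
  have hε : ∀ n : ℕ, (0 : ℝ) < 1 / ((n : ℝ) + 1) := fun n => by positivity
  have hs : ContDiff ℝ ∞ fun p => (Ψ p : ℂ) := Complex.ofRealCLM.contDiff.comp hΨ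
  have hcs : HasCompactSupport fun p => (Ψ p : ℂ) :=
    hcΨ.comp_left (g := fun x : ℝ => (x : ℂ)) Complex.ofReal_zero
  have hTi : Integrable fun t => ∑ z ∈ rootsZ Q t, Ψ (z, t) := by
    simpa using (integral_logDeriv_mul_dAnti_zero hQ hs hcs).1.re
  have hSi := integrable_slope_of_nonneg hQ hΨ hcΨ hΨ0
  have hstar := fun n => integral_dampedSlope_eq hQ hψ hc (hε n)
  have hψi := (integral_logDeriv_mul_dAnti_zero hQ hψ hc).1
  have limA : ∀ᵐ z, Tendsto (fun n : ℕ => ∑ t ∈ rootsT Q z,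
      (dampedSlope Q (1 / ((n : ℝ) + 1)) (z, t) : ℂ) * ψ (z, t)) atTop
      (𝓝 (∑ t ∈ rootsT Q z, (‖evDeriv Q 0 (z, t) / evDeriv Q 1 (z, t)‖ ^ 2 : ℝ) * ψ (z, t))) := by
    filter_upwards [ae_evDeriv_one_ne_zero hQ] with z hz
    refine tendsto_finsetSum _ fun t ht => Tendsto.mul_const _ ?_
    exact (Complex.continuous_ofReal.tendsto _).comp
      (tendsto_dampedSlope (hz t ((mem_rootsT hz).1 ht)))
  have limB : ∀ t, Tendsto (fun n : ℕ => ∑ z ∈ rootsZ Q t,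
      (dampedUnit Q (1 / ((n : ℝ) + 1)) (z, t) : ℂ) * ψ (z, t)) atTop
      (𝓝 (∑ z ∈ rootsZ Q t, if evDeriv Q 1 (z, t) = 0 then 0 else ψ (z, t))) := by
    intro t
    refine tendsto_finsetSum _ fun z hz => ?_
    have := ((Complex.continuous_ofReal.tendsto _).comp
      (tendsto_dampedUnit (Q := Q) (z, t))).mul_const
      (ψ (z, t))
    split_ifs at this ⊢ with h <;> simpa [h] using this
  have hA : Integrable (fun z => ∑ t ∈ rootsT Q z,
      (‖evDeriv Q 0 (z, t) / evDeriv Q 1 (z, t)‖ ^ 2 : ℝ) * ψ (z, t)) := by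
    refine hSi.mono' (aestronglyMeasurable_of_tendsto_ae atTop
      (fun n => (hstar n).1.aestronglyMeasurable) limA) (.of_forall fun z => ?_)
    refine (norm_sum_le _ _).trans (Finset.sum_le_sum fun t _ => ?_)
    rw [norm_mul, Complex.norm_real, Real.norm_of_nonneg (by positivity)]
    gcongr
    exact hle _
  have hB : Integrable fun t =>
      ∑ z ∈ rootsZ Q t, if evDeriv Q 1 (z, t) = 0 then 0 else ψ (z, t) := by
    refine hTi.mono' (aestronglyMeasurable_of_tendsto_ae atTop
      (fun n => (hstar n).2.1.aestronglyMeasurable) (.of_forall limB)) (.of_forall fun z => ?_)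
    refine (norm_sum_le _ _).trans (Finset.sum_le_sum fun t _ => ?_)
    split_ifs
    · simpa using hΨ0 _
    · exact hle _
  have hsplit : ∀ t, ∑ z ∈ rootsZ Q t, ψ (z, t) =
      (∑ z ∈ rootsZ Q t, if evDeriv Q 1 (z, t) = 0 then 0 else ψ (z, t)) +
      ∑ z ∈ rootsZ Q t, if evDeriv Q 1 (z, t) = 0 then ψ (z, t) else 0 := by
    intro t
    rw [← Finset.sum_add_distrib]
    refine Finset.sum_congr rfl fun z _ => ?_
    split_ifs <;> simp
  have hC : Integrable fun t => ∑ z ∈ rootsZ Q t, if evDeriv Q 1 (z, t) = 0 then ψ (z, t) else 0 :=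
    (hψi.sub hB).congr (.of_forall fun t => by
      simp only [Pi.sub_apply]; rw [hsplit t]; ring)
  refine ⟨hA, hC, ?_⟩
  have hAB : ∫ z, ∑ t ∈ rootsT Q z, (‖evDeriv Q 0 (z, t) / evDeriv Q 1 (z, t)‖ ^ 2 : ℝ) * ψ (z, t) =
      ∫ t, ∑ z ∈ rootsZ Q t, if evDeriv Q 1 (z, t) = 0 then 0 else ψ (z, t) := by
    have l1 := tendsto_integral_of_dominated_convergence _
      (fun n => (hstar n).1.aestronglyMeasurable) hSi (fun n => ?_) limA
    have l2 := tendsto_integral_of_dominated_convergence _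
      (fun n => (hstar n).2.1.aestronglyMeasurable) hTi (fun n => ?_) (.of_forall limB)
    · simp only [(hstar _).2.2] at l1
      exact tendsto_nhds_unique l1 l2
    · refine .of_forall fun t => ?_
      refine (norm_sum_le _ _).trans (Finset.sum_le_sum fun z _ => ?_)
      rw [norm_mul, Complex.norm_real, Real.norm_of_nonneg (dampedUnit_nonneg (hε n).le _)]
      exact (mul_le_of_le_one_left (norm_nonneg _) (dampedUnit_le_one (hε n).le _)).trans (hle _)
    · filter_upwards [ae_evDeriv_one_ne_zero hQ] with z hz
      refine (norm_sum_le _ _).trans (Finset.sum_le_sum fun t ht => ?_)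
      rw [norm_mul, Complex.norm_real, Real.norm_of_nonneg (dampedSlope_nonneg (hε n).le _)]
      exact mul_le_mul (dampedSlope_le (hε n).le (hz t ((mem_rootsT hz).1 ht))) (hle _)
        (norm_nonneg _) (by positivity)
  rw [hAB, ← integral_add hB hC]
  simp only [hsplit]

end ChangeOfCoordinate

/-! ### The Poincaré-Lelong formula for an irreducible curve -/

section PoincareLelong

theorem TestForm.contDiff_apply (φ : TestForm) (j k : Fin 2) : ContDiff ℝ ∞ fun p => φ p j k :=
  contDiff_pi.1 (contDiff_pi.1 φ.contDiff j) k

theorem TestForm.hasCompactSupport_apply (φ : TestForm) (j k : Fin 2) :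
    HasCompactSupport fun p => φ p j k :=
  φ.hasCompactSupport.comp_left (g := fun w : Fin 2 → Fin 2 → ℂ => w j k) rfl

theorem onLine_one (w : Fin 2 → Fin 2 → ℂ) (c : ℂ) : onLine w ![1, c] =
    w 0 0 + w 0 1 * conj c + w 1 0 * c + w 1 1 * (‖c‖ ^ 2 : ℝ) := by
  rw [← Complex.normSq_eq_norm_sq, ← Complex.mul_conj]
  simp [onLine, Fin.sum_univ_two]
  ring

theorem onLine_zero_one (w : Fin 2 → Fin 2 → ℂ) : onLine w ![0, 1] = w 1 1 := by
  simp [onLine, Fin.sum_univ_two]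

variable {Q : MvPolynomial (Fin 2) ℂ}

/-- For almost every `z` the curve is unramified over `z`, so that all its points above `z`
contribute to `fibreSumZ`. -/
theorem fibreSumZ_ae_eq (hQ : Irreducible Q) (φ : TestForm) :
    fibreSumZ Q φ =ᵐ[volume] fun z => ∑ t ∈ rootsT Q z,
      onLine (φ (z, t)) ![1, -(evDeriv Q 0 (z, t) / evDeriv Q 1 (z, t))] := by
  filter_upwards [ae_evDeriv_one_ne_zero hQ] with z hz
  have hset : {t : ℂ | ev Q (z, t) = 0 ∧ evDeriv Q 1 (z, t) ≠ 0} = ↑(rootsT Q z) := by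
    ext t
    simp only [Set.mem_ofPred_eq, Finset.mem_coe, mem_rootsT hz]
    exact ⟨fun h => h.1, fun h => ⟨h, hz t h⟩⟩
  rw [fibreSumZ, hset, finsum_mem_coe_finset]

/-- For almost every `t` the points of the curve with second coordinate `t` are regular, as
`∂_zQ ≠ 0` there. -/
theorem fibreSumT_ae_eq (hQ : Irreducible Q) (φ : TestForm) :
    fibreSumT Q φ =ᵐ[volume] fun t => ∑ z ∈ rootsZ Q t,
      if evDeriv Q 1 (z, t) = 0 then φ (z, t) 1 1 else 0 := by
  filter_upwards [ae_evDeriv_zero_ne_zero hQ] with t ht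
  have hset : {z : ℂ | ev Q (z, t) = 0 ∧ evDeriv Q 1 (z, t) = 0 ∧ evDeriv Q 0 (z, t) ≠ 0} =
      ↑((rootsZ Q t).filter fun z => evDeriv Q 1 (z, t) = 0) := by
    ext z
    simp only [Set.mem_ofPred_eq, Finset.coe_filter, mem_rootsZ ht]
    exact ⟨fun h => ⟨h.1, h.2.1⟩, fun h => ⟨h.1, h.2, ht z h.1⟩⟩
  rw [fibreSumT, hset, finsum_mem_coe_finset, Finset.sum_filter]
  simp only [onLine_zero_one]

theorem integral_log_mul_dHol_dAnti_one (hQ : Irreducible Q) (j : Fin 2) {ψ : ℂ × ℂ → ℂ}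
    (hψ : ContDiff ℝ ∞ ψ) (hc : HasCompactSupport ψ) :
    (2 / Real.pi) * ∫ p, (Real.log ‖ev Q p‖ : ℂ) * dHol j (dAnti 1 ψ) p =
      ∫ z, ∑ t ∈ rootsT Q z, evDeriv Q j (z, t) / evDeriv Q 1 (z, t) * ψ (z, t) := by
  have hπ : (Real.pi : ℂ) ≠ 0 := by simp [Real.pi_ne_zero]
  rw [integral_log_mul_dHol (ψ := dAnti 1 ψ) hQ.ne_zero j
    (contDiff_wirt hψ) (hasCompactSupport_wirt hc),
    (integral_logDeriv_mul_dAnti_one hQ j hψ hc).2]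
  field_simp

theorem integral_log_mul_dHol_dAnti_zero (hQ : Irreducible Q) {ψ : ℂ × ℂ → ℂ}
    (hψ : ContDiff ℝ ∞ ψ) (hc : HasCompactSupport ψ) :
    (2 / Real.pi) * ∫ p, (Real.log ‖ev Q p‖ : ℂ) * dHol 0 (dAnti 0 ψ) p =
      ∫ t, ∑ z ∈ rootsZ Q t, ψ (z, t) := by
  have hπ : (Real.pi : ℂ) ≠ 0 := by simp [Real.pi_ne_zero]
  rw [integral_log_mul_dHol (ψ := dAnti 0 ψ) hQ.ne_zero 0
    (contDiff_wirt hψ) (hasCompactSupport_wirt hc),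
    (integral_logDeriv_mul_dAnti_zero hQ hψ hc).2]
  field_simp

/-- The complex conjugate of `integral_log_mul_dHol_dAnti_one`. -/
theorem integral_log_mul_dHol_one_dAnti (hQ : Irreducible Q) (j : Fin 2) {ψ : ℂ × ℂ → ℂ}
    (hψ : ContDiff ℝ ∞ ψ) (hc : HasCompactSupport ψ) :
    Integrable (fun z => ∑ t ∈ rootsT Q z, conj (evDeriv Q j (z, t) / evDeriv Q 1 (z, t)) *
        ψ (z, t)) ∧
    (2 / Real.pi) * ∫ p, (Real.log ‖ev Q p‖ : ℂ) * dHol 1 (dAnti j ψ) p =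
      ∫ z, ∑ t ∈ rootsT Q z, conj (evDeriv Q j (z, t) / evDeriv Q 1 (z, t)) * ψ (z, t) := by
  have hs : ContDiff ℝ ∞ fun p => conj (ψ p) := Complex.conjCLE.contDiff.comp hψ
  have hcs : HasCompactSupport fun p => conj (ψ p) :=
    hc.comp_left (g := fun x : ℂ => conj x) (map_zero _)
  have hsum : ∀ z, conj (∑ t ∈ rootsT Q z, evDeriv Q j (z, t) / evDeriv Q 1 (z, t) *
      conj (ψ (z, t))) =
      ∑ t ∈ rootsT Q z, conj (evDeriv Q j (z, t) / evDeriv Q 1 (z, t)) * ψ (z, t) := by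
    intro z
    rw [map_sum]
    refine Finset.sum_congr rfl fun t _ => ?_
    rw [map_mul, Complex.conj_conj]
  constructor
  · have := (integral_logDeriv_mul_dAnti_one hQ j hs hcs).1
    have h2 := (Complex.conjCLE.toContinuousLinearMap.integrable_comp this)
    exact h2.congr (.of_forall fun z => hsum z)
  · have h1 := congrArg conj (integral_log_mul_dHol_dAnti_one hQ j hs hcs)
    rw [map_mul, ← integral_conj, ← integral_conj] at h1
    simp only [hsum] at h1
    rw [← h1]
    congr 1
    · simp [Complex.conj_ofReal, Complex.conj_ofNat]
    · congr 1
      funext p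
      rw [map_mul, Complex.conj_ofReal]
      congr 1
      have e1 : dAnti 1 (fun p => conj (ψ p)) = fun p => conj (dHol 1 ψ p) := by
        funext q
        rw [dAnti_eq_wirt, wirt_comp_conj (hψ.differentiable (by simp) q), Complex.conj_I,
          ← dHol_eq_wirt]
      have hd : ContDiff ℝ ∞ (dHol 1 ψ) := by rw [dHol_eq_wirt]; exact contDiff_wirt hψ
      rw [e1, dHol_eq_wirt j, wirt_comp_conj (hd.differentiable (by simp) p), Complex.conj_conj,
        map_neg, Complex.conj_I, neg_neg, dHol_eq_wirt, dAnti_eq_wirt]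
      exact wirt_comm hψ

theorem integral_add_sub_sub {α : Type*} [MeasurableSpace α] {m : Measure α} {f g h k : α → ℂ}
    (hf : Integrable f m) (hg : Integrable g m) (hh : Integrable h m) (hk : Integrable k m) :
    ∫ x, (f x + g x - h x - k x) ∂m = ∫ x, f x ∂m + ∫ x, g x ∂m - ∫ x, h x ∂m - ∫ x, k x ∂m := by
  rw [integral_sub (f := fun x => f x + g x - h x) ((hf.add hg).sub hh) hk,
    integral_sub (f := fun x => f x + g x) (hf.add hg) hh, integral_add hf hg]

theorem integral_sub_sub_add {α : Type*} [MeasurableSpace α] {m : Measure α} {f g h k : α → ℂ}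
    (hf : Integrable f m) (hg : Integrable g m) (hh : Integrable h m) (hk : Integrable k m) :
    ∫ x, (f x - g x - h x + k x) ∂m = ∫ x, f x ∂m - ∫ x, g x ∂m - ∫ x, h x ∂m + ∫ x, k x ∂m := by
  rw [integral_add (f := fun x => f x - g x - h x) ((hf.sub hg).sub hh) hk,
    integral_sub (f := fun x => f x - g x) (hf.sub hg) hh, integral_sub hf hg]

/-- The Poincaré-Lelong formula for an irreducible plane algebraic curve. -/
theorem poincare_lelong (hQ : Irreducible Q) (φ : TestForm) :
    Integrable (fibreSumZ Q φ) ∧ Integrable (fibreSumT Q φ) ∧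
      ∫ p, (Real.log ‖ev Q p‖ : ℂ) * ddbarDensity φ p = curveIntegral Q φ := by
  have hs := φ.contDiff_apply
  have hc := φ.hasCompactSupport_apply
  have i00 := (integral_logDeriv_mul_dAnti_one hQ 1 (hs 0 0) (hc 0 0)).1
  have i10 := (integral_logDeriv_mul_dAnti_one hQ 0 (hs 1 0) (hc 1 0)).1
  have e00 := integral_log_mul_dHol_dAnti_one hQ 1 (hs 0 0) (hc 0 0)
  have e10 := integral_log_mul_dHol_dAnti_one hQ 0 (hs 1 0) (hc 1 0)
  obtain ⟨i01, e01⟩ := integral_log_mul_dHol_one_dAnti hQ 0 (hs 0 1) (hc 0 1)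
  have e11 := integral_log_mul_dHol_dAnti_zero hQ (hs 1 1) (hc 1 1)
  obtain ⟨i11, iT, e11'⟩ := integral_slope_add_eq hQ (hs 1 1) (hc 1 1)
  have hZ : fibreSumZ Q φ =ᵐ[volume] fun z =>
      (∑ t ∈ rootsT Q z, evDeriv Q 1 (z, t) / evDeriv Q 1 (z, t) * φ (z, t) 0 0) -
      (∑ t ∈ rootsT Q z, conj (evDeriv Q 0 (z, t) / evDeriv Q 1 (z, t)) * φ (z, t) 0 1) -
      (∑ t ∈ rootsT Q z, evDeriv Q 0 (z, t) / evDeriv Q 1 (z, t) * φ (z, t) 1 0) +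
      ∑ t ∈ rootsT Q z, (‖evDeriv Q 0 (z, t) / evDeriv Q 1 (z, t)‖ ^ 2 : ℝ) * φ (z, t) 1 1 := by
    filter_upwards [fibreSumZ_ae_eq hQ φ, ae_evDeriv_one_ne_zero hQ] with z h hz
    rw [h, ← Finset.sum_sub_distrib, ← Finset.sum_sub_distrib, ← Finset.sum_add_distrib]
    refine Finset.sum_congr rfl fun t ht => ?_
    rw [onLine_one, div_self (hz t ((mem_rootsT hz).1 ht)), norm_neg, map_neg]
    ring
  have hT := fibreSumT_ae_eq hQ φ
  have hlog : ∀ (s s' : ℂ) (v w : ℂ × ℂ) (j k : Fin 2), Integrable fun p =>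
      (Real.log ‖ev Q p‖ : ℂ) * wirt s v (wirt s' w fun q => φ q j k) p := fun s s' v w j k =>
    integrable_log_mul hQ.ne_zero (contDiff_wirt (contDiff_wirt (hs j k))).continuous
      (hasCompactSupport_wirt (hasCompactSupport_wirt (hc j k)))
  have I : ∀ l m j k, Integrable fun p =>
      (Real.log ‖ev Q p‖ : ℂ) * dHol l (dAnti m fun q => φ q j k) p := fun l m j k => by
    simp only [dHol_eq_wirt, dAnti_eq_wirt]
    exact hlog _ _ _ _ _ _
  refine ⟨(((i00.sub i01).sub i10).add i11).congr hZ.symm, iT.congr hT.symm, ?_⟩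
  have hL : ∀ p, (Real.log ‖ev Q p‖ : ℂ) * ddbarDensity φ p = (2 / Real.pi) *
      ((Real.log ‖ev Q p‖ : ℂ) * dHol 0 (dAnti 0 fun q => φ q 1 1) p +
        (Real.log ‖ev Q p‖ : ℂ) * dHol 1 (dAnti 1 fun q => φ q 0 0) p -
        (Real.log ‖ev Q p‖ : ℂ) * dHol 0 (dAnti 1 fun q => φ q 1 0) p -
        (Real.log ‖ev Q p‖ : ℂ) * dHol 1 (dAnti 0 fun q => φ q 0 1) p) := fun p => by
    rw [ddbarDensity]; ring
  simp only [hL]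
  rw [integral_const_mul, integral_add_sub_sub (I 0 0 1 1) (I 1 1 0 0) (I 0 1 1 0) (I 1 0 0 1),
    mul_sub, mul_sub, mul_add, e00, e10, e01, e11, e11', curveIntegral, integral_congr_ae hZ,
    integral_congr_ae hT, integral_sub_sub_add i00 i01 i10 i11]
  ring

end PoincareLelong

/-! ### Means over balls -/

section BallMeans

/-- The mean of `f` over the closed ball of radius `r` around `p`, in the sup norm of `ℂ × ℂ`; that
is, over a polydisc. -/
def ballMean (f : ℂ × ℂ → ℝ) (r : ℝ) (p : ℂ × ℂ) : ℝ := ⨍ q in Metric.closedBall p r, f q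

theorem setIntegral_closedBall (f : ℂ × ℂ → ℝ) (r : ℝ) (p : ℂ × ℂ) :
    ∫ q in Metric.closedBall p r, f q = ∫ b in Metric.closedBall 0 r, f (p + b) := by
  have hpre : (fun b => p + b) ⁻¹' Metric.closedBall p r = Metric.closedBall 0 r := by
    ext b; simp
  rw [← hpre, (measurePreserving_add_left (volume : Measure (ℂ × ℂ)) p).setIntegral_preimage_emb
    (measurableEmbedding_addLeft p)]

theorem ballMean_def (f : ℂ × ℂ → ℝ) (r : ℝ) (p : ℂ × ℂ) : ballMean f r p =
    (volume.real (Metric.closedBall (0 : ℂ × ℂ) r))⁻¹ * ∫ q in Metric.closedBall p r, f q := by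
  rw [ballMean, setAverage_eq, smul_eq_mul, measureReal_def, measureReal_def,
    Measure.addHaar_closedBall_center]

theorem ballVolume_pos {r : ℝ} (hr : 0 < r) :
    0 < volume.real (Metric.closedBall (0 : ℂ × ℂ) r) :=
  ENNReal.toReal_pos (Metric.measure_closedBall_pos volume _ hr).ne' measure_closedBall_lt_top.ne

theorem ballMean_eq_unitBall (f : ℂ × ℂ → ℝ) {r : ℝ} (hr : 0 < r) (p : ℂ × ℂ) : ballMean f r p =
    (volume.real (Metric.closedBall (0 : ℂ × ℂ) 1))⁻¹ *
      ∫ b in Metric.closedBall 0 1, f (p + r • b) := by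
  have hb := smul_unitClosedBall (E := ℂ × ℂ) r
  rw [Real.norm_of_nonneg hr.le] at hb
  have h1 := Measure.setIntegral_comp_smul volume (fun b => f (p + b))
    (Metric.closedBall (0 : ℂ × ℂ) 1) hr.ne'
  have h2 := Measure.setIntegral_comp_smul volume (fun _ => (1 : ℝ))
    (Metric.closedBall (0 : ℂ × ℂ) 1) hr.ne'
  simp only [integral_const, smul_eq_mul, mul_one, measureReal_restrict_apply_univ, hb] at h1 h2
  have h3 : |(r ^ Module.finrank ℝ (ℂ × ℂ))⁻¹| ≠ 0 := by positivity
  rw [ballMean_def, setIntegral_closedBall, h1, h2, mul_inv]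
  field_simp

theorem continuous_ballMean {f : ℂ × ℂ → ℝ} (hf : LocallyIntegrable f) (r : ℝ) :
    Continuous (ballMean f r) := by
  have hfun : ballMean f r = fun p => (volume.real (Metric.closedBall (0 : ℂ × ℂ) r))⁻¹ *
      ∫ q, (Metric.closedBall p r).indicator f q := by
    funext p
    rw [integral_indicator measurableSet_closedBall, ballMean_def]
  rw [hfun]
  refine continuous_const.mul (continuous_iff_continuousAt.2 fun p => ?_)
  refine tendsto_integral_filter_of_dominated_convergence
    ((Metric.closedBall p (r + 1)).indicator fun q => ‖f q‖) ?_ ?_ ?_ ?_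
  · exact .of_forall fun q => hf.aestronglyMeasurable.indicator measurableSet_closedBall
  · filter_upwards [Metric.ball_mem_nhds p one_pos] with p' hp'
    refine .of_forall fun q => ?_
    rw [norm_indicator_eq_indicator_norm]
    refine Set.indicator_le_indicator_of_subset ?_ (fun _ => norm_nonneg _) q
    refine Metric.closedBall_subset_closedBall' ?_
    linarith [Metric.mem_ball.1 hp']
  · exact IntegrableOn.integrable_indicator
      (hf.integrableOn_isCompact (isCompact_closedBall p (r + 1))).norm measurableSet_closedBall
  · have hs : ∀ᵐ q, q ∉ Metric.sphere p r :=
      measure_eq_zero_iff_ae_notMem.1 (Measure.addHaar_sphere _ p r)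
    filter_upwards [hs] with q hq
    rw [Metric.mem_sphere, ← ne_eq] at hq
    have hd : Tendsto (fun p' : ℂ × ℂ => dist q p') (𝓝 p) (𝓝 (dist q p)) :=
      (continuous_const.dist continuous_id).tendsto p
    refine tendsto_const_nhds.congr' ?_
    rcases lt_or_gt_of_ne hq with h | h
    · filter_upwards [hd.eventually_lt_const h] with p' hp'
      rw [Set.indicator_of_mem (Metric.mem_closedBall.2 h.le),
        Set.indicator_of_mem (Metric.mem_closedBall.2 hp'.le)]
    · filter_upwards [hd.eventually_const_lt h] with p' hp'
      rw [Set.indicator_of_notMem (by simpa using h), Set.indicator_of_notMem (by simpa using hp')]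

/-- Averaging over the rotations `b ↦ e^{iθ} b` does not change the integral over a ball around the
origin. -/
theorem integral_closedBall_eq_circleAverage {g : ℂ × ℂ → ℝ} (hg : Measurable g) {R : ℝ}
    (hint : IntegrableOn g (Metric.closedBall 0 R)) :
    IntegrableOn (fun b => Real.circleAverage (fun τ => g (τ • b)) 0 1) (Metric.closedBall 0 R) ∧
      ∫ b in Metric.closedBall 0 R, Real.circleAverage (fun τ => g (τ • b)) 0 1 =
        ∫ b in Metric.closedBall 0 R, g b := by
  set ν := (volume : Measure (ℂ × ℂ)).restrict (Metric.closedBall 0 R) with hν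
  set μθ := (volume : Measure ℝ).restrict (Set.Ioc 0 (2 * Real.pi)) with hμθ
  have hmp : ∀ θ : ℝ, MeasurePreserving (fun b : ℂ × ℂ => circleMap 0 1 θ • b) ν ν := fun θ => by
    have h := (measurePreserving_smul_of_norm_eq_one
      (c := circleMap 0 1 θ) (by simp)).restrict_preimage
      (s := Metric.closedBall 0 R) measurableSet_closedBall
    have hpre : (fun b : ℂ × ℂ => circleMap 0 1 θ • b) ⁻¹' Metric.closedBall 0 R =
        Metric.closedBall 0 R := by
      ext b; simp [norm_smul]
    rwa [hpre] at h
  have hemb : ∀ θ : ℝ, MeasurableEmbedding (fun b : ℂ × ℂ => circleMap 0 1 θ • b) := fun θ =>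
    (Homeomorph.smulOfNeZero (circleMap 0 1 θ)
        (circleMap_ne_center one_ne_zero)).measurableEmbedding
  have hH : Integrable (Function.uncurry fun (θ : ℝ) (b : ℂ × ℂ) => g (circleMap 0 1 θ • b))
      (μθ.prod ν) := by
    have hm : Measurable (Function.uncurry fun (θ : ℝ) (b : ℂ × ℂ) => g (circleMap 0 1 θ • b)) :=
      hg.comp (Continuous.measurable (by fun_prop))
    refine (integrable_prod_iff hm.aestronglyMeasurable).2 ⟨.of_forall fun θ => ?_, ?_⟩
    · exact ((hmp θ).integrable_comp_emb (hemb θ)).2 hint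
    · have : ∀ θ : ℝ, ∫ b, ‖g (circleMap 0 1 θ • b)‖ ∂ν = ∫ b, ‖g b‖ ∂ν := fun θ =>
        (hmp θ).integral_comp (hemb θ) (fun b => ‖g b‖)
      simp only [Function.uncurry_apply_pair, this]
      exact integrable_const _
  have hc : ∀ b : ℂ × ℂ, Real.circleAverage (fun τ => g (τ • b)) 0 1 =
      (2 * Real.pi)⁻¹ * ∫ θ, g (circleMap 0 1 θ • b) ∂μθ := fun b => by
    rw [Real.circleAverage_def, intervalIntegral.integral_of_le Real.two_pi_pos.le, smul_eq_mul]
  simp only [hc]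
  refine ⟨hH.integral_prod_right.const_mul _, ?_⟩
  rw [integral_const_mul, ← integral_integral_swap hH]
  have : ∀ θ : ℝ, ∫ b, g (circleMap 0 1 θ • b) ∂ν = ∫ b, g b ∂ν := fun θ =>
    (hmp θ).integral_comp (hemb θ) g
  simp only [this, integral_const, hμθ, measureReal_restrict_apply_univ, Real.volume_real_Ioc,
    sub_zero, max_eq_left Real.two_pi_pos.le, smul_eq_mul]
  rw [inv_mul_cancel_left₀ Real.two_pi_pos.ne']

/-- The ball means of the circle averages of `f` in the direction `b` are the circle averages of the
ball means of `f`. -/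
theorem ballMean_circleAverage {f : ℂ × ℂ → ℝ} (hf : Measurable f) (hfi : LocallyIntegrable f)
    (a b : ℂ × ℂ) {r : ℝ} (hr : 0 < r) :
    IntegrableOn (fun q => Real.circleAverage (fun τ => f (q + τ • b)) 0 1)
        (Metric.closedBall a r) ∧
      ballMean (fun q => Real.circleAverage (fun τ => f (q + τ • b)) 0 1) r a =
        Real.circleAverage (fun τ => ballMean f r (a + τ • b)) 0 1 := by
  set ν := (volume : Measure (ℂ × ℂ)).restrict (Metric.closedBall a r) with hν
  set μθ := (volume : Measure ℝ).restrict (Set.Ioc 0 (2 * Real.pi)) with hμθ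
  have hV := (ballVolume_pos hr).ne'
  have htrans : ∀ (g : ℂ × ℂ → ℝ) (c : ℂ × ℂ), (∫ q, g (q + c) ∂ν) =
      volume.real (Metric.closedBall (0 : ℂ × ℂ) r) * ballMean g r (a + c) := fun g c => by
    rw [ballMean_def, mul_inv_cancel_left₀ hV, hν, setIntegral_closedBall,
      setIntegral_closedBall g r (a + c)]
    simp only [add_right_comm]
  have hH : Integrable (Function.uncurry fun (θ : ℝ) (q : ℂ × ℂ) => f (q + circleMap 0 1 θ • b))
      (μθ.prod ν) := by
    have hm : Measurable (Function.uncurry fun (θ : ℝ) (q : ℂ × ℂ) =>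
        f (q + circleMap 0 1 θ • b)) :=
      hf.comp (Continuous.measurable (by fun_prop))
    refine (integrable_prod_iff hm.aestronglyMeasurable).2 ⟨.of_forall fun θ => ?_, ?_⟩
    · have hmp := measurePreserving_add_right (volume : Measure (ℂ × ℂ)) (circleMap 0 1 θ • b)
      have h := (hmp.integrableOn_comp_preimage (measurableEmbedding_addRight _) (f := f)
        (s := Metric.closedBall (a + circleMap 0 1 θ • b) r)).2
        (hfi.integrableOn_isCompact (isCompact_closedBall _ _))
      have hpre : (fun q => q + circleMap 0 1 θ • b) ⁻¹'
          Metric.closedBall (a + circleMap 0 1 θ • b) r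
          = Metric.closedBall a r := by
        ext q; simp
      rw [hpre] at h
      exact h
    · simp only [Function.uncurry_apply_pair]
      simp only [htrans fun q => ‖f q‖]
      refine IntegrableOn.mono_set (t := Set.Icc 0 (2 * Real.pi)) ?_ Set.Ioc_subset_Icc_self
      refine Continuous.integrableOn_Icc (continuous_const.mul ?_)
      exact (continuous_ballMean (fun q => (hfi q).norm) r).comp (by fun_prop)
  have hc : ∀ q : ℂ × ℂ, Real.circleAverage (fun τ => f (q + τ • b)) 0 1 =
      (2 * Real.pi)⁻¹ * ∫ θ, f (q + circleMap 0 1 θ • b) ∂μθ := fun b => by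
    rw [Real.circleAverage_def, intervalIntegral.integral_of_le Real.two_pi_pos.le, smul_eq_mul]
  simp only [hc]
  refine ⟨hH.integral_prod_right.const_mul _, ?_⟩
  rw [ballMean_def, integral_const_mul, ← hν, ← integral_integral_swap hH,
    Real.circleAverage_def, intervalIntegral.integral_of_le Real.two_pi_pos.le, smul_eq_mul, ← hμθ]
  simp only [htrans f, integral_const_mul]
  rw [mul_left_comm, inv_mul_cancel_left₀ hV]

end BallMeans

/-! ### Ball means of plurisubharmonic functions -/

section SubharmonicMeans

/-- A real-valued representative of a plurisubharmonic function, with arbitrary values on the null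
set where that function is `-∞`: its means over circles in complex lines increase with the radius,
and the submean inequality holds around almost every point. As the direction `b` is arbitrary, it
is enough to state the latter for the radius `1`. -/
structure IsSubharmonicOnLines (f : ℂ × ℂ → ℝ) : Prop where
  measurable : Measurable f
  locallyIntegrable : LocallyIntegrable f
  mono : ∀ p b {r s : ℝ}, 0 < r → r ≤ s →
    Real.circleAverage (fun τ => f (p + τ • b)) 0 r ≤
      Real.circleAverage (fun τ => f (p + τ • b)) 0 s
  submean : ∀ᵐ p, ∀ b, f p ≤ Real.circleAverage (fun τ => f (p + τ • b)) 0 1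

theorem isSubharmonicOnLines_log_norm {Q : MvPolynomial (Fin 2) ℂ} (hQ : Q ≠ 0) {c : ℝ}
    (hc : 0 ≤ c) : IsSubharmonicOnLines fun p => c * Real.log ‖ev Q p‖ := by
  have h : ∀ p b r, Real.circleAverage (fun τ => c * Real.log ‖ev Q (p + τ • b)‖) 0 r =
      c * Real.circleAverage (fun τ => Real.log ‖ev Q (p + τ • b)‖) 0 r := fun p b r => by
    have := Real.circleAverage_smul (a := c) (f := fun τ => Real.log ‖ev Q (p + τ • b)‖)
      (c := 0) (R := r)
    exact this
  refine ⟨(measurable_log_norm_ev Q).const_mul c, (locallyIntegrable_log_norm_ev hQ).smul c,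
    fun p b r s hr hrs => ?_, ?_⟩
  · rw [h, h]
    exact mul_le_mul_of_nonneg_left (circleAverage_log_norm_ev_mono Q p b hr hrs) hc
  · filter_upwards [ae_ev_ne_zero hQ] with p hp b
    rw [h]
    exact mul_le_mul_of_nonneg_left (log_norm_ev_le_circleAverage b hp) hc

variable {f : ℂ × ℂ → ℝ}

theorem integrableOn_comp_smul (hf : LocallyIntegrable f) {r : ℝ} (hr : 0 < r) (p : ℂ × ℂ) :
    IntegrableOn (fun b => f (p + r • b)) (Metric.closedBall 0 1) := by
  rw [← integrable_indicator_iff measurableSet_closedBall]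
  have h : Integrable ((Metric.closedBall 0 r).indicator fun b => f (p + b)) := by
    rw [integrable_indicator_iff measurableSet_closedBall]
    have hpre : (fun b => p + b) ⁻¹' Metric.closedBall p r = Metric.closedBall 0 r := by
      ext b; simp
    rw [← hpre]
    exact ((measurePreserving_add_left volume p).integrableOn_comp_preimage
      (measurableEmbedding_addLeft p)).2 (hf.integrableOn_isCompact (isCompact_closedBall p r))
  refine ((integrable_comp_smul_iff volume _ hr.ne').2 h).congr (.of_forall fun b => ?_)
  have hb : r • b ∈ Metric.closedBall (0 : ℂ × ℂ) r ↔ b ∈ Metric.closedBall (0 : ℂ × ℂ) 1 := by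
    simp only [mem_closedBall_zero_iff, norm_smul, Real.norm_of_nonneg hr.le]
    exact mul_le_iff_le_one_right hr
  by_cases h1 : b ∈ Metric.closedBall (0 : ℂ × ℂ) 1
  · rw [Set.indicator_of_mem h1]
    exact Set.indicator_of_mem (hb.2 h1) _
  · rw [Set.indicator_of_notMem h1]
    exact Set.indicator_of_notMem (fun h => h1 (hb.1 h)) _

/-- A ball mean is an average, over the directions `b`, of means over circles around the same
centre. -/
theorem IsSubharmonicOnLines.ballMean_mono (hf : IsSubharmonicOnLines f) (p : ℂ × ℂ) {r s : ℝ}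
    (hr : 0 < r) (hrs : r ≤ s) : ballMean f r p ≤ ballMean f s p := by
  have key : ∀ r : ℝ, 0 < r →
      IntegrableOn (fun b => Real.circleAverage (fun τ => f (p + τ • b)) 0 r)
        (Metric.closedBall 0 1) ∧
      ballMean f r p = (volume.real (Metric.closedBall (0 : ℂ × ℂ) 1))⁻¹ *
        ∫ b in Metric.closedBall 0 1, Real.circleAverage (fun τ => f (p + τ • b)) 0 r := by
    intro r hr
    have h := integral_closedBall_eq_circleAverage (g := fun b => f (p + r • b)) (R := 1)
      (hf.measurable.comp (Continuous.measurable (by fun_prop)))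
      (integrableOn_comp_smul hf.locallyIntegrable hr p)
    have hc : ∀ b : ℂ × ℂ, Real.circleAverage (fun τ => f (p + r • τ • b)) 0 1 =
        Real.circleAverage (fun τ => f (p + τ • b)) 0 r := fun b => by
      rw [Real.circleAverage_def, Real.circleAverage_def]
      congr 2
      funext θ
      congr 2
      rw [← smul_assoc]
      congr 1
      simp [circleMap]
    simp only [hc] at h
    exact ⟨h.1, by rw [ballMean_eq_unitBall f hr, h.2]⟩
  rw [(key r hr).2, (key s (hr.trans_le hrs)).2]
  refine mul_le_mul_of_nonneg_left ?_ (inv_nonneg.2 measureReal_nonneg)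
  exact setIntegral_mono (key r hr).1 (key s (hr.trans_le hrs)).1 fun b => hf.mono p b hr hrs

theorem IsSubharmonicOnLines.ballMean_le_circleAverage (hf : IsSubharmonicOnLines f)
    (a b : ℂ × ℂ) {r : ℝ} (hr : 0 < r) :
    ballMean f r a ≤ Real.circleAverage (fun τ => ballMean f r (a + τ • b)) 0 1 := by
  have h := ballMean_circleAverage hf.measurable hf.locallyIntegrable a b hr
  rw [← h.2, ballMean_def, ballMean_def]
  refine mul_le_mul_of_nonneg_left ?_ (inv_nonneg.2 measureReal_nonneg)
  refine setIntegral_mono_ae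
    (hf.locallyIntegrable.integrableOn_isCompact (isCompact_closedBall a r))
    h.1 ?_
  filter_upwards [hf.submean] with q hq using hq b

end SubharmonicMeans

/-! ### Limits of ball means -/

section Limits

variable {f : ℕ → ℂ × ℂ → ℝ} {F : ℂ × ℂ → ℝ}

theorem TendstoL1Loc.integral_norm_sub (hfi : ∀ n, LocallyIntegrable (f n)) (h : TendstoL1Loc f F)
    {K : Set (ℂ × ℂ)} (hK : IsCompact K) :
    Tendsto (fun n => ∫ p in K, ‖f n p - F p‖) atTop (𝓝 0) := by
  have h1 : ∀ n, ∫ p in K, ‖f n p - F p‖ = (∫⁻ p in K, ‖f n p - F p‖ₑ).toReal := fun n =>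
    integral_norm_eq_lintegral_enorm (((hfi n).sub h.1).aestronglyMeasurable.restrict)
  simp only [h1]
  exact (ENNReal.tendsto_toReal ENNReal.zero_ne_top).comp (h.2 K hK)

theorem abs_ballMean_sub_le {f F : ℂ × ℂ → ℝ} (hf : LocallyIntegrable f) (hF : LocallyIntegrable F)
    {K : Set (ℂ × ℂ)} (hK : IsCompact K) {p : ℂ × ℂ} {r : ℝ} (hp : Metric.closedBall p r ⊆ K) :
    |ballMean f r p - ballMean F r p| ≤
      (volume.real (Metric.closedBall (0 : ℂ × ℂ) r))⁻¹ * ∫ p in K, ‖f p - F p‖ := by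
  rw [ballMean_def, ballMean_def, ← mul_sub, abs_mul,
    abs_of_nonneg (inv_nonneg.2 measureReal_nonneg)]
  refine mul_le_mul_of_nonneg_left ?_ (inv_nonneg.2 measureReal_nonneg)
  rw [← integral_sub (hf.integrableOn_isCompact (isCompact_closedBall p r))
    (hF.integrableOn_isCompact (isCompact_closedBall p r)), ← Real.norm_eq_abs]
  refine (norm_integral_le_integral_norm _).trans ?_
  exact setIntegral_mono_set ((hf.sub hF).integrableOn_isCompact hK).norm
    (.of_forall fun _ => norm_nonneg _) hp.eventuallyLE

theorem tendsto_ballMean (hf : ∀ n, IsSubharmonicOnLines (f n)) (h : TendstoL1Loc f F)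
    (r : ℝ) (p : ℂ × ℂ) :
    Tendsto (fun n => ballMean (f n) r p) atTop (𝓝 (ballMean F r p)) := by
  rw [tendsto_iff_norm_sub_tendsto_zero]
  have h1 := (h.integral_norm_sub (fun n => (hf n).locallyIntegrable)
    (isCompact_closedBall p r)).const_mul (volume.real (Metric.closedBall (0 : ℂ × ℂ) r))⁻¹
  rw [mul_zero] at h1
  exact squeeze_zero (fun _ => norm_nonneg _)
    (fun n => abs_ballMean_sub_le (hf n).locallyIntegrable h.1 (isCompact_closedBall p r) le_rfl) h1

theorem ballMean_mono_of_tendstoL1Loc (hf : ∀ n, IsSubharmonicOnLines (f n)) (h : TendstoL1Loc f F)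
    (p : ℂ × ℂ) {r s : ℝ} (hr : 0 < r) (hrs : r ≤ s) :
    ballMean F r p ≤ ballMean F s p :=
  le_of_tendsto_of_tendsto' (tendsto_ballMean hf h r p) (tendsto_ballMean hf h s p)
    fun n => (hf n).ballMean_mono p hr hrs

theorem circleIntegrable_ballMean {f : ℂ × ℂ → ℝ} (hf : LocallyIntegrable f) (a b : ℂ × ℂ) (r : ℝ) :
    CircleIntegrable (fun τ => ballMean f r (a + τ • b)) 0 1 :=
  ((continuous_ballMean hf r).comp (by fun_prop)).continuousOn.circleIntegrable zero_le_one

/-- On a fixed circle the ball means of `f n` converge uniformly to those of `F`, so that the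
submean inequality passes to the limit. -/
theorem ballMean_le_circleAverage_of_tendstoL1Loc
    (hf : ∀ n, IsSubharmonicOnLines (f n)) (h : TendstoL1Loc f F)
    (a b : ℂ × ℂ) {r : ℝ} (hr : 0 < r) :
    ballMean F r a ≤ Real.circleAverage (fun τ => ballMean F r (a + τ • b)) 0 1 := by
  have hfi := fun n => (hf n).locallyIntegrable
  set K := Metric.closedBall a (r + ‖b‖) with hKdef
  have hK : IsCompact K := isCompact_closedBall _ _
  set ε : ℕ → ℝ := fun n =>
    (volume.real (Metric.closedBall (0 : ℂ × ℂ) r))⁻¹ * ∫ p in K, ‖f n p - F p‖ with hε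
  have hε0 : Tendsto ε atTop (𝓝 0) := by
    rw [← mul_zero (volume.real (Metric.closedBall (0 : ℂ × ℂ) r))⁻¹]
    exact (h.integral_norm_sub hfi hK).const_mul _
  have hle : ∀ n, ballMean (f n) r a ≤
      Real.circleAverage (fun τ => ballMean F r (a + τ • b)) 0 1 + ε n := fun n => by
    refine ((hf n).ballMean_le_circleAverage a b hr).trans ?_
    rw [← Real.circleAverage_const (ε n) 0 1, ← Real.circleAverage_add
      (circleIntegrable_ballMean h.1 a b r) (circleIntegrable_const _ _ _)]
    refine Real.circleAverage_mono (circleIntegrable_ballMean (hfi n) a b r)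
      ((circleIntegrable_ballMean h.1 a b r).add (circleIntegrable_const _ _ _)) fun τ hτ => ?_
    have hsub : Metric.closedBall (a + τ • b) r ⊆ K := by
      refine Metric.closedBall_subset_closedBall' ?_
      rw [abs_one, mem_sphere_zero_iff_norm] at hτ
      simp [dist_eq_norm, norm_smul, hτ]
    have := (abs_le.1 (abs_ballMean_sub_le (hfi n) h.1 hK hsub)).2
    simp only [Pi.add_apply]
    linarith
  have := le_of_tendsto_of_tendsto' (tendsto_ballMean hf h r a) (tendsto_const_nhds.add hε0) hle
  simpa using this

end Limits

/-! ### Plurisubharmonic representatives of `L¹_loc` limits -/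

section Envelope

theorem coe_circleAverage_eq_circleMean {g : ℂ × ℂ → ℝ} (hg : Continuous g) (a b : ℂ × ℂ) :
    ((Real.circleAverage (fun τ => g (a + τ • b)) 0 1 : ℝ) : EReal) =
      circleMean (fun p => (g p : EReal)) a b := by
  have hcont : Continuous fun θ : ℝ => g (a + Complex.exp (θ * Complex.I) • b) :=
    hg.comp (by fun_prop)
  have hint : Integrable (fun θ : ℝ => g (a + Complex.exp (θ * Complex.I) • b))
      (volume.restrict (Set.Ioc 0 (2 * Real.pi))) :=
    (hcont.integrableOn_Icc).mono_set Set.Ioc_subset_Icc_self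
  have hpos : ∫⁻ θ in Set.Ioc 0 (2 * Real.pi),
      ENNReal.ofReal (g (a + Complex.exp (θ * Complex.I) • b)) ≠ ⊤ := hint.lintegral_lt_top.ne
  have hneg : ∫⁻ θ in Set.Ioc 0 (2 * Real.pi),
      ENNReal.ofReal (-g (a + Complex.exp (θ * Complex.I) • b)) ≠ ⊤ := hint.neg.lintegral_lt_top.ne
  have hπ : (ENNReal.ofReal (2 * Real.pi))⁻¹ ≠ ⊤ := by simp [Real.pi_pos]
  have hcoe : ∀ x : ENNReal, x ≠ ⊤ → (x : EReal) = ((x.toReal : ℝ) : EReal) := fun x hx =>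
    by rw [← EReal.toReal_coe_ennreal, EReal.coe_toReal (EReal.coe_ennreal_eq_top_iff.not.2 hx)
      (EReal.coe_ennreal_ne_bot x)]
  rw [circleMean]
  simp only [← EReal.coe_neg, EReal.toENNReal_of_ne_top (EReal.coe_ne_top _), EReal.toReal_coe]
  rw [hcoe _ (ENNReal.mul_ne_top hπ hpos), hcoe _ (ENNReal.mul_ne_top hπ hneg), ← EReal.coe_sub,
    EReal.coe_eq_coe_iff, Real.circleAverage_def,
    intervalIntegral.integral_of_le Real.two_pi_pos.le, smul_eq_mul]
  have hcm : ∀ θ : ℝ, circleMap 0 1 θ = Complex.exp (θ * Complex.I) := fun θ => by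
    simp [circleMap]
  simp only [hcm]
  rw [integral_eq_lintegral_pos_part_sub_lintegral_neg_part hint, ENNReal.toReal_mul,
    ENNReal.toReal_mul, ENNReal.toReal_inv, ENNReal.toReal_ofReal Real.two_pi_pos.le, mul_sub]

/-- A decreasing limit of continuous plurisubharmonic functions is plurisubharmonic. -/
theorem isPSH_iInf {g : ℕ → ℂ × ℂ → ℝ} (hc : ∀ n, Continuous (g n)) (hanti : Antitone g)
    (hsub : ∀ n a b, g n a ≤ Real.circleAverage (fun τ => g n (a + τ • b)) 0 1) :
    IsPSH fun p => ⨅ n, (g n p : EReal) := by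
  have hlim : ∀ p, Tendsto (fun n => (g n p : EReal)) atTop (𝓝 (⨅ n, (g n p : EReal))) := fun p =>
    tendsto_atTop_iInf fun m n hmn => EReal.coe_le_coe_iff.2 (hanti hmn p)
  have hcE : ∀ n, Continuous fun p => (g n p : EReal) := fun n =>
      continuous_coe_real_ereal.comp (hc n)
  refine ⟨fun p => ?_, upperSemicontinuous_iInf fun n => (hcE n).upperSemicontinuous, fun a b => ?_⟩
  · exact ((iInf_le _ 0).trans_lt (EReal.coe_lt_top (g 0 p))).ne
  · set γ : ℝ → ℂ × ℂ := fun θ => a + Complex.exp (θ * Complex.I) • b with hγ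
    have hγc : Continuous γ := by fun_prop
    have hpos : Tendsto (fun n => ∫⁻ θ in Set.Ioc 0 (2 * Real.pi), (g n (γ θ) : EReal).toENNReal)
        atTop (𝓝 (∫⁻ θ in Set.Ioc 0 (2 * Real.pi), (⨅ n, (g n (γ θ) : EReal)).toENNReal)) := by
      refine lintegral_tendsto_of_tendsto_of_antitone (fun n => ?_)
        (.of_forall fun θ m n hmn => ?_) ?_
        (.of_forall fun θ => ?_)
      · exact ((hcE n).comp hγc).ereal_toENNReal.measurable.aemeasurable
      · exact EReal.toENNReal_le_toENNReal (EReal.coe_le_coe_iff.2 (hanti hmn _))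
      · simp only [EReal.toENNReal_of_ne_top (EReal.coe_ne_top _), EReal.toReal_coe]
        exact (((hc 0).comp hγc).integrableOn_Icc.mono_set
          (Set.Ioc_subset_Icc_self : Set.Ioc 0 (2 * Real.pi) ⊆ _)).lintegral_lt_top.ne
      · exact (EReal.continuous_toENNReal.tendsto _).comp (hlim _)
    have hneg : Tendsto (fun n => ∫⁻ θ in Set.Ioc 0 (2 * Real.pi), (-(g n (γ θ) : EReal)).toENNReal)
        atTop (𝓝 (∫⁻ θ in Set.Ioc 0 (2 * Real.pi), (-⨅ n, (g n (γ θ) : EReal)).toENNReal)) := by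
      refine lintegral_tendsto_of_tendsto_of_monotone (fun n => ?_) (.of_forall fun θ m n hmn => ?_)
        (.of_forall fun θ => ?_)
      · exact ((hcE n).comp hγc).neg.ereal_toENNReal.measurable.aemeasurable
      · exact EReal.toENNReal_le_toENNReal
          (EReal.neg_le_neg_iff.2 (EReal.coe_le_coe_iff.2 (hanti hmn _)))
      · exact ((EReal.continuous_toENNReal.comp continuous_neg).tendsto _).comp (hlim _)
    have hπ : (ENNReal.ofReal (2 * Real.pi))⁻¹ ≠ ⊤ := by simp [Real.pi_pos]
    have hfin : ∫⁻ θ in Set.Ioc 0 (2 * Real.pi), (⨅ n, (g n (γ θ) : EReal)).toENNReal ≠ ⊤ := by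
      refine ne_top_of_le_ne_top ?_ (lintegral_mono fun θ =>
        EReal.toENNReal_le_toENNReal (iInf_le (fun n => (g n (γ θ) : EReal)) 0))
      simp only [EReal.toENNReal_of_ne_top (EReal.coe_ne_top _), EReal.toReal_coe]
      exact (((hc 0).comp hγc).integrableOn_Icc.mono_set
          (Set.Ioc_subset_Icc_self : Set.Ioc 0 (2 * Real.pi) ⊆ _)).lintegral_lt_top.ne
    have hmean : Tendsto (fun n => circleMean (fun p => (g n p : EReal)) a b) atTop
        (𝓝 (circleMean (fun p => ⨅ n, (g n p : EReal)) a b)) := by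
      have h1 := (continuous_coe_ennreal_ereal.tendsto _).comp
        (ENNReal.Tendsto.const_mul hpos (.inr hπ))
      have h2 := (continuous_neg.tendsto _).comp ((continuous_coe_ennreal_ereal.tendsto _).comp
        (ENNReal.Tendsto.const_mul hneg (.inr hπ)))
      refine (EReal.continuousAt_add (.inl ?_) (.inl ?_)).tendsto.comp (h1.prodMk_nhds h2)
      · exact EReal.coe_ennreal_eq_top_iff.not.2 (ENNReal.mul_ne_top hπ hfin)
      · exact EReal.coe_ennreal_ne_bot _
    refine ge_of_tendsto' hmean fun n => ?_
    rw [← coe_circleAverage_eq_circleMean (hc n)]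
    exact (iInf_le _ n).trans (EReal.coe_le_coe_iff.2 (hsub n a b))

/-- An `L¹_loc` limit of plurisubharmonic functions agrees almost everywhere with a plurisubharmonic
function, namely with the limit of its means over balls of decreasing radius. -/
theorem exists_isPSH_of_tendstoL1Loc {f : ℕ → ℂ × ℂ → ℝ} {F : ℂ × ℂ → ℝ}
    (hf : ∀ n, IsSubharmonicOnLines (f n)) (h : TendstoL1Loc f F) :
    ∃ G : ℂ × ℂ → EReal, IsPSH G ∧ ∀ᵐ p, G p = F p := by
  have hr : ∀ n : ℕ, (0 : ℝ) < 1 / ((n : ℝ) + 1) := fun n => Nat.one_div_pos_of_nat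
  have hanti : Antitone fun (n : ℕ) p => ballMean F (1 / ((n : ℝ) + 1)) p := fun m n hmn p =>
    ballMean_mono_of_tendstoL1Loc hf h p (hr n) (Nat.one_div_le_one_div hmn)
  refine ⟨_, isPSH_iInf (g := fun (n : ℕ) p => ballMean F (1 / ((n : ℝ) + 1)) p)
    (fun n => continuous_ballMean h.1 _) hanti
    fun n a b => ballMean_le_circleAverage_of_tendstoL1Loc hf h a b (hr n), ?_⟩
  filter_upwards [IsUnifLocDoublingMeasure.ae_tendsto_average volume h.1 1] with p hp
  have h1 : Tendsto (fun n : ℕ => ballMean F (1 / ((n : ℝ) + 1)) p) atTop (𝓝 (F p)) := by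
    refine hp (fun _ => p) (fun n : ℕ => 1 / ((n : ℝ) + 1)) ?_ (.of_forall fun n => ?_)
    · exact tendsto_nhdsWithin_iff.2 ⟨tendsto_one_div_add_atTop_nhds_zero_nat, .of_forall hr⟩
    · exact Metric.mem_closedBall_self (by rw [one_mul]; exact (hr n).le)
  refine tendsto_nhds_unique (tendsto_atTop_iInf fun m n hmn =>
    EReal.coe_le_coe_iff.2 (hanti hmn p)) ((continuous_coe_real_ereal.tendsto _).comp h1)

end Envelope

/-! ### The current `(i/π) ∂∂̄u` -/

section Currents

/-- Smooth compactly supported functions on `ℂ²`. -/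
abbrev TestScalar : Type := TestFunction (⊤ : Opens (ℂ × ℂ)) ℂ ⊤

/-- The coefficient `ω_{jk}` of a test form, as a continuous linear map. -/
def coeffCLM (j k : Fin 2) : TestForm →L[ℂ] TestScalar :=
  TestFunction.postcompCLM
    ((ContinuousLinearMap.proj (R := ℂ) (φ := fun _ : Fin 2 => ℂ) k).comp
      (ContinuousLinearMap.proj (R := ℂ) (φ := fun _ : Fin 2 => Fin 2 → ℂ) j))

/-- Multiplication by a constant on test functions. -/
def scalarCLM (c : ℂ) : TestScalar →L[ℂ] TestScalar :=
  TestFunction.postcompCLM (ContinuousLinearMap.mul ℂ ℂ c)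

/-- The operator `wirt s v` on test functions. -/
def wirtCLM (s : ℂ) (v : ℂ × ℂ) : TestScalar →L[ℂ] TestScalar :=
  (scalarCLM (1 / 2)).comp ((TestFunction.lineDerivCLM ℂ v : TestScalar →L[ℂ] TestScalar) +
    (scalarCLM s).comp (TestFunction.lineDerivCLM ℂ (Complex.I • v)))

theorem coe_coeffCLM (j k : Fin 2) (φ : TestForm) : ⇑(coeffCLM j k φ) = fun p => φ p j k := rfl

theorem coe_wirtCLM (s : ℂ) (v : ℂ × ℂ) (φ : TestScalar) : ⇑(wirtCLM s v φ) = wirt s v φ := by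
  have h : ∀ (v p : ℂ × ℂ), (TestFunction.lineDerivCLM ℂ v φ : TestScalar) p = fderiv ℝ φ p v :=
    fun v p => by
      rw [TestFunction.lineDerivCLM_eq_fderivCLM, TestFunction.fderivCLM_apply_of_le _ (by simp)]
  funext p
  rw [wirt, ← h, ← h]
  rfl

/-- The operator `ω ↦ (i/π) ∂∂̄ω`. -/
def ddbarCLM : TestForm →L[ℂ] TestScalar :=
  (scalarCLM (2 / Real.pi)).comp
    ((wirtCLM (-Complex.I) (basisVec 0)).comp ((wirtCLM Complex.I (basisVec 0)).comp
        (coeffCLM 1 1)) +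
      (wirtCLM (-Complex.I) (basisVec 1)).comp ((wirtCLM Complex.I (basisVec 1)).comp
          (coeffCLM 0 0)) -
      (wirtCLM (-Complex.I) (basisVec 0)).comp ((wirtCLM Complex.I (basisVec 1)).comp
          (coeffCLM 1 0)) -
      (wirtCLM (-Complex.I) (basisVec 1)).comp ((wirtCLM Complex.I (basisVec 0)).comp
          (coeffCLM 0 1)))

theorem coe_ddbarCLM (φ : TestForm) : ⇑(ddbarCLM φ) = ddbarDensity φ := by
  funext p
  simp only [ddbarDensity, dHol_eq_wirt, dAnti_eq_wirt, ← coe_coeffCLM, ← coe_wirtCLM]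
  rfl

/-- The current `(i/π) ∂∂̄u`, for a locally integrable function `u`. -/
def ddbarCurrent (u : ℂ × ℂ → ℝ) : Current :=
  (TestFunction.integralAgainstBilinCLM (ContinuousLinearMap.mul ℂ ℂ).flip volume
    fun p => (u p : ℂ)).comp ddbarCLM

theorem locallyIntegrable_ofReal {u : ℂ × ℂ → ℝ} (hu : LocallyIntegrable u) :
    LocallyIntegrable fun p => (u p : ℂ) := fun p => by
  obtain ⟨s, hs, h⟩ := hu p
  exact ⟨s, hs, h.ofReal⟩

theorem ddbarCurrent_apply {u : ℂ × ℂ → ℝ} (hu : LocallyIntegrable u) (φ : TestForm) :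
    ddbarCurrent u φ = ∫ p, (u p : ℂ) * ddbarDensity φ p := by
  rw [ddbarCurrent, ContinuousLinearMap.comp_apply, TestFunction.integralAgainstBilinCLM_eq_integral
    ((locallyIntegrable_ofReal hu).locallyIntegrableOn _), coe_ddbarCLM]
  rfl

theorem continuous_ddbarDensity (φ : TestForm) : Continuous (ddbarDensity φ) :=
  coe_ddbarCLM φ ▸ (ddbarCLM φ).continuous

theorem hasCompactSupport_ddbarDensity (φ : TestForm) : HasCompactSupport (ddbarDensity φ) :=
  coe_ddbarCLM φ ▸ (ddbarCLM φ).hasCompactSupport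

theorem integrable_mul_ddbarDensity {u : ℂ × ℂ → ℝ} (hu : LocallyIntegrable u) (φ : TestForm) :
    Integrable fun p => (u p : ℂ) * ddbarDensity φ p := by
  simpa only [smul_eq_mul] using
    (locallyIntegrable_ofReal hu).integrable_smul_right_of_hasCompactSupport
    (continuous_ddbarDensity φ) (hasCompactSupport_ddbarDensity φ)

theorem integral_ddbarDensity (φ : TestForm) : ∫ p, ddbarDensity φ p = 0 := by
  have hs := φ.contDiff_apply
  have hc := φ.hasCompactSupport_apply
  have hi : ∀ (s s' : ℂ) (v w : ℂ × ℂ) (j k : Fin 2),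
      Integrable (wirt s v (wirt s' w fun q => φ q j k)) := fun s s' v w j k =>
    (contDiff_wirt (contDiff_wirt (hs j k))).continuous.integrable_of_hasCompactSupport
      (hasCompactSupport_wirt (hasCompactSupport_wirt (hc j k)))
  have h0 : ∀ (s s' : ℂ) (v w : ℂ × ℂ) (j k : Fin 2),
      ∫ p, wirt s v (wirt s' w fun q => φ q j k) p = 0 := fun s s' v w j k =>
    integral_wirt_eq_zero (contDiff_wirt (hs j k)) (hasCompactSupport_wirt (hc j k))
  simp only [ddbarDensity, dHol_eq_wirt, dAnti_eq_wirt]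
  rw [integral_const_mul, integral_add_sub_sub (hi _ _ _ _ _ _) (hi _ _ _ _ _ _) (hi _ _ _ _ _ _)
    (hi _ _ _ _ _ _)]
  simp only [h0]
  simp

/-- `∂∂̄(dη) = 0` for a `1`-form `η`, as all derivatives commute. -/
theorem ddbarDensity_eq_zero_of_exact (a b : TestCovector) (φ : TestForm)
    (h : ∀ p j k, φ p j k =
      -2 * Complex.I * (dHol j (fun q => b q k) p - dAnti k (fun q => a q j) p)) (p : ℂ × ℂ) :
    ddbarDensity φ p = 0 := by
  have ha : ∀ j, ContDiff ℝ ∞ fun q => a q j := fun j => contDiff_pi.1 a.contDiff j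
  have hb : ∀ k, ContDiff ℝ ∞ fun q => b q k := fun k => contDiff_pi.1 b.contDiff k
  have hcomm : ∀ {s s' : ℂ} {v w : ℂ × ℂ} {f : ℂ × ℂ → ℂ}, ContDiff ℝ ∞ f →
      wirt s v (wirt s' w f) = wirt s' w (wirt s v f) := fun hf => funext fun p => wirt_comm hf
  have hlin : ∀ {s : ℂ} {v : ℂ × ℂ} (c : ℂ) {f g : ℂ × ℂ → ℂ}, ContDiff ℝ ∞ f → ContDiff ℝ ∞ g →
      (wirt s v fun p => c * (f p - g p)) = fun p => c * (wirt s v f p - wirt s v g p) :=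
    fun c f g hf hg => funext fun p => by
      have hf := hf.differentiable (by simp) p
      have hg := hg.differentiable (by simp) p
      rw [wirt_const_mul (f := fun p => f p - g p) c (hf.sub hg), wirt_sub hf hg]
  have key : ∀ l m j k, dHol l (dAnti m fun q => φ q j k) p = -2 * Complex.I *
      (wirt (-Complex.I) (basisVec l) (wirt (-Complex.I) (basisVec j)
          (wirt Complex.I (basisVec m) fun q => b q k)) p -
        wirt (-Complex.I) (basisVec l) (wirt Complex.I (basisVec m)
          (wirt Complex.I (basisVec k) fun q => a q j)) p) := fun l m j k => by
    have e : (fun q => φ q j k) = fun q => -2 * Complex.I *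
        (wirt (-Complex.I) (basisVec j) (fun q => b q k) q -
          wirt Complex.I (basisVec k) (fun q => a q j) q) := funext fun q => by
      rw [h, dHol_eq_wirt, dAnti_eq_wirt]
    have hD := contDiff_wirt (s := -Complex.I) (v := basisVec j) (hb k)
    have hA := contDiff_wirt (s := Complex.I) (v := basisVec k) (ha j)
    rw [e, dHol_eq_wirt, dAnti_eq_wirt, hlin _ hD hA, hlin _ (contDiff_wirt hD) (contDiff_wirt hA),
      hcomm (hb k)]
  have e1 := fun k m => hcomm (s := -Complex.I) (v := basisVec 0) (s' := -Complex.I)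
    (w := basisVec 1)
    (contDiff_wirt (s := Complex.I) (v := basisVec m) (hb k))
  have e2 := fun j => hcomm (s := Complex.I) (v := basisVec 0) (s' := Complex.I)
    (w := basisVec 1) (ha j)
  rw [ddbarDensity, key, key, key, key, e1, e1, e2, e2]
  ring

theorem ddbarCurrent_isClosed {u : ℂ × ℂ → ℝ} (hu : LocallyIntegrable u) :
    (ddbarCurrent u).IsClosed := fun a b φ h => by
  simp [ddbarCurrent_apply hu, ddbarDensity_eq_zero_of_exact a b φ h]

/-- `(i/π) ∂∂̄` is continuous from `L¹_loc` to currents. -/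
theorem tendsto_ddbarCurrent {f : ℕ → ℂ × ℂ → ℝ} {F : ℂ × ℂ → ℝ}
    (hf : ∀ n, LocallyIntegrable (f n)) (h : TendstoL1Loc f F) (φ : TestForm) :
    Tendsto (fun n => ddbarCurrent (f n) φ) atTop (𝓝 (ddbarCurrent F φ)) := by
  obtain ⟨C, hC⟩ := (hasCompactSupport_ddbarDensity φ).exists_bound_of_continuous
    (continuous_ddbarDensity φ)
  set K := tsupport (ddbarDensity φ) with hKdef
  have hK : IsCompact K := hasCompactSupport_ddbarDensity φ
  rw [tendsto_iff_norm_sub_tendsto_zero]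
  have h0 := (h.integral_norm_sub hf hK).const_mul C
  rw [mul_zero] at h0
  refine squeeze_zero (fun _ => norm_nonneg _) (fun n => ?_) h0
  rw [ddbarCurrent_apply (hf n), ddbarCurrent_apply h.1,
    ← integral_sub (integrable_mul_ddbarDensity (hf n) φ) (integrable_mul_ddbarDensity h.1 φ),
    ← setIntegral_eq_integral_of_forall_compl_eq_zero (s := K), ← integral_const_mul]
  · refine norm_integral_le_of_norm_le ?_ (.of_forall fun p => ?_)
    · exact (((hf n).sub h.1).integrableOn_isCompact hK).norm.const_mul C
    · rw [← sub_mul, norm_mul, mul_comm, ← Complex.ofReal_sub, Complex.norm_real]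
      exact mul_le_mul_of_nonneg_right (hC p) (norm_nonneg _)
  · intro p hp
    rw [image_eq_zero_of_notMem_tsupport hp, mul_zero, mul_zero, sub_zero]

end Currents

/-! ### Zero divisors of polynomials -/

section ZeroDivisors

/-- The Poincaré-Lelong formula for a product of irreducible polynomials. -/
theorem integral_sum_log_mul_ddbarDensity (m : Multiset (MvPolynomial (Fin 2) ℂ))
    (hm : ∀ Q ∈ m, Irreducible Q) (φ : TestForm) :
    Integrable (fun p => ((m.map fun Q => Real.log ‖ev Q p‖).sum : ℂ) * ddbarDensity φ p) ∧
    ∫ p, ((m.map fun Q => Real.log ‖ev Q p‖).sum : ℂ) * ddbarDensity φ p =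
      (m.map fun Q => curveIntegral Q φ).sum := by
  induction m using Multiset.induction with
  | empty => simp
  | cons Q m ih =>
    obtain ⟨h1, h2⟩ := ih fun Q hQ => hm Q (Multiset.mem_cons_of_mem hQ)
    have hQ := hm Q (Multiset.mem_cons_self Q m)
    have h3 := integrable_mul_ddbarDensity (locallyIntegrable_log_norm_ev hQ.ne_zero) φ
    simp only [Multiset.map_cons, Multiset.sum_cons, Complex.ofReal_add, add_mul]
    exact ⟨h3.add h1, by rw [integral_add h3 h1, h2, (poincare_lelong hQ φ).2.2]⟩

theorem log_norm_prod (m : Multiset (MvPolynomial (Fin 2) ℂ)) {p : ℂ × ℂ} (hp : ev m.prod p ≠ 0) :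
    Real.log ‖ev m.prod p‖ = (m.map fun Q => Real.log ‖ev Q p‖).sum := by
  induction m using Multiset.induction with
  | empty => simp [ev]
  | cons Q m ih =>
    rw [Multiset.prod_cons, ev_mul] at hp ⊢
    rw [norm_mul, Real.log_mul (norm_ne_zero_iff.2 (left_ne_zero_of_mul hp))
      (norm_ne_zero_iff.2 (right_ne_zero_of_mul hp)), ih (right_ne_zero_of_mul hp),
      Multiset.map_cons, Multiset.sum_cons]

/-- `log |P|` is, up to an additive constant, the sum of `log |Q|` over the irreducible factors `Q`
of `P`. -/
theorem exists_log_norm_eq_sum_factors {P : MvPolynomial (Fin 2) ℂ} (hP : P ≠ 0) :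
    ∃ c : ℝ, ∀ᵐ p, Real.log ‖ev P p‖ =
      c + ((UniqueFactorizationMonoid.factors P).map fun Q => Real.log ‖ev Q p‖).sum := by
  obtain ⟨u, hu⟩ := UniqueFactorizationMonoid.factors_prod hP
  obtain ⟨a, -, ha⟩ := MvPolynomial.isUnit_iff_eq_C_of_isReduced.1 u.isUnit
  refine ⟨Real.log ‖a‖, ?_⟩
  filter_upwards [ae_ev_ne_zero hP] with p hp
  have h : ev P p = ev (UniqueFactorizationMonoid.factors P).prod p * a := by
    conv_lhs => rw [← hu, ha, ev_mul, ev_C]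
  rw [h] at hp ⊢
  rw [norm_mul, Real.log_mul (norm_ne_zero_iff.2 (left_ne_zero_of_mul hp))
    (norm_ne_zero_iff.2 (right_ne_zero_of_mul hp)), log_norm_prod _ (left_ne_zero_of_mul hp),
        add_comm]

/-- The Poincaré-Lelong formula: `(i/π) ∂∂̄ log |P|` is the current of integration over the zero
divisor of `P`. -/
theorem isZeroDivisorCurrent_ddbarCurrent {P : MvPolynomial (Fin 2) ℂ} (hP : P ≠ 0) :
    IsZeroDivisorCurrent P (ddbarCurrent fun p => Real.log ‖ev P p‖) := by
  intro φ
  have hirr : ∀ Q ∈ UniqueFactorizationMonoid.factors P, Irreducible Q := fun Q hQ =>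
    UniqueFactorizationMonoid.irreducible_of_factor Q hQ
  refine ⟨fun Q hQ => ⟨(poincare_lelong (hirr Q hQ) φ).1, (poincare_lelong (hirr Q hQ) φ).2.1⟩, ?_⟩
  obtain ⟨c, hc⟩ := exists_log_norm_eq_sum_factors hP
  obtain ⟨h1, h2⟩ := integral_sum_log_mul_ddbarDensity _ hirr φ
  have h3 : Integrable fun p => (c : ℂ) * ddbarDensity φ p :=
    ((continuous_ddbarDensity φ).integrable_of_hasCompactSupport
      (hasCompactSupport_ddbarDensity φ)).const_mul _
  have h4 : ∫ p, (c : ℂ) * ddbarDensity φ p = 0 := by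
    rw [integral_const_mul, integral_ddbarDensity, mul_zero]
  rw [ddbarCurrent_apply (locallyIntegrable_log_norm_ev hP), ← h2]
  refine Eq.trans ?_ ((integral_add h3 h1).trans (by rw [h4, zero_add]))
  refine integral_congr_ae ?_
  filter_upwards [hc] with p hp
  rw [hp, Complex.ofReal_add, add_mul]

open scoped ComplexOrder in
theorem curveIntegral_nonneg (Q : MvPolynomial (Fin 2) ℂ) {φ : TestForm} (hφ : φ.IsPositive) :
    0 ≤ curveIntegral Q φ := by
  have hline : ∀ p v, 0 ≤ onLine (φ p) v := fun p v =>
    Complex.nonneg_iff.2 ⟨(hφ p v).1, (hφ p v).2.symm⟩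
  have hint : ∀ f : ℂ → ℂ, (∀ z, 0 ≤ f z) → 0 ≤ ∫ z, f z := fun f hf => by
    have : f = fun z => ((f z).re : ℂ) := funext fun z =>
      Complex.eq_re_of_ofReal_le (r := 0) (by simpa using hf z)
    rw [this, integral_complex_ofReal]
    exact Complex.zero_le_real.2 (integral_nonneg fun z => (Complex.nonneg_iff.1 (hf z)).1)
  refine add_nonneg (hint _ fun z => ?_) (hint _ fun t => ?_)
  · exact finsum_mem_induction (fun x : ℂ => 0 ≤ x) le_rfl (fun _ _ => add_nonneg)
      fun t _ => hline _ _
  · exact finsum_mem_induction (fun x : ℂ => 0 ≤ x) le_rfl (fun _ _ => add_nonneg)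
      fun t _ => hline _ _

end ZeroDivisors

/-! ### Lee-Yang-Fisher zeros -/

section LeeYangFisherZeros

variable {V : Type*} [Fintype V] [DecidableEq V] (Γ : SimpleGraph V) [DecidableRel Γ.Adj]

theorem clearedPartition_ne_zero : clearedPartition Γ ≠ 0 := by
  intro h
  -- At `z = t = 1` every spin configuration contributes `1`.
  have h1 : MvPolynomial.eval (fun _ => (1 : ℂ)) (clearedPartition Γ) =
      (Fintype.card (V → ℤˣ) : ℂ) := by
    simp [clearedPartition]
  rw [h, map_zero] at h1
  exact Fintype.card_ne_zero (Nat.cast_eq_zero.1 h1.symm)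

end LeeYangFisherZeros

end LeeYangFisher

theorem mainTheorem10 {V : ℕ → Type*} [∀ n, Fintype (V n)] [∀ n, DecidableEq (V n)]
    (Γ : ∀ n, SimpleGraph (V n)) [∀ n, DecidableRel (Γ n).Adj]
    (hE : ∀ n, 0 < LeeYangFisher.numEdges (Γ n))
    (F : ℂ × ℂ → ℝ)
    (hF : LeeYangFisher.TendstoL1Loc
      (fun n p => 1 / (2 * (LeeYangFisher.numEdges (Γ n) : ℝ)) *
        LeeYangFisher.freeEnergy (Γ n) p) F) :
    ∃ (S : ℕ → LeeYangFisher.Current) (μ : LeeYangFisher.Current),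
      (∀ n, LeeYangFisher.IsZeroDivisorCurrent (LeeYangFisher.clearedPartition (Γ n)) (S n)) ∧
      μ.IsClosed ∧ μ.IsPositive ∧
      (∀ ω : LeeYangFisher.TestForm,
        Tendsto (fun n => 1 / (2 * (LeeYangFisher.numEdges (Γ n) : ℂ)) * S n ω) atTop
          (𝓝 (μ ω))) ∧
      ∃ G : ℂ × ℂ → EReal,
        LeeYangFisher.IsPluripotential G μ ∧ ∀ᵐ p, G p = (F p : EReal) := by
  have hsub := fun n => LeeYangFisher.isSubharmonicOnLines_log_norm
    (LeeYangFisher.clearedPartition_ne_zero (Γ n))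
    (c := 1 / (2 * (LeeYangFisher.numEdges (Γ n) : ℝ))) (by positivity)
  have hS := fun n => LeeYangFisher.isZeroDivisorCurrent_ddbarCurrent
    (LeeYangFisher.clearedPartition_ne_zero (Γ n))
  have hlim : ∀ ω : LeeYangFisher.TestForm,
      Tendsto (fun n => 1 / (2 * (LeeYangFisher.numEdges (Γ n) : ℂ)) *
        LeeYangFisher.ddbarCurrent (LeeYangFisher.freeEnergy (Γ n)) ω) atTop
          (𝓝 (LeeYangFisher.ddbarCurrent F ω)) := fun ω => by
    refine (LeeYangFisher.tendsto_ddbarCurrent (fun n => (hsub n).locallyIntegrable) hF ω).congr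
      fun n => ?_
    rw [LeeYangFisher.ddbarCurrent_apply (hsub n).locallyIntegrable,
      LeeYangFisher.ddbarCurrent_apply (u := LeeYangFisher.freeEnergy (Γ n))
        (LeeYangFisher.locallyIntegrable_log_norm_ev
          (LeeYangFisher.clearedPartition_ne_zero (Γ n))), ← integral_const_mul]
    refine integral_congr_ae (.of_forall fun p => ?_)
    simp only [LeeYangFisher.freeEnergy, LeeYangFisher.ev]
    push_cast
    ring
  obtain ⟨G, hG, hGF⟩ := LeeYangFisher.exists_isPSH_of_tendstoL1Loc hsub hF
  have hGF' : (fun p => (G p).toReal) =ᵐ[volume] F := by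
    filter_upwards [hGF] with p hp
    rw [hp, EReal.toReal_coe]
  refine ⟨fun n => LeeYangFisher.ddbarCurrent (LeeYangFisher.freeEnergy (Γ n)),
    LeeYangFisher.ddbarCurrent F, hS, LeeYangFisher.ddbarCurrent_isClosed hF.1,
    fun ω hω => ?_, hlim,
    G, ⟨hG, ?_, ?_, fun ω => ?_⟩, hGF⟩
  · -- `μ ω` is a limit of nonnegative multiples of integrals of `ω` over curves.
    open scoped ComplexOrder in
    have h0 : 0 ≤ LeeYangFisher.ddbarCurrent F ω := by
      refine ge_of_tendsto' (hlim ω) fun n => mul_nonneg ?_ ?_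
      · have h : (0 : ℝ) ≤ 1 / (2 * (LeeYangFisher.numEdges (Γ n) : ℝ)) := by positivity
        simpa only [Complex.ofReal_div, Complex.ofReal_one, Complex.ofReal_mul,
          Complex.ofReal_ofNat, Complex.ofReal_natCast] using Complex.zero_le_real.2 h
      · refine ((hS n ω).2).symm ▸ Multiset.sum_nonneg fun x hx => ?_
        obtain ⟨Q, -, rfl⟩ := Multiset.mem_map.1 hx
        exact LeeYangFisher.curveIntegral_nonneg Q hω
    open scoped ComplexOrder in
    exact ⟨(Complex.nonneg_iff.1 h0).1, (Complex.nonneg_iff.1 h0).2.symm⟩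
  · filter_upwards [hGF] with p hp
    rw [hp]
    exact EReal.coe_ne_bot _
  · exact hF.1.congr hGF'.symm
  · rw [LeeYangFisher.ddbarCurrent_apply hF.1]
    refine integral_congr_ae ?_
    filter_upwards [hGF'] with p hp
    rw [hp]

end
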